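/- Let $\mathcal H=\ell^2(\mathbb N)$ be the Hilbert space of a harmonic oscillator with Fock states $|n\rangle$ and annihilation operator $\mathbf a$; put $\mathcal D(\mathbf L)\rho=\mathbf L\rho\mathbf L^\dagger-\tfrac12(\mathbf L^\dagger\mathbf L\rho+\rho\mathbf L^\dagger\mathbf L)$. For $\theta>0$ and pair amplitudes $\beta_{gg},\beta_{ge},\beta_{eg},\beta_{ee}\in\mathbb C$ consider the Lindblad equation $$\tfrac{d}{d\tau}\rho=-i[\mathbf H,\rho]+\mathcal D(\mathbf L_1)\rho,\qquad(\ast)$$ $$\mathbf H=-i\theta(\mathbf Q-\mathbf Q^\dagger),\quad \mathbf Q=\big[\beta_{gg}(\beta_{ge}^*+\beta_{eg}^*)+\beta_{ee}^*(\beta_{ge}+\beta_{eg})\big]\mathbf a,\quad \mathbf L_1=\sqrt2\,\theta\,(\beta_{gg}\mathbf a-\beta_{ee}\mathbf a^\dagger),$$ where solutions are curves $\tau\mapsto\rho(\tau)$, $\tau\ge0$, of density operators that satisfy $(\ast)$ weakly, i.e. in matrix elements between finite linear combinations of Fock states. Let $$\mathbf D(\alpha)=\exp(\alpha\mathbf a^\dagger-\alpha^*\mathbf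 a),\qquad \mathbf S(\zeta)=\exp\big(\tfrac12(\zeta^*\mathbf a^2-\zeta(\mathbf a^\dagger)^2)\big),\qquad |\alpha,\zeta\rangle=\mathbf D(\alpha)\mathbf S(\zeta)|0\rangle.$$ These exponentials are well defined: each is the time-one element of a strongly continuous unitary group whose generator extends the exponent on finite combinations of Fock states, and it is uniquely determined by this. We say that $(\ast)$ *stabilizes $|\alpha,\zeta\rangle$ at rate $\kappa>0$* if (a) every density operator is the initial value of a solution; (b) $|\alpha,\zeta\rangle\langle\alpha,\zeta|$ is stationary; (c) every solution converges to it in trace norm as $\tau\to\infty$; (d) for every solution the excitation number above the target, $E(\rho)=\sum_n n\,\langle n|V^\dagger\rho V|n\rangle\in[0,\infty]$ with $V=\mathbf D(\alpha)\mathbf S(\zeta)$, satisfies $E(\rho(\tau))=e^{-\kappa\tau}E(\rho(0))$, and $1-\langle\alpha,\zeta|\rho(\tau)|\alpha,\zeta\rangle\le e^{-\kappa\tau}E(\rho(0))$; (e) some solution with $E(\rho(0))=1$ has $1-\langle\alpha,\zeta|\rho(\tau)|\alpha,\zeta\rangle=e^{-\kappa\tau}$ for all $\tau\ge0$. Let $\alpha=|\alpha|e^{i\phi_\alpha}\in\mathbb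 C$, $r,\phi_r\in\mathbb R$, $\zeta=re^{i\phi_r}$, and let $$\beta_{gg}=\cos\epsilon\cos u,\quad \beta_{ee}=e^{i\mu}\cos\epsilon\sin u,\quad \beta_{ge}=\beta_{eg}=e^{i\chi}\sin\epsilon/\sqrt2,$$ with $\mu=\phi_r$; $u\in(-\tfrac\pi4,\tfrac\pi4)$, $\tan u=-\tanh r$; and $$\tan\chi=\frac{\sin\phi_\alpha-\tanh r\,\sin(\phi_\alpha-\phi_r)}{\cos\phi_\alpha+\tanh r\,\cos(\phi_\alpha-\phi_r)},$$ understood on the branch where $(\cos\chi,\sin\chi)$ is a positive multiple of (denominator, numerator). Put $$\epsilon_0(\theta)=\frac{\theta|\alpha|}{\sqrt2}\sqrt{\frac{(1+\sin2u)(1-\sin2u)}{1+\cos(\phi_r-2\chi)\sin2u}},\qquad \kappa=2\theta^2\,\frac{1-\tanh^2|r|}{1+\tanh^2|r|}.$$ **Theorem 1.** (i) *Exact tuning.* If $\tan\epsilon=\epsilon_0(\theta)$ with $|\epsilon|<\pi/2$, then $(\ast)$ stabilizes $|\alpha,re^{i\phi_r}\rangle$ at rate $\kappa\cos^2\epsilon$.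 (ii) *Leading-order tuning.* If $\epsilon=\epsilon_0(\theta)$ and $\cos\epsilon\ne0$, then $(\ast)$ stabilizes $|\tfrac{\tan\epsilon}{\epsilon}\alpha,re^{i\phi_r}\rangle$ (read as $|0,re^{i\phi_r}\rangle$ if $\alpha=0$) at rate $\kappa\cos^2\epsilon$. As $\theta\to0^+$ this is the target $|\alpha,re^{i\phi_r}\rangle$ with rate $\kappa$ up to second-order corrections: $\tfrac{\tan\epsilon}{\epsilon}\alpha-\alpha$, the norm distance between the two state vectors, and $\kappa\cos^2\epsilon/\kappa-1$ are all $O(\theta^2)$. -/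

import Mathlib

open Filter Topology Asymptotics
open scoped ENNReal InnerProductSpace

noncomputable section

namespace SqueezedReservoir

/-! ### The oscillator: Fock space, ladder operators -/

/-- The Hilbert space of the harmonic oscillator, `ℓ²(ℕ)`; coordinate `n` belongs to the
Fock state `|n⟩`. -/
abbrev Osc : Type := lp (fun _ : ℕ => ℂ) 2

/-- Finite linear combinations of Fock states: the common domain of all polynomials in the
ladder operators. -/
abbrev Fin0 : Type := ℕ →₀ ℂ

/-- The Fock state `|n⟩`. -/
def fock (n : ℕ) : Osc := lp.single 2 n (1 : ℂ)

/-- The inclusion of the finite combinations of Fock states into the Hilbert space. -/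
def incl : Fin0 →ₗ[ℂ] Osc := Finsupp.linearCombination ℂ fock

/-- Annihilation operator: `a |n⟩ = √n |n-1⟩` (so `a |0⟩ = 0`). -/
def ann : Module.End ℂ Fin0 :=
  Finsupp.linearCombination ℂ (fun n : ℕ => Finsupp.single (n - 1) ((Real.sqrt n : ℝ) : ℂ))

/-- Creation operator: `a† |n⟩ = √(n+1) |n+1⟩`. -/
def cre : Module.End ℂ Fin0 :=
  Finsupp.linearCombination ℂ
    (fun n : ℕ => Finsupp.single (n + 1) ((Real.sqrt (n + 1) : ℝ) : ℂ))

/-- The operator `c a + d a†`. -/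
def lin (c d : ℂ) : Module.End ℂ Fin0 := c • ann + d • cre

/-- The adjoint of `c a + d a†`, namely `d* a + c* a†`. -/
def linDag (c d : ℂ) : Module.End ℂ Fin0 := lin (star d) (star c)

/-! ### Unitary exponentials, displacement, squeezing -/

/-- `V = exp A` for a skew-symmetric operator `A` on the finite Fock combinations: `V` is the
time-one element of a strongly continuous one-parameter unitary group whose generator
extends `A`. -/
def IsUnitaryExp (A : Module.End ℂ Fin0) (V : Osc ≃ₗᵢ[ℂ] Osc) : Prop :=
  ∃ U : ℝ → (Osc ≃ₗᵢ[ℂ] Osc),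
    (∀ s t : ℝ, ∀ v : Osc, U (s + t) v = U s (U t v)) ∧
    (∀ v : Osc, Continuous fun t : ℝ => U t v) ∧
    (∀ x : Fin0, HasDerivAt (fun t : ℝ => U t (incl x)) (incl (A x)) 0) ∧
    U 1 = V

/-- The unitary `exp A` (meaningful when there is exactly one `V` with `IsUnitaryExp A V`). -/
def unitaryExp (A : Module.End ℂ Fin0) : Osc ≃ₗᵢ[ℂ] Osc :=
  Classical.epsilon (IsUnitaryExp A)

/-- `α a† - α* a`. -/
def displacementGen (α : ℂ) : Module.End ℂ Fin0 := α • cre - star α • ann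

/-- `(ζ* a² - ζ (a†)²) / 2`. -/
def squeezingGen (ζ : ℂ) : Module.End ℂ Fin0 :=
  (1 / 2 : ℂ) • (star ζ • (ann * ann) - ζ • (cre * cre))

/-- Displacement operator `D(α)`. -/
def displacement (α : ℂ) : Osc ≃ₗᵢ[ℂ] Osc := unitaryExp (displacementGen α)

/-- Squeezing operator `S(ζ)`. -/
def squeezing (ζ : ℂ) : Osc ≃ₗᵢ[ℂ] Osc := unitaryExp (squeezingGen ζ)

/-- The displaced squeezed Fock state `D(α) S(ζ) |n⟩`. -/
def squeezedFock (α ζ : ℂ) (n : ℕ) : Osc := displacement α (squeezing ζ (fock n))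

/-- The squeezed coherent state `|α, ζ⟩ = D(α) S(ζ) |0⟩`. -/
def squeezedCoherent (α ζ : ℂ) : Osc := squeezedFock α ζ 0

/-! ### Density operators and trace norm -/

/-- Density operators: positive, of trace one. -/
def IsDensity (ρ : Osc →L[ℂ] Osc) : Prop :=
  ρ.IsPositive ∧ HasSum (fun n : ℕ => ⟪fock n, ρ (fock n)⟫_ℂ) 1

/-- The absolute value `|T| = √(T† T)` of a bounded operator. -/
def absOp {E : Type*} [NormedAddCommGroup E] [InnerProductSpace ℂ E] [CompleteSpace E]
    (T : E →L[ℂ] E) : E →L[ℂ] E := CFC.abs T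

/-- The trace norm `Tr |T|`, valued in `[0, ∞]`. -/
def traceNorm (T : Osc →L[ℂ] Osc) : ℝ≥0∞ :=
  ∑' n : ℕ, ENNReal.ofReal (⟪fock n, absOp T (fock n)⟫_ℂ).re

/-- The rank-one operator `|ψ⟩⟨ψ|`. -/
def pureState (ψ : Osc) : Osc →L[ℂ] Osc := InnerProductSpace.rankOne ℂ ψ ψ

/-! ### The Lindblad equation of the qubit-pair reservoir -/

/-- Amplitudes of the pair state `β_gg |gg⟩ + β_ge |ge⟩ + β_eg |eg⟩ + β_ee |ee⟩`. -/
structure PairState where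
  gg : ℂ
  ge : ℂ
  eg : ℂ
  ee : ℂ

/-- `β_gg = cos ε cos u`, `β_ee = e^{iμ} cos ε sin u`, `β_ge = β_eg = e^{iχ} sin ε / √2`. -/
def pairState (ε u μ χ : ℝ) : PairState where
  gg := (Real.cos ε * Real.cos u : ℝ)
  ge := Complex.exp (Complex.I * χ) * ((Real.sin ε / Real.sqrt 2 : ℝ) : ℂ)
  eg := Complex.exp (Complex.I * χ) * ((Real.sin ε / Real.sqrt 2 : ℝ) : ℂ)
  ee := Complex.exp (Complex.I * μ) * ((Real.cos ε * Real.sin u : ℝ) : ℂ)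

/-- The coefficient of `a` in `Q`. -/
def qCoeff (β : PairState) : ℂ :=
  β.gg * (star β.ge + star β.eg) + star β.ee * (β.ge + β.eg)

/-- `H = -iθ (Q - Q†)` with `Q = qCoeff β · a`. -/
def hamiltonian (θ : ℝ) (β : PairState) : Module.End ℂ Fin0 :=
  (-Complex.I * θ) • (lin (qCoeff β) 0 - linDag (qCoeff β) 0)

/-- `L₁ = √2 θ (β_gg a - β_ee a†)`. -/
def jump (θ : ℝ) (β : PairState) : Module.End ℂ Fin0 :=
  lin (((Real.sqrt 2 * θ : ℝ) : ℂ) * β.gg) (-(((Real.sqrt 2 * θ : ℝ) : ℂ) * β.ee))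

/-- `L₁†`. -/
def jumpDag (θ : ℝ) (β : PairState) : Module.End ℂ Fin0 :=
  linDag (((Real.sqrt 2 * θ : ℝ) : ℂ) * β.gg) (-(((Real.sqrt 2 * θ : ℝ) : ℂ) * β.ee))

/-- The matrix element
`⟨x| -i[H, ρ] + L ρ L† - (L† L ρ + ρ L† L) / 2 |y⟩` for finite Fock combinations `x`, `y`,
with the (symmetric) `H`, and `L`, `L†`, `L† L` moved onto the test vectors. -/
def lindbladForm (H L Ld : Module.End ℂ Fin0) (ρ : Osc →L[ℂ] Osc) (x y : Fin0) : ℂ :=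
  -Complex.I * (⟪incl (H x), ρ (incl y)⟫_ℂ - ⟪incl x, ρ (incl (H y))⟫_ℂ)
    + ⟪incl (Ld x), ρ (incl (Ld y))⟫_ℂ
    - (1 / 2 : ℂ) *
      (⟪incl (Ld (L x)), ρ (incl y)⟫_ℂ + ⟪incl x, ρ (incl (Ld (L y)))⟫_ℂ)

/-- `ρ` is, for times `τ ≥ 0`, a curve of density operators that solves
`dρ/dτ = -i[H, ρ] + D(L₁) ρ`, weakly on the finite Fock combinations. -/
def IsLindbladSolution (θ : ℝ) (β : PairState) (ρ : ℝ → (Osc →L[ℂ] Osc)) : Prop :=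
  (∀ t : ℝ, 0 ≤ t → IsDensity (ρ t)) ∧
  ∀ t : ℝ, 0 ≤ t → ∀ x y : Fin0,
    HasDerivWithinAt (fun s : ℝ => ⟪incl x, ρ s (incl y)⟫_ℂ)
      (lindbladForm (hamiltonian θ β) (jump θ β) (jumpDag θ β) (ρ t) x y) (Set.Ici 0) t

/-! ### Stabilization -/

/-- The mean excitation number above `|α, ζ⟩`: the expectation `Tr (ρ V a† a V†)` with
`V = D(α) S(ζ)`, valued in `[0, ∞]`. -/
def excitation (α ζ : ℂ) (ρ : Osc →L[ℂ] Osc) : ℝ≥0∞ :=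
  ∑' n : ℕ, ENNReal.ofReal (n * (⟪squeezedFock α ζ n, ρ (squeezedFock α ζ n)⟫_ℂ).re)

/-- The population `1 - ⟨α, ζ| ρ |α, ζ⟩` outside the state `|α, ζ⟩`. -/
def infidelity (α ζ : ℂ) (ρ : Osc →L[ℂ] Osc) : ℝ :=
  1 - (⟪squeezedCoherent α ζ, ρ (squeezedCoherent α ζ)⟫_ℂ).re

/-- The Lindblad equation with coupling `θ` and pair amplitudes `β` stabilizes `|α, ζ⟩` with
convergence rate `κ > 0`: it is solvable from every initial density operator, the state is
stationary, every solution converges to it in trace norm, the mean excitation number above it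
decays exactly like `e^{-κτ}` and bounds the infidelity accordingly, and `κ` is attained. -/
def Stabilizes (θ : ℝ) (β : PairState) (α ζ : ℂ) (κ : ℝ) : Prop :=
  0 < κ ∧
  (∀ ρ₀ : Osc →L[ℂ] Osc, IsDensity ρ₀ → ∃ ρ, IsLindbladSolution θ β ρ ∧ ρ 0 = ρ₀) ∧
  IsLindbladSolution θ β (fun _ => pureState (squeezedCoherent α ζ)) ∧
  (∀ ρ, IsLindbladSolution θ β ρ →
    Tendsto (fun t : ℝ => traceNorm (ρ t - pureState (squeezedCoherent α ζ))) atTop (𝓝 0) ∧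
    ∀ t : ℝ, 0 ≤ t →
      excitation α ζ (ρ t) = ENNReal.ofReal (Real.exp (-κ * t)) * excitation α ζ (ρ 0) ∧
      ENNReal.ofReal (infidelity α ζ (ρ t)) ≤
        ENNReal.ofReal (Real.exp (-κ * t)) * excitation α ζ (ρ 0)) ∧
  ∃ ρ, IsLindbladSolution θ β ρ ∧ excitation α ζ (ρ 0) = 1 ∧
    ∀ t : ℝ, 0 ≤ t → infidelity α ζ (ρ t) = Real.exp (-κ * t)

/-! ### The tuning formulas -/

/-- `θ|α|/√2 · √((1 + sin 2u)(1 - sin 2u) / (1 + cos(φ_r - 2χ) sin 2u))`. -/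
def tuning (θ : ℝ) (α : ℂ) (φr u χ : ℝ) : ℝ :=
  θ * ‖α‖ / Real.sqrt 2 *
    Real.sqrt ((1 + Real.sin (2 * u)) * (1 - Real.sin (2 * u)) /
      (1 + Real.cos (φr - 2 * χ) * Real.sin (2 * u)))

/-- `κ = 2θ² (1 - tanh² |r|) / (1 + tanh² |r|)`. -/
def rate (θ r : ℝ) : ℝ :=
  2 * θ ^ 2 * ((1 - Real.tanh |r| ^ 2) / (1 + Real.tanh |r| ^ 2))

end SqueezedReservoir

end

noncomputable section

namespace SqueezedReservoir

/-! ### Fock coordinates -/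

/-! Put V = D(α)S(ζ). Conjugation by V is a Bogoliubov transformation of a, a† together with a
scalar shift. Since tan u = -tanh r, it turns L₁ into k a + l with a scalar l and k² = κ cos²ε; the
choice of χ and ε turns H into exactly the linear Hamiltonian that compensates l
(`lindbladForm_shift`). In the target frame (∗) is thus the damped oscillator with jump operator k
a, and its dark state is the vacuum.

The damped oscillator is explicit. Its populations obey the closed master equation of the linear
death process, whose generating function is constant along characteristics
(`IsDeathFlow.tsum_mul_pow`). This gives the vacuum population, its limit 1, and the exact decay of
the mean, infinite means included. A density operator with little weight outside a pure state is
close to it in trace norm (`traceNorm_sub_pureState_le`). Solutions are supplied by the attenuation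
channel with binomial Kraus operators (`exists_isDamped`), and the one started in V|1⟩ attains the
rate.

The analytic difficulty is that the operators are unbounded and the equation is only weak. The
exponentials are strong limits of the unitary groups of cut-off generators (`exists_unitaryGroup`).
An energy estimate with bounded weights, uniform in all cut-offs, shows that these groups preserve
quadratically weighted decay of Fock coefficients. For x a finite combination, ladder polynomials of
degree two therefore converge along the truncations of V x. This carries the uniqueness of the
exponentials (`IsGroupOf.weak_unique`), the Heisenberg relations (`IsGroupOf.intertwines`) and the
transport of weak solutions between frames (`IsWeakSolution.conj`).

What remains is trigonometry. Denominator + i·numerator of tan χ is e^{iφ_α} + tanh r e^{i(φ_r-φ_α)}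
= R e^{iχ}, the square root in ε₀ equals R cos u, and both tunings are instances of √2 sin ε = R θ
cos ε cos u · m, where m e^{iφ_α} is the stabilized displacement: m = |α| for the exact tuning, m =
|α| tan ε/ε for the leading-order one. -/

theorem inner_fock_left (n : ℕ) (v : Osc) : ⟪fock n, v⟫_ℂ = v n := by
  unfold fock
  rw [lp.inner_single_left]
  simp

theorem inner_fock_right (n : ℕ) (v : Osc) : ⟪v, fock n⟫_ℂ = star (v n) := by
  rw [← inner_conj_symm, inner_fock_left]; rfl

theorem fock_apply (m n : ℕ) : (fock m : Osc) n = if m = n then 1 else 0 := by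
  unfold fock
  rw [lp.single_apply]
  split_ifs with h
  · subst h; simp
  · rw [Pi.single_eq_of_ne (fun h' => h h'.symm)]

/-- The Fock states as a Hilbert basis. -/
def fockBasis : HilbertBasis ℕ ℂ Osc := HilbertBasis.ofRepr (LinearIsometryEquiv.refl ℂ Osc)

theorem fockBasis_apply (n : ℕ) : fockBasis n = fock n := by
  classical
  unfold fock
  rw [← HilbertBasis.repr_symm_single]
  simp only [fockBasis]
  have h : ∀ v : Osc, (LinearIsometryEquiv.refl ℂ Osc).symm v = v := fun _ => rfl
  rw [h]

theorem norm_fock (n : ℕ) : ‖fock n‖ = 1 := by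
  rw [← fockBasis_apply]
  exact fockBasis.orthonormal.1 n

theorem hasSum_fock (v : Osc) : HasSum (fun n => v n • fock n) v := by
  have h := fockBasis.hasSum_repr v
  simp only [fockBasis_apply] at h
  exact h

theorem hasSum_norm_sq (v : Osc) : HasSum (fun n => ‖v n‖ ^ 2) (‖v‖ ^ 2) := by
  have h := lp.hasSum_norm (p := 2) (by norm_num) v
  simpa using h

theorem hasSum_inner (v w : Osc) : HasSum (fun n => star (v n) * w n) ⟪v, w⟫_ℂ := by
  have h := fockBasis.hasSum_inner_mul_inner v w
  simpa only [fockBasis_apply, inner_fock_left, inner_fock_right] using h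

theorem incl_single (n : ℕ) (c : ℂ) : incl (Finsupp.single n c) = c • fock n := by
  simp [incl, Finsupp.linearCombination_single]

theorem inner_incl_single (n : ℕ) (v : Osc) : ⟪incl (Finsupp.single n 1), v⟫_ℂ = v n := by
  rw [incl_single, one_smul, inner_fock_left]

theorem incl_apply (x : Fin0) (n : ℕ) : (incl x : Osc) n = x n := by
  induction x using Finsupp.induction_linear with
  | zero => simp
  | add f g hf hg => simp [hf, hg]
  | single m c =>
    rw [incl_single, lp.coeFn_smul, Pi.smul_apply, fock_apply, Finsupp.single_apply]
    split_ifs <;> simp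

theorem ext_inner_incl {v w : Osc} (h : ∀ z : Fin0, ⟪incl z, v⟫_ℂ = ⟪incl z, w⟫_ℂ) : v = w := by
  ext n
  have := h (Finsupp.single n 1)
  rwa [inner_incl_single, inner_incl_single] at this

theorem real_smul_eq (c : ℝ) (v : Osc) : c • v = (c : ℂ) • v := (Complex.coe_smul c v).symm

/-- The first `k` Fock components. -/
def trunc (k : ℕ) (v : Osc) : Fin0 := ∑ n ∈ Finset.range k, Finsupp.single n (v n)

theorem map_trunc (M : Module.End ℂ Fin0) (k : ℕ) (v : Osc) :
    incl (M (trunc k v)) = ∑ n ∈ Finset.range k, v n • incl (M (Finsupp.single n 1)) := by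
  simp only [trunc, map_sum]
  refine Finset.sum_congr rfl fun n _ => ?_
  rw [← map_smul, ← map_smul, Finsupp.smul_single, smul_eq_mul, mul_one]

theorem tendsto_trunc (v : Osc) : Tendsto (fun k => incl (trunc k v)) atTop (𝓝 v) := by
  have h := (hasSum_fock v).tendsto_sum_nat
  refine h.congr fun k => ?_
  have := map_trunc 1 k v
  simp only [Module.End.one_apply, incl_single, one_smul] at this
  exact this.symm

theorem denseRange_incl : DenseRange (incl : Fin0 → Osc) := fun v =>
  mem_closure_of_tendsto (tendsto_trunc v) (Eventually.of_forall fun _ => ⟨_, rfl⟩)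

/-! ### Formal adjoints -/

/-- `M'` is the formal adjoint of `M` on the finite Fock combinations. -/
def FAdj (M M' : Module.End ℂ Fin0) : Prop :=
  ∀ x y : Fin0, ⟪incl (M x), incl y⟫_ℂ = ⟪incl x, incl (M' y)⟫_ℂ

theorem FAdj.symm {M M' : Module.End ℂ Fin0} (h : FAdj M M') : FAdj M' M := fun x y => by
  rw [← inner_conj_symm, ← h, inner_conj_symm]

theorem FAdj.add {M M' N N' : Module.End ℂ Fin0} (h : FAdj M M') (k : FAdj N N') :
    FAdj (M + N) (M' + N') := fun x y => by
  simp only [LinearMap.add_apply, map_add, inner_add_left, inner_add_right, h x y, k x y]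

theorem FAdj.smul {M M' : Module.End ℂ Fin0} (h : FAdj M M') (c : ℂ) :
    FAdj (c • M) (star c • M') := fun x y => by
  simp only [LinearMap.smul_apply, map_smul, inner_smul_left, inner_smul_right, h x y]
  rfl

theorem FAdj.mul {M M' N N' : Module.End ℂ Fin0} (h : FAdj M M') (k : FAdj N N') :
    FAdj (M * N) (N' * M') := fun x y => by
  simp only [Module.End.mul_apply, h _ y, k x _]

theorem FAdj.one : FAdj 1 1 := fun _ _ => rfl

theorem ann_single (n : ℕ) (c : ℂ) :
    ann (Finsupp.single n c) = Finsupp.single (n - 1) (c * (Real.sqrt n : ℝ)) := by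
  simp [ann]

theorem cre_single (n : ℕ) (c : ℂ) :
    cre (Finsupp.single n c) = Finsupp.single (n + 1) (c * (Real.sqrt (n + 1) : ℝ)) := by
  simp [cre, Finsupp.linearCombination_single]

theorem ann_apply (x : Fin0) (n : ℕ) : ann x n = (Real.sqrt (n + 1) : ℝ) * x (n + 1) := by
  induction x using Finsupp.induction_linear with
  | zero => simp
  | add f g hf hg => simp only [map_add, Finsupp.add_apply, hf, hg]; ring
  | single m c =>
    rw [ann_single]
    rcases m with _ | m
    · simp
    · simp only [Nat.add_sub_cancel, Finsupp.single_apply]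
      by_cases h : m = n
      · subst h; simp [mul_comm]
      · simp [h]

theorem fadj_ann_cre : FAdj ann cre := fun x y => by
  induction y using Finsupp.induction_linear with
  | zero => simp
  | add f g hf hg => simp only [map_add, inner_add_right, hf, hg]
  | single m c =>
    rw [cre_single, incl_single, incl_single, inner_smul_right, inner_smul_right,
      inner_fock_right, inner_fock_right, incl_apply, incl_apply, ann_apply, star_mul,
      mul_assoc, mul_comm (star (x (m + 1)))]
    congr 2
    exact Complex.conj_ofReal _

theorem ann_cre_comm : ann * cre = cre * ann + 1 := by
  refine Finsupp.lhom_ext fun n c => ?_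
  simp only [Module.End.mul_apply, LinearMap.add_apply, Module.End.one_apply, cre_single,
    ann_single]
  rcases n with _ | n
  · simp
  · simp only [Nat.add_sub_cancel, ← Finsupp.single_add]
    congr 1
    have h1 : ((Real.sqrt ((n : ℝ) + 1) : ℝ) : ℂ) * ((Real.sqrt ((n : ℝ) + 1) : ℝ) : ℂ)
        = (n : ℂ) + 1 := by
      rw [← Complex.ofReal_mul, Real.mul_self_sqrt (by positivity)]; push_cast; rfl
    have h2 : ((Real.sqrt ((n : ℝ) + 1 + 1) : ℝ) : ℂ) * ((Real.sqrt ((n : ℝ) + 1 + 1) : ℝ) : ℂ)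
        = (n : ℂ) + 1 + 1 := by
      rw [← Complex.ofReal_mul, Real.mul_self_sqrt (by positivity)]; push_cast; rfl
    push_cast
    rw [mul_assoc, mul_assoc, h1, h2]
    ring

/-- The operator `c a + d a† + e`. -/
def aff (c d e : ℂ) : Module.End ℂ Fin0 := c • ann + d • cre + e • 1

theorem lin_eq_aff (c d : ℂ) : lin c d = aff c d 0 := by simp [lin, aff]

theorem fadj_aff (c d e : ℂ) : FAdj (aff c d e) (aff (star d) (star c) (star e)) := by
  have := ((fadj_ann_cre.smul c).add (fadj_ann_cre.symm.smul d)).add (FAdj.one.smul e)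
  unfold aff
  rwa [add_comm (star d • ann)]

/-! ### Operators of degree at most two and vectors with decaying Fock coefficients -/

/-- `‖M |n⟩‖ = O(n + 1)`, as for polynomials of degree at most two in the ladder operators. -/
def Deg2 (M : Module.End ℂ Fin0) : Prop :=
  ∃ C : ℝ, ∀ n : ℕ, ‖incl (M (Finsupp.single n 1))‖ ≤ C * (n + 1)

theorem Deg2.add {M N : Module.End ℂ Fin0} (h : Deg2 M) (k : Deg2 N) : Deg2 (M + N) := by
  obtain ⟨C, hC⟩ := h
  obtain ⟨D, hD⟩ := k
  refine ⟨C + D, fun n => ?_⟩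
  rw [LinearMap.add_apply, map_add, add_mul]
  exact norm_add_le_of_le (hC n) (hD n)

theorem Deg2.smul {M : Module.End ℂ Fin0} (h : Deg2 M) (c : ℂ) : Deg2 (c • M) := by
  obtain ⟨C, hC⟩ := h
  refine ⟨‖c‖ * C, fun n => ?_⟩
  rw [LinearMap.smul_apply, map_smul, norm_smul, mul_assoc]
  exact mul_le_mul_of_nonneg_left (hC n) (norm_nonneg _)

theorem norm_ofReal_sqrt (a : ℝ) : ‖((Real.sqrt a : ℝ) : ℂ)‖ = Real.sqrt a := by
  rw [Complex.norm_real, Real.norm_of_nonneg (Real.sqrt_nonneg _)]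

theorem sqrt_mul_sqrt_le {a b c : ℝ} (ha : a ≤ c) (hb : b ≤ c) (hc : 0 ≤ c) :
    Real.sqrt a * Real.sqrt b ≤ c := by
  calc Real.sqrt a * Real.sqrt b ≤ Real.sqrt c * Real.sqrt c :=
        mul_le_mul (Real.sqrt_le_sqrt ha) (Real.sqrt_le_sqrt hb) (Real.sqrt_nonneg _)
          (Real.sqrt_nonneg _)
    _ = c := Real.mul_self_sqrt hc

theorem sqrt_le_self_of_le {a c : ℝ} (ha : a ≤ c) (hc : 1 ≤ c) : Real.sqrt a ≤ c := by
  have := sqrt_mul_sqrt_le ha hc (by linarith)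
  simpa using this

theorem deg2_one : Deg2 1 := ⟨1, fun n => by
  simp [incl_single, norm_fock]⟩

theorem deg2_ann : Deg2 ann := ⟨1, fun n => by
  rw [ann_single, incl_single, norm_smul, norm_fock, one_mul, norm_ofReal_sqrt, mul_one, one_mul]
  exact sqrt_le_self_of_le (by linarith) (by linarith [n.cast_nonneg (α := ℝ)])⟩

theorem deg2_cre : Deg2 cre := ⟨1, fun n => by
  rw [cre_single, incl_single, norm_smul, norm_fock, one_mul, norm_ofReal_sqrt, mul_one, one_mul]
  exact sqrt_le_self_of_le (by linarith) (by linarith [n.cast_nonneg (α := ℝ)])⟩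

theorem deg2_ann_ann : Deg2 (ann * ann) := ⟨1, fun n => by
  rw [Module.End.mul_apply, ann_single, ann_single, incl_single, norm_smul, norm_fock, one_mul,
    norm_mul, norm_ofReal_sqrt, norm_ofReal_sqrt, mul_one, one_mul]
  refine sqrt_mul_sqrt_le (by linarith) ?_ (by positivity)
  have : ((n - 1 : ℕ) : ℝ) ≤ n := by exact_mod_cast Nat.sub_le n 1
  linarith⟩

theorem deg2_cre_ann : Deg2 (cre * ann) := ⟨1, fun n => by
  rw [Module.End.mul_apply, ann_single, cre_single, incl_single, norm_smul, norm_fock, one_mul,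
    norm_mul, norm_ofReal_sqrt, norm_ofReal_sqrt, mul_one, one_mul]
  refine sqrt_mul_sqrt_le (by linarith) ?_ (by positivity)
  have : ((n - 1 : ℕ) : ℝ) ≤ n := by exact_mod_cast Nat.sub_le n 1
  linarith⟩

theorem deg2_cre_cre : Deg2 (cre * cre) := ⟨2, fun n => by
  rw [Module.End.mul_apply, cre_single, cre_single, incl_single, norm_smul, norm_fock, one_mul,
    norm_mul, norm_ofReal_sqrt, norm_ofReal_sqrt, mul_one]
  have := n.cast_nonneg (α := ℝ)
  refine sqrt_mul_sqrt_le (by linarith) ?_ (by positivity)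
  push_cast
  linarith⟩

theorem deg2_aff (c d e : ℂ) : Deg2 (aff c d e) :=
  ((deg2_ann.smul c).add (deg2_cre.smul d)).add (deg2_one.smul e)

theorem aff_mul_aff (c d e c' d' e' : ℂ) :
    aff c d e * aff c' d' e' = (c * c') • (ann * ann) + (c * d' + d * c') • (cre * ann)
      + (d * d') • (cre * cre) + aff (c * e' + e * c') (d * e' + e * d') (c * d' + e * e') := by
  have h := ann_cre_comm
  simp only [aff, mul_add, add_mul, smul_mul_assoc, mul_smul_comm, h, one_mul, mul_one]
  module

theorem deg2_aff_mul_aff (c d e c' d' e' : ℂ) : Deg2 (aff c d e * aff c' d' e') := by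
  rw [aff_mul_aff]
  exact (((deg2_ann_ann.smul _).add (deg2_cre_ann.smul _)).add (deg2_cre_cre.smul _)).add
    (deg2_aff _ _ _)

/-- Fock coefficients summable against `n + 1`. -/
def Dom (v : Osc) : Prop := Summable fun n : ℕ => ((n : ℝ) + 1) * ‖v n‖

theorem Deg2.summable {M : Module.End ℂ Fin0} (h : Deg2 M) {v : Osc} (hv : Dom v) :
    Summable fun n => ‖v n • incl (M (Finsupp.single n 1))‖ := by
  obtain ⟨C, hC⟩ := h
  refine Summable.of_nonneg_of_le (fun _ => norm_nonneg _) (fun n => ?_) (hv.mul_left C)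
  rw [norm_smul]
  calc _ ≤ ‖v n‖ * (C * (n + 1)) := mul_le_mul_of_nonneg_left (hC n) (norm_nonneg _)
    _ = _ := by ring

/-- A vector representing `M v` weakly is the limit of `M` on the truncations of `v`. -/
theorem Deg2.tendsto_trunc {M M' : Module.End ℂ Fin0} (h : Deg2 M) (hM : FAdj M' M) {v m : Osc}
    (hv : Dom v) (hm : ∀ z : Fin0, ⟪incl z, m⟫_ℂ = ⟪incl (M' z), v⟫_ℂ) :
    Tendsto (fun k => incl (M (trunc k v))) atTop (𝓝 m) := by
  have h1 := (h.summable hv).of_norm.hasSum.tendsto_sum_nat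
  simp only [← map_trunc] at h1
  -- The series converges absolutely because `v` decays; testing against finite combinations
  -- identifies its sum with `m`.
  convert h1
  refine ext_inner_incl fun z => ?_
  rw [hm]
  have h2 : Tendsto (fun k => ⟪incl (M' z), incl (trunc k v)⟫_ℂ) atTop
      (𝓝 ⟪incl (M' z), v⟫_ℂ) := tendsto_const_nhds.inner (SqueezedReservoir.tendsto_trunc v)
  simp only [hM z] at h2
  exact tendsto_nhds_unique h2 (tendsto_const_nhds.inner h1)

/-- `M v` for `v` with decaying coefficients, with a bound. -/
theorem Deg2.exists_weak {M M' : Module.End ℂ Fin0} (h : Deg2 M) (hM : FAdj M' M) :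
    ∃ C : ℝ, 0 ≤ C ∧ ∀ v : Osc, Dom v → ∃ m : Osc,
      (∀ z : Fin0, ⟪incl z, m⟫_ℂ = ⟪incl (M' z), v⟫_ℂ) ∧
      ‖m‖ ≤ C * ∑' n : ℕ, ((n : ℝ) + 1) * ‖v n‖ := by
  obtain ⟨C, hC⟩ := id h
  have hC0 : 0 ≤ C := by simpa using (norm_nonneg _).trans (hC 0)
  refine ⟨C, hC0, fun v hv => ?_⟩
  have h1 := (h.summable hv).of_norm.hasSum.tendsto_sum_nat
  simp only [← map_trunc] at h1
  refine ⟨∑' n, v n • incl (M (Finsupp.single n 1)), fun z => ?_, ?_⟩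
  rotate_left
  · refine (norm_tsum_le_tsum_norm (h.summable hv)).trans ?_
    rw [← tsum_mul_left]
    refine (h.summable hv).tsum_le_tsum (fun n => ?_) (Summable.mul_left C hv)
    rw [norm_smul]
    calc _ ≤ ‖v n‖ * (C * (n + 1)) := mul_le_mul_of_nonneg_left (hC n) (norm_nonneg _)
      _ = _ := by ring
  · have h2 : Tendsto (fun k => ⟪incl (M' z), incl (trunc k v)⟫_ℂ) atTop
      (𝓝 ⟪incl (M' z), v⟫_ℂ) := tendsto_const_nhds.inner (SqueezedReservoir.tendsto_trunc v)
    simp only [hM z] at h2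
    exact tendsto_nhds_unique (tendsto_const_nhds.inner h1) h2

/-! ### Derivatives of limits -/

/-- A pointwise limit of functions whose derivatives converge uniformly is differentiable. -/
theorem hasDerivWithinAt_of_tendsto {E : Type*} [NormedAddCommGroup E] [NormedSpace ℝ E]
    {s : Set ℝ} (hs : Convex ℝ s) {g g' : ℕ → ℝ → E} {f f' : ℝ → E} {b : ℕ → ℝ}
    (hg : ∀ k, ∀ t ∈ s, HasDerivWithinAt (g k) (g' k t) s t)
    (hlim : ∀ t ∈ s, Tendsto (fun k => g k t) atTop (𝓝 (f t)))
    (hb : ∀ k, ∀ t ∈ s, ‖g' k t - f' t‖ ≤ b k) (hb0 : Tendsto b atTop (𝓝 0))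
    {t : ℝ} (ht : t ∈ s) : HasDerivWithinAt f (f' t) s t := by
  -- Mean value inequality for `g k - g m`, whose derivative is bounded by `b k + b m`, followed by
  -- `m → ∞`.
  have key : ∀ k, ∀ x ∈ s, ‖(g k x - f x) - (g k t - f t)‖ ≤ b k * ‖x - t‖ := by
    intro k x hx
    have h1 : ∀ m, ‖(g k x - g m x) - (g k t - g m t)‖ ≤ (b k + b m) * ‖x - t‖ := fun m =>
      hs.norm_image_sub_le_of_norm_hasDerivWithin_le (f := fun x => g k x - g m x)
        (f' := fun x => g' k x - g' m x)
        (fun y hy => (hg k y hy).sub (hg m y hy))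
        (fun y hy => by
          calc ‖g' k y - g' m y‖ = ‖(g' k y - f' y) - (g' m y - f' y)‖ := by congr 1; abel
            _ ≤ _ := norm_sub_le_of_le (hb k y hy) (hb m y hy)) ht hx
    have h2 : Tendsto (fun m => ‖(g k x - g m x) - (g k t - g m t)‖) atTop
        (𝓝 ‖(g k x - f x) - (g k t - f t)‖) :=
      ((tendsto_const_nhds.sub (hlim x hx)).sub (tendsto_const_nhds.sub (hlim t ht))).norm
    have h3 : Tendsto (fun m => (b k + b m) * ‖x - t‖) atTop (𝓝 ((b k + 0) * ‖x - t‖)) :=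
      (tendsto_const_nhds.add hb0).mul_const _
    simpa using le_of_tendsto_of_tendsto' h2 h3 h1
  rw [hasDerivWithinAt_iff_isLittleO, Asymptotics.isLittleO_iff]
  intro ε hε
  obtain ⟨k, hk⟩ := (hb0.eventually (gt_mem_nhds (show (0 : ℝ) < ε / 3 by positivity))).exists
  have h1 := (hasDerivWithinAt_iff_isLittleO.1 (hg k t ht))
  rw [Asymptotics.isLittleO_iff] at h1
  filter_upwards [h1 (show (0 : ℝ) < ε / 3 by positivity), self_mem_nhdsWithin] with x hx hxs
  have e : f x - f t - (x - t) • f' t = (g k x - g k t - (x - t) • g' k t)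
      - ((g k x - f x) - (g k t - f t)) + (x - t) • (g' k t - f' t) := by
    rw [smul_sub]; abel
  rw [e]
  have hk' := key k x hxs
  have h4 : ‖(x - t) • (g' k t - f' t)‖ ≤ b k * ‖x - t‖ := by
    rw [norm_smul, mul_comm]
    exact mul_le_mul_of_nonneg_right (hb k t ht) (norm_nonneg _)
  have h5 : b k * ‖x - t‖ ≤ ε / 3 * ‖x - t‖ := mul_le_mul_of_nonneg_right hk.le (norm_nonneg _)
  refine (norm_add_le _ _).trans ?_
  have := norm_sub_le (g k x - g k t - (x - t) • g' k t) ((g k x - f x) - (g k t - f t))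
  linarith

/-- Product rule for `⟨p(t), w(t)⟩` when `p` is differentiable in norm and `w` is bounded and only
weakly differentiable against `p(t)`. -/
theorem hasDerivWithinAt_inner_weak {s : Set ℝ} {p w : ℝ → Osc} {p' : Osc} {d : ℂ} {t B : ℝ}
    (hp : HasDerivWithinAt p p' s t) (hB : ∀ x ∈ s, ‖w x‖ ≤ B)
    (hw : HasDerivWithinAt (fun x => ⟪p t, w x⟫_ℂ) d s t)
    (hc : Tendsto (fun x => ⟪p', w x⟫_ℂ) (𝓝[s] t) (𝓝 ⟪p', w t⟫_ℂ)) :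
    HasDerivWithinAt (fun x => ⟪p x, w x⟫_ℂ) (⟪p', w t⟫_ℂ + d) s t := by
  rw [hasDerivWithinAt_iff_isLittleO] at hp hw ⊢
  -- Since `w` has no norm derivative, the remainder of `p` is paired with the bounded `w x`, the
  -- weak derivative is taken against the fixed vector `p t`, and the cross term needs only weak
  -- continuity against `p'`.
  have e : (fun x => ⟪p x, w x⟫_ℂ - ⟪p t, w t⟫_ℂ - (x - t) • (⟪p', w t⟫_ℂ + d)) =
      fun x => ⟪p x - p t - (x - t) • p', w x⟫_ℂ + (⟪p t, w x⟫_ℂ - ⟪p t, w t⟫_ℂ - (x - t) • d)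
        + (x - t) • (⟪p', w x⟫_ℂ - ⟪p', w t⟫_ℂ) := by
    funext x
    rw [real_smul_eq (x - t) p']
    simp only [inner_sub_left, inner_smul_left, Complex.real_smul, Complex.conj_ofReal]
    ring
  rw [e]
  refine (Asymptotics.IsLittleO.add ?_ hw).add ?_
  · have h1 : (fun x => ⟪p x - p t - (x - t) • p', w x⟫_ℂ) =O[𝓝[s] t]
        fun x => p x - p t - (x - t) • p' := by
      refine Asymptotics.IsBigO.of_bound B ?_
      filter_upwards [self_mem_nhdsWithin] with x hx
      rw [mul_comm]
      exact (norm_inner_le_norm _ _).trans (mul_le_mul_of_nonneg_left (hB x hx) (norm_nonneg _))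
    exact h1.trans_isLittleO hp
  · have h1 : (fun x => ⟪p', w x⟫_ℂ - ⟪p', w t⟫_ℂ) =o[𝓝[s] t] fun _ => (1 : ℝ) := by
      rw [Asymptotics.isLittleO_one_iff]
      simpa using hc.sub_const ⟪p', w t⟫_ℂ
    simpa using (Asymptotics.isBigO_refl (fun x => x - t) (𝓝[s] t)).smul_isLittleO h1

/-! ### Weighted shifts -/

theorem clm_mul_apply (S T : Osc →L[ℂ] Osc) (v : Osc) : (S * T) v = S (T v) := rfl

theorem summable_wshift {τ : ℕ → ℂ} {C : ℝ} (h : ∀ n, ‖τ n‖ ≤ C) (d : ℕ) (v : Osc) :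
    Summable fun n => ‖τ n * v (n + d)‖ ^ 2 := by
  have h1 : Summable fun n => C ^ 2 * ‖v (n + d)‖ ^ 2 :=
    (((hasSum_norm_sq v).summable.comp_injective (add_left_injective d))).mul_left _
  refine h1.of_nonneg_of_le (fun n => by positivity) fun n => ?_
  rw [norm_mul, mul_pow]
  gcongr
  exact h n

theorem memℓp_wshift {τ : ℕ → ℂ} {C : ℝ} (h : ∀ n, ‖τ n‖ ≤ C) (d : ℕ) (v : Osc) :
    Memℓp (fun n => τ n * v (n + d)) 2 := by
  refine memℓp_gen ?_
  simpa using summable_wshift h d v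

theorem norm_le_of_apply_shift {τ : ℕ → ℂ} {C : ℝ} (h : ∀ n, ‖τ n‖ ≤ C) (d : ℕ) {v w : Osc}
    (hw : ∀ n, w n = τ n * v (n + d)) : ‖w‖ ≤ C * ‖v‖ := by
  have hC0 : 0 ≤ C := (norm_nonneg _).trans (h 0)
  refine le_of_sq_le_sq ?_ (by positivity)
  rw [← (hasSum_norm_sq w).tsum_eq, mul_pow, ← (hasSum_norm_sq v).tsum_eq, ← tsum_mul_left]
  have hs := (hasSum_norm_sq v).summable
  calc ∑' n, ‖w n‖ ^ 2 ≤ ∑' n, C ^ 2 * ‖v (n + d)‖ ^ 2 := by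
        refine (hasSum_norm_sq w).summable.tsum_le_tsum (fun n => ?_)
          ((hs.comp_injective (add_left_injective d)).mul_left _)
        rw [hw, norm_mul, mul_pow]
        gcongr
        exact h n
    _ ≤ _ := tsum_comp_le_tsum_of_inj (hs.mul_left (C ^ 2))
        (fun n => by positivity) (add_left_injective d)

open Classical in
/-- The bounded operator `v ↦ (τ n * v (n + d))ₙ` for a bounded sequence `τ`. -/
def wshift (d : ℕ) (τ : ℕ → ℂ) : Osc →L[ℂ] Osc :=
  if h : ∃ C, ∀ n, ‖τ n‖ ≤ C then
    LinearMap.mkContinuous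
      { toFun := fun v => (⟨fun n => τ n * v (n + d), memℓp_wshift h.choose_spec d v⟩ : Osc)
        map_add' := fun v w => by ext n; exact mul_add _ _ _
        map_smul' := fun c v => by ext n; simp; ring } h.choose fun v =>
      norm_le_of_apply_shift h.choose_spec d fun n => rfl
  else 0

theorem wshift_apply {τ : ℕ → ℂ} {C : ℝ} (h : ∀ n, ‖τ n‖ ≤ C) (d : ℕ) (v : Osc) (n : ℕ) :
    wshift d τ v n = τ n * v (n + d) := by
  rw [wshift, dif_pos ⟨C, h⟩]
  rfl

theorem norm_wshift_le {τ : ℕ → ℂ} {C : ℝ} (h : ∀ n, ‖τ n‖ ≤ C) (d : ℕ) :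
    ‖wshift d τ‖ ≤ C :=
  ContinuousLinearMap.opNorm_le_bound _ ((norm_nonneg _).trans (h 0)) fun v =>
    norm_le_of_apply_shift h d (wshift_apply h d v)

theorem inner_wshift_zero {w : ℕ → ℝ} {C : ℝ} (h : ∀ n, ‖(w n : ℂ)‖ ≤ C) (x y : Osc) :
    ⟪wshift 0 (fun n => (w n : ℂ)) x, y⟫_ℂ = ⟪x, wshift 0 (fun n => (w n : ℂ)) y⟫_ℂ := by
  rw [← (hasSum_inner _ _).tsum_eq, ← (hasSum_inner _ _).tsum_eq]
  refine tsum_congr fun n => ?_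
  rw [wshift_apply h, wshift_apply h, star_mul, add_zero]
  have : star (w n : ℂ) = w n := Complex.conj_ofReal _
  rw [this]
  ring

/-! ### Weights `min (n + 1) (K + 1) ^ 2` -/

/-- The weight `min (n + 1) (K + 1) ^ 2`. -/
def wt (K n : ℕ) : ℝ := (min (n + 1) (K + 1) : ℕ) ^ 2

/-- Multiplication of Fock coefficients by `wt K`. -/
def wtOp (K : ℕ) : Osc →L[ℂ] Osc := wshift 0 fun n => (wt K n : ℂ)

theorem wt_pos (K n : ℕ) : 0 < wt K n := by
  unfold wt
  have : 0 < min (n + 1) (K + 1) := by omega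
  positivity

theorem norm_wt_le (K n : ℕ) : ‖(wt K n : ℂ)‖ ≤ ((K : ℝ) + 1) ^ 2 := by
  rw [Complex.norm_real, Real.norm_of_nonneg (wt_pos K n).le]
  unfold wt
  have : ((min (n + 1) (K + 1) : ℕ) : ℝ) ≤ (K : ℝ) + 1 := by
    exact_mod_cast min_le_right _ _
  gcongr

theorem wt_le (K n : ℕ) : wt K n ≤ ((n : ℝ) + 1) ^ 2 := by
  unfold wt
  have : ((min (n + 1) (K + 1) : ℕ) : ℝ) ≤ (n : ℝ) + 1 := by
    exact_mod_cast min_le_left _ _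
  gcongr

theorem wt_of_le {K n : ℕ} (h : n ≤ K) : wt K n = ((n : ℝ) + 1) ^ 2 := by
  unfold wt
  rw [min_eq_left (by omega)]
  push_cast
  rfl

theorem wt_mono (K : ℕ) {m n : ℕ} (h : m ≤ n) : wt K m ≤ wt K n := by
  unfold wt
  gcongr

theorem wtOp_apply (K : ℕ) (v : Osc) (n : ℕ) : wtOp K v n = wt K n * v n :=
  wshift_apply (norm_wt_le K) 0 v n

theorem inner_wtOp (K : ℕ) (x y : Osc) : ⟪wtOp K x, y⟫_ℂ = ⟪x, wtOp K y⟫_ℂ :=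
  inner_wshift_zero (norm_wt_le K) x y

/-- The variation of the squared weight over two levels is of relative order `1 / (n + 1)`. -/
theorem wt_sq_sub_le (K n d : ℕ) (hd : d ≤ 2) :
    |wt K n ^ 2 - wt K (n + d) ^ 2| * (n + 1) ≤ 80 * (wt K n * wt K (n + d)) := by
  have hp := mul_pos (wt_pos K n) (wt_pos K (n + d))
  -- Beyond the cap the weight is constant and there is no variation.
  rcases le_or_gt K n with h | h
  · have : wt K n = wt K (n + d) := by
      unfold wt
      rw [min_eq_right (by omega), min_eq_right (by omega)]
    rw [this] at hp ⊢
    simp only [sub_self, abs_zero, zero_mul]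
    positivity
  · have h0 : wt K n ^ 2 ≤ wt K (n + d) ^ 2 :=
      pow_le_pow_left₀ (wt_pos K n).le (wt_mono K (by omega)) 2
    have h1 : wt K (n + d) ^ 2 ≤ ((n : ℝ) + 3) ^ 4 := by
      have h2 : wt K (n + d) ≤ ((n : ℝ) + 3) ^ 2 := by
        refine (wt_le K (n + d)).trans ?_
        have : ((n + d : ℕ) : ℝ) + 1 ≤ (n : ℝ) + 3 := by
          have : (d : ℝ) ≤ 2 := by exact_mod_cast hd
          push_cast
          linarith
        gcongr
      calc _ ≤ (((n : ℝ) + 3) ^ 2) ^ 2 := pow_le_pow_left₀ (wt_pos K _).le h2 2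
        _ = _ := by ring
    have h3 : wt K n * wt K n ≤ wt K n * wt K (n + d) :=
      mul_le_mul_of_nonneg_left (wt_mono K (by omega)) (wt_pos K n).le
    rw [abs_sub_comm, abs_of_nonneg (by linarith)]
    rw [wt_of_le h.le] at h3 ⊢
    have hn := n.cast_nonneg (α := ℝ)
    -- The constant 80 is attained at `n = 0`, where 3⁴ - 1⁴ = 80.
    have h4 : (((n : ℝ) + 3) ^ 4 - ((n : ℝ) + 1) ^ 4) * (n + 1) ≤ 80 * ((n : ℝ) + 1) ^ 4 := by
      have : 80 * ((n : ℝ) + 1) ^ 4 - (((n : ℝ) + 3) ^ 4 - ((n : ℝ) + 1) ^ 4) * (n + 1)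
        = (n : ℝ) * (n + 1) * (72 * n ^ 2 + 192 * n + 160) - 24 * n ^ 2 - 24 * n := by ring
      nlinarith [mul_nonneg (mul_nonneg hn (by linarith : (0 : ℝ) ≤ n + 1))
        (by positivity : (0 : ℝ) ≤ 72 * (n : ℝ) ^ 2 + 144 * n + 80)]
    nlinarith [mul_le_mul_of_nonneg_right (sub_le_sub_right h1 ((n + 1 : ℝ) ^ 4))
      (by linarith : (0 : ℝ) ≤ n + 1)]

/-! ### Cut-off generators -/

/-- The weighted shift with `τ` cut off at level `M`. -/
def cutShift (d : ℕ) (τ : ℕ → ℂ) (M : ℕ) : Osc →L[ℂ] Osc :=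
  wshift d fun n => if n < M then τ n else 0

/-- The bounded skew-adjoint operator `T - T†` for the cut-off shift `T`. -/
def cutGen (d : ℕ) (τ : ℕ → ℂ) (M : ℕ) : Osc →L[ℂ] Osc :=
  cutShift d τ M - star (cutShift d τ M)

/-- The unitary group of the cut-off generator. -/
def cutExp (d : ℕ) (τ : ℕ → ℂ) (M : ℕ) (t : ℝ) : Osc →L[ℂ] Osc :=
  NormedSpace.exp (t • cutGen d τ M)

section cut

variable {d : ℕ} {τ : ℕ → ℂ} {c : ℝ}

theorem norm_cut_le (hτ : ∀ n, ‖τ n‖ ≤ c * (n + 1)) (M n : ℕ) :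
    ‖(if n < M then τ n else 0 : ℂ)‖ ≤ c * (M + 1) := by
  have hc : 0 ≤ c := by simpa using (norm_nonneg _).trans (hτ 0)
  split_ifs with h
  · refine (hτ n).trans ?_
    have : (n : ℝ) ≤ M := by exact_mod_cast h.le
    gcongr
  · rw [norm_zero]; positivity

theorem cutShift_apply (hτ : ∀ n, ‖τ n‖ ≤ c * (n + 1)) (M : ℕ) (v : Osc) (n : ℕ) :
    cutShift d τ M v n = (if n < M then τ n else 0) * v (n + d) :=
  wshift_apply (norm_cut_le hτ M) d v n

theorem cutGen_mem_skewAdjoint (M : ℕ) : cutGen d τ M ∈ skewAdjoint (Osc →L[ℂ] Osc) := by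
  rw [skewAdjoint.mem_iff]
  simp [cutGen]

theorem cutExp_mem_unitary (M : ℕ) (t : ℝ) : cutExp d τ M t ∈ unitary (Osc →L[ℂ] Osc) := by
  let _ := NormedAlgebra.restrictScalars ℚ ℂ (Osc →L[ℂ] Osc)
  refine NormedSpace.exp_mem_unitary_of_mem_skewAdjoint (skewAdjoint.mem_iff.2 ?_)
  have h : t • cutGen d τ M = (t : ℂ) • cutGen d τ M := by
    ext1 v
    exact real_smul_eq t _
  rw [h, star_smul, skewAdjoint.mem_iff.1 (cutGen_mem_skewAdjoint M), smul_neg]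
  congr 2
  exact Complex.conj_ofReal t

theorem norm_cutExp (M : ℕ) (t : ℝ) (v : Osc) : ‖cutExp d τ M t v‖ = ‖v‖ :=
  ContinuousLinearMap.norm_map_of_mem_unitary (cutExp_mem_unitary M t) v

theorem cutExp_zero (M : ℕ) : cutExp d τ M 0 = 1 := by simp [cutExp]

theorem cutExp_add (M : ℕ) (s t : ℝ) : cutExp d τ M (s + t) = cutExp d τ M s * cutExp d τ M t := by
  let _ := NormedAlgebra.restrictScalars ℚ ℂ (Osc →L[ℂ] Osc)
  unfold cutExp
  rw [add_smul, NormedSpace.exp_add_of_commute]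
  exact ((Commute.refl _).smul_left s).smul_right t

theorem hasDerivAt_cutExp (M : ℕ) (t : ℝ) :
    HasDerivAt (cutExp d τ M) (cutExp d τ M t * cutGen d τ M) t :=
  hasDerivAt_exp_smul_const (𝕂 := ℝ) (cutGen d τ M) t

theorem hasDerivAt_cutExp' (M : ℕ) (t : ℝ) :
    HasDerivAt (cutExp d τ M) (cutGen d τ M * cutExp d τ M t) t :=
  hasDerivAt_exp_smul_const' (𝕂 := ℝ) (cutGen d τ M) t

theorem HasDerivAt.clm_apply_const {f : ℝ → (Osc →L[ℂ] Osc)} {f' : Osc →L[ℂ] Osc} {t : ℝ}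
    (h : HasDerivAt f f' t) (v : Osc) : HasDerivAt (fun s => f s v) (f' v) t :=
  ((ContinuousLinearMap.apply ℂ Osc v).restrictScalars ℝ).hasFDerivAt.comp_hasDerivAt t h

/-- Weighted energy estimate for the cut-off generators, uniform in both cut-offs. -/
theorem re_inner_wtOp_cutGen_le (hd : d ≤ 2) (hτ : ∀ n, ‖τ n‖ ≤ c * (n + 1)) (K M : ℕ) (y : Osc) :
    |(⟪wtOp K y, wtOp K (cutGen d τ M y)⟫_ℂ).re| ≤ 80 * c * ‖wtOp K y‖ ^ 2 := by
  have hc : 0 ≤ c := by simpa using (norm_nonneg _).trans (hτ 0)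
  set T := cutShift d τ M
  -- Coefficients of the operator `G` with `w² T - T w² = w G w`, `w` being the weight. The relative
  -- variation of `w²` is of order 1/(n+1), which offsets the growth of `τ`, so the bound on `G`
  -- sees neither cut-off.
  have hg : ∀ n, ‖((wt K n ^ 2 - wt K (n + d) ^ 2 : ℝ) : ℂ) * (if n < M then τ n else 0)
      / ((wt K n * wt K (n + d) : ℝ) : ℂ)‖ ≤ 80 * c := by
    intro n
    have hp := mul_pos (wt_pos K n) (wt_pos K (n + d))
    rw [norm_div, norm_mul, Complex.norm_real, Complex.norm_real, Real.norm_of_nonneg hp.le,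
      div_le_iff₀ hp, Real.norm_eq_abs]
    have h1 : ‖(if n < M then τ n else 0 : ℂ)‖ ≤ c * (n + 1) := by
      split_ifs
      · exact hτ n
      · rw [norm_zero]; positivity
    calc _ ≤ |wt K n ^ 2 - wt K (n + d) ^ 2| * (c * (n + 1)) :=
          mul_le_mul_of_nonneg_left h1 (abs_nonneg _)
      _ = c * (|wt K n ^ 2 - wt K (n + d) ^ 2| * (n + 1)) := by ring
      _ ≤ c * (80 * (wt K n * wt K (n + d))) :=
          mul_le_mul_of_nonneg_left (wt_sq_sub_le K n d hd) hc
      _ = _ := by ring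
  set G := wshift d fun n => ((wt K n ^ 2 - wt K (n + d) ^ 2 : ℝ) : ℂ) *
    (if n < M then τ n else 0) / ((wt K n * wt K (n + d) : ℝ) : ℂ)
  have hcomm : wtOp K (wtOp K (T y)) - T (wtOp K (wtOp K y)) = wtOp K (G (wtOp K y)) := by
    ext n
    rw [lp.coeFn_sub, Pi.sub_apply, cutShift_apply hτ, wtOp_apply, wtOp_apply, wtOp_apply,
      wtOp_apply, wtOp_apply, cutShift_apply hτ, wshift_apply hg, wtOp_apply]
    have h1 : (wt K n : ℂ) ≠ 0 := by exact_mod_cast (wt_pos K n).ne'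
    have h2 : (wt K (n + d) : ℂ) ≠ 0 := by exact_mod_cast (wt_pos K (n + d)).ne'
    push_cast
    field_simp
  -- In the real part, `T - T†` contributes only through the commutator of `T` with the squared
  -- weight.
  have e : (⟪wtOp K y, wtOp K (cutGen d τ M y)⟫_ℂ).re = (⟪wtOp K y, G (wtOp K y)⟫_ℂ).re := by
    have e1 : ⟪wtOp K y, wtOp K (star T y)⟫_ℂ = ⟪T (wtOp K (wtOp K y)), y⟫_ℂ := by
      rw [← inner_wtOp, ContinuousLinearMap.star_eq_adjoint,
        ContinuousLinearMap.adjoint_inner_right]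
    have e2 : (⟪T (wtOp K (wtOp K y)), y⟫_ℂ).re = (⟪y, T (wtOp K (wtOp K y))⟫_ℂ).re :=
      inner_re_symm (𝕜 := ℂ) _ _
    have e3 : ⟪wtOp K y, G (wtOp K y)⟫_ℂ
        = ⟪y, wtOp K (wtOp K (T y))⟫_ℂ - ⟪y, T (wtOp K (wtOp K y))⟫_ℂ := by
      rw [inner_wtOp, ← hcomm, inner_sub_right]
    have e4 : cutGen d τ M y = T y - star T y := rfl
    rw [e4, map_sub, inner_sub_right, e1, Complex.sub_re, e2, e3, Complex.sub_re,
      inner_wtOp]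
  rw [e]
  calc _ ≤ ‖⟪wtOp K y, G (wtOp K y)⟫_ℂ‖ := Complex.abs_re_le_norm _
    _ ≤ ‖wtOp K y‖ * ‖G (wtOp K y)‖ := norm_inner_le_norm _ _
    _ ≤ ‖wtOp K y‖ * (80 * c * ‖wtOp K y‖) := by
        gcongr
        exact G.le_of_opNorm_le (norm_wshift_le hg d) _
    _ = _ := by ring

/-- Two-sided Grönwall inequality: a suitable exponential factor makes `f` antitone for positive
times and monotone for negative ones. -/
theorem le_exp_mul_of_abs_deriv_le {f f' : ℝ → ℝ} {K : ℝ} (hf : ∀ t, HasDerivAt f (f' t) t)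
    (hb : ∀ t, |f' t| ≤ K * f t) (t : ℝ) : f t ≤ Real.exp (K * |t|) * f 0 := by
  have h1 : ∀ a : ℝ, ∀ s, HasDerivAt (fun s => Real.exp (a * s) * f s)
      (Real.exp (a * s) * (a * f s + f' s)) s := fun a s => by
    have := (((hasDerivAt_id s).const_mul a).exp).mul (hf s)
    refine HasDerivAt.congr_deriv (f := fun s => Real.exp (a * s) * f s) this ?_
    simp only [id, mul_one]
    ring
  rcases le_total 0 t with ht | ht
  · have h2 : Antitone fun s => Real.exp (-K * s) * f s :=
      antitone_of_hasDerivAt_nonpos (h1 (-K)) fun s =>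
        mul_nonpos_of_nonneg_of_nonpos (Real.exp_pos _).le (by
          have := (le_abs_self _).trans (hb s); linarith)
    have h3 := h2 ht
    simp only [mul_zero, Real.exp_zero, one_mul] at h3
    rw [abs_of_nonneg ht]
    calc f t = Real.exp (K * t) * (Real.exp (-K * t) * f t) := by
          rw [← mul_assoc, ← Real.exp_add]; simp
      _ ≤ _ := by gcongr
  · have h2 : Monotone fun s => Real.exp (K * s) * f s :=
      monotone_of_hasDerivAt_nonneg (h1 K) fun s =>
        mul_nonneg (Real.exp_pos _).le (by
          have := (neg_abs_le _).trans' (neg_le_neg (hb s)); linarith)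
    have h3 := h2 ht
    simp only [mul_zero, Real.exp_zero, one_mul] at h3
    rw [abs_of_nonpos ht]
    calc f t = Real.exp (K * -t) * (Real.exp (K * t) * f t) := by
          rw [← mul_assoc, ← Real.exp_add]; simp
      _ ≤ _ := by gcongr

theorem hasDerivAt_norm_sq {f : ℝ → Osc} {f' : Osc} {t : ℝ} (h : HasDerivAt f f' t) :
    HasDerivAt (fun s => ‖f s‖ ^ 2) (2 * (⟪f t, f'⟫_ℂ).re) t := by
  have h1 := Complex.reCLM.hasFDerivAt.comp_hasDerivAt t (h.inner ℂ h)
  have h2 : (fun s => ‖f s‖ ^ 2) = Complex.reCLM ∘ fun s => ⟪f s, f s⟫_ℂ := by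
    funext s
    simp [inner_self_eq_norm_sq_to_K, ← Complex.ofReal_pow]
  rw [h2]
  refine h1.congr_deriv ?_
  have h3 : (⟪f', f t⟫_ℂ).re = (⟪f t, f'⟫_ℂ).re := inner_re_symm (𝕜 := ℂ) _ _
  simp only [Complex.reCLM_apply, Complex.add_re, h3]
  ring

/-- Grönwall for the squared norm has rate 160c, and the square root leaves 80c. Neither cut-off
enters the factor, so the estimate survives the limit in `M` and holds for every `K`. -/
theorem norm_wtOp_cutExp_le (hd : d ≤ 2) (hτ : ∀ n, ‖τ n‖ ≤ c * (n + 1)) (K M : ℕ) (t : ℝ)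
    (x : Osc) : ‖wtOp K (cutExp d τ M t x)‖ ≤ Real.exp (80 * c * |t|) * ‖wtOp K x‖ := by
  have h1 : ∀ s, HasDerivAt (fun s => wtOp K (cutExp d τ M s x))
      (wtOp K (cutGen d τ M (cutExp d τ M s x))) s := fun s =>
    ((wtOp K).restrictScalars ℝ).hasFDerivAt.comp_hasDerivAt s
      (HasDerivAt.clm_apply_const (hasDerivAt_cutExp' M s) x)
  have h2 := fun s => hasDerivAt_norm_sq (h1 s)
  have h3 := le_exp_mul_of_abs_deriv_le (K := 160 * c) h2 (fun s => by
    have := re_inner_wtOp_cutGen_le hd hτ K M (cutExp d τ M s x)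
    rw [abs_mul, abs_two]
    linarith) t
  rw [cutExp_zero, one_apply_eq_self] at h3
  refine le_of_sq_le_sq ?_ (by positivity)
  refine h3.trans (le_of_eq ?_)
  rw [mul_pow, ← Real.exp_nat_mul]
  congr 2
  push_cast
  ring

/-- The cut-off generators differ little on vectors with decaying coefficients. -/
theorem norm_cutGen_sub_le (hd : d ≤ 2) (hτ : ∀ n, ‖τ n‖ ≤ c * (n + 1)) {K M : ℕ} (hKM : K ≤ M)
    (y : Osc) :
    ‖(cutGen d τ M - cutGen d τ K) y‖ ≤ 2 * c / (K + 1) * ‖wtOp (M + 2) y‖ := by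
  have hc : 0 ≤ c := by simpa using (norm_nonneg _).trans (hτ 0)
  set δ : ℕ → ℂ := fun n => (if n < M then τ n else 0) - (if n < K then τ n else 0)
  -- The two cut-offs differ only for `K ≤ n < M`, where `τ` is at most c(n+1) and the weight at
  -- least (n+1)²; the quotient gains 1/(K+1).
  have hδ : ∀ n, ∀ e ≤ 2, ‖δ n / (wt (M + 2) (n + e) : ℂ)‖ ≤ c / (K + 1) := by
    intro n e he
    by_cases h : n < M ∧ ¬ n < K
    · have h1 : δ n = τ n := by simp [δ, h.1, h.2]
      have hp := wt_pos (M + 2) (n + e)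
      have hKn : (K : ℝ) ≤ n := by exact_mod_cast not_lt.1 h.2
      rw [h1, norm_div, Complex.norm_real, Real.norm_of_nonneg hp.le, div_le_div_iff₀ hp
        (by positivity)]
      have h2 : ((n : ℝ) + 1) ^ 2 ≤ wt (M + 2) (n + e) := by
        rw [← wt_of_le (show n ≤ M + 2 by omega)]
        exact wt_mono _ (by omega)
      calc ‖τ n‖ * (K + 1) ≤ c * (n + 1) * (n + 1) := by
            gcongr
            exact hτ n
        _ = c * (n + 1) ^ 2 := by ring
        _ ≤ _ := by gcongr
    · have h1 : δ n = 0 := by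
        simp only [δ]
        split_ifs with ha hb hb
        · simp
        · exact absurd ⟨ha, hb⟩ h
        · omega
        · simp
      rw [h1, zero_div, norm_zero]
      positivity
  have e1 : (cutShift d τ M - cutShift d τ K) = wshift d (fun n => δ n / (wt (M + 2) (n + d) : ℂ)) *
      wtOp (M + 2) := by
    ext v n
    rw [sub_apply, lp.coeFn_sub, Pi.sub_apply, cutShift_apply hτ,
      cutShift_apply hτ, clm_mul_apply, wshift_apply (fun n => hδ n d hd),
      wtOp_apply]
    have h2 : (wt (M + 2) (n + d) : ℂ) ≠ 0 := by exact_mod_cast (wt_pos _ (n + d)).ne'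
    field_simp
    simp only [δ]
  -- The second factorization has the weight on the left, so that taking the adjoint moves it next
  -- to `y`.
  have e2 : (cutShift d τ M - cutShift d τ K) = wtOp (M + 2) *
      wshift d (fun n => δ n / (wt (M + 2) (n + 0) : ℂ)) := by
    ext v n
    rw [sub_apply, lp.coeFn_sub, Pi.sub_apply, cutShift_apply hτ,
      cutShift_apply hτ, clm_mul_apply, wtOp_apply,
      wshift_apply (fun n => hδ n 0 (by omega))]
    have h2 : (wt (M + 2) n : ℂ) ≠ 0 := by exact_mod_cast (wt_pos _ n).ne'
    simp only [add_zero]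
    field_simp
    simp only [δ]
  have hsa : star (wtOp (M + 2)) = wtOp (M + 2) := by
    rw [ContinuousLinearMap.star_eq_adjoint]
    exact ((ContinuousLinearMap.eq_adjoint_iff _ _).2 fun x y => inner_wtOp _ x y).symm
  have e3 : (cutGen d τ M - cutGen d τ K) y = (cutShift d τ M - cutShift d τ K) y
      - star (cutShift d τ M - cutShift d τ K) y := by
    simp only [cutGen, star_sub, sub_apply]
    abel
  rw [e3]
  refine (norm_sub_le _ _).trans ?_
  nth_rewrite 1 [e1]
  rw [e2, star_mul, hsa, clm_mul_apply, clm_mul_apply]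
  have h1 := ContinuousLinearMap.le_of_opNorm_le _
    (norm_wshift_le (fun n => hδ n d hd) d) (wtOp (M + 2) y)
  have h2 := ContinuousLinearMap.le_of_opNorm_le _
    ((norm_star _).le.trans (norm_wshift_le (fun n => hδ n 0 (by omega)) d)) (wtOp (M + 2) y)
  refine (add_le_add h1 h2).trans (le_of_eq ?_)
  ring

/-- Duhamel's formula: along `s ↦ exp((t-s)A_M) exp(sA_K) x` the derivative is the difference of the
generators applied to a vector whose decay is controlled uniformly. -/
theorem norm_cutExp_sub_le (hd : d ≤ 2) (hτ : ∀ n, ‖τ n‖ ≤ c * (n + 1)) {K M : ℕ} (hKM : K ≤ M)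
    {x : Osc} {B : ℝ} (hB : ∀ J, ‖wtOp J x‖ ≤ B) (t : ℝ) :
    ‖cutExp d τ M t x - cutExp d τ K t x‖ ≤
      2 * c / (K + 1) * (Real.exp (80 * c * |t|) * B) * |t| := by
  have hc : 0 ≤ c := by simpa using (norm_nonneg _).trans (hτ 0)
  have h1 : ∀ s, HasDerivAt (fun s => cutExp d τ M (t - s) (cutExp d τ K s x))
      (-(cutExp d τ M (t - s) ((cutGen d τ M - cutGen d τ K) (cutExp d τ K s x)))) s := by
    intro s
    have h2 := ((hasDerivAt_cutExp (d := d) (τ := τ) M (t - s)).scomp s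
      ((hasDerivAt_id s).const_sub t))
    have h3 := hasDerivAt_cutExp' (d := d) (τ := τ) K s
    have h4 := HasDerivAt.clm_apply_const (h2.mul h3) x
    refine HasDerivAt.congr_deriv
      (f := fun s => cutExp d τ M (t - s) (cutExp d τ K s x)) h4 ?_
    simp only [Function.comp, add_apply, clm_mul_apply,
      sub_apply, map_sub, neg_smul, one_smul, neg_apply]
    abel
  have h5 := (convex_uIcc (0 : ℝ) t).norm_image_sub_le_of_norm_hasDerivWithin_le
    (C := 2 * c / (K + 1) * (Real.exp (80 * c * |t|) * B))
    (fun s _ => (h1 s).hasDerivWithinAt) (fun s hs => by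
      rw [norm_neg, norm_cutExp]
      refine (norm_cutGen_sub_le hd hτ hKM _).trans ?_
      gcongr
      refine (norm_wtOp_cutExp_le hd hτ _ _ _ _).trans ?_
      have hs' : |s| ≤ |t| := by
        have := Set.abs_sub_left_of_mem_uIcc hs
        simpa using this
      have hB0 : 0 ≤ B := (norm_nonneg _).trans (hB 0)
      exact mul_le_mul (Real.exp_le_exp.2 (by gcongr)) (hB _) (norm_nonneg _) (Real.exp_pos _).le)
    Set.left_mem_uIcc Set.right_mem_uIcc
  simp only [sub_self, sub_zero, cutExp_zero, one_apply_eq_self] at h5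
  rw [norm_sub_rev]
  simpa using h5

theorem norm_cutExp_sub_self_le (M : ℕ) (v : Osc) (t : ℝ) :
    ‖cutExp d τ M t v - v‖ ≤ ‖cutGen d τ M v‖ * |t| := by
  have h5 := (convex_univ (𝕜 := ℝ) (E := ℝ)).norm_image_sub_le_of_norm_hasDerivWithin_le
    (C := ‖cutGen d τ M v‖) (x := 0) (y := t)
    (fun s _ => (HasDerivAt.clm_apply_const
      (hasDerivAt_cutExp (d := d) (τ := τ) M s) v).hasDerivWithinAt) (fun s _ => by
        rw [clm_mul_apply, norm_cutExp]) trivial trivial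
  simpa [cutExp_zero] using h5

/-- A Taylor remainder bounded by the square of the generator on a fixed vector is stable as the
cut-off is removed, and yields the derivative of the limiting group at 0. -/
theorem norm_cutExp_sub_sub_le (M : ℕ) (v : Osc) (t : ℝ) :
    ‖cutExp d τ M t v - v - t • cutGen d τ M v‖ ≤
      ‖cutGen d τ M (cutGen d τ M v)‖ * |t| * |t| := by
  have h5 := (convex_uIcc (0 : ℝ) t).norm_image_sub_le_of_norm_hasDerivWithin_le
    (f := fun s => cutExp d τ M s v - s • cutGen d τ M v)
    (C := ‖cutGen d τ M (cutGen d τ M v)‖ * |t|) (x := 0) (y := t)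
    (fun s _ => ((HasDerivAt.clm_apply_const (hasDerivAt_cutExp (d := d) (τ := τ) M s) v).sub
      ((hasDerivAt_id s).smul_const (cutGen d τ M v))).hasDerivWithinAt) (fun s hs => by
        rw [clm_mul_apply, one_smul]
        refine (norm_cutExp_sub_self_le _ _ _).trans ?_
        have hs' : |s| ≤ |t| := by
          have := Set.abs_sub_left_of_mem_uIcc hs
          simpa using this
        gcongr) Set.left_mem_uIcc Set.right_mem_uIcc
  simp only [cutExp_zero, one_apply_eq_self, zero_smul, sub_zero] at h5
  rw [sub_right_comm]
  simpa using h5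

end cut

/-! ### Decay of Fock coefficients -/

theorem exists_wtOp_incl_le (x : Fin0) : ∃ B : ℝ, ∀ J, ‖wtOp J (incl x)‖ ≤ B := by
  induction x using Finsupp.induction_linear with
  | zero => exact ⟨0, fun J => by simp⟩
  | add f g hf hg =>
    obtain ⟨B, hB⟩ := hf
    obtain ⟨D, hD⟩ := hg
    exact ⟨B + D, fun J => by rw [map_add, map_add]; exact norm_add_le_of_le (hB J) (hD J)⟩
  | single m c =>
    refine ⟨‖c‖ * ((m : ℝ) + 1) ^ 2, fun J => ?_⟩
    have h : wtOp J (fock m) = (wt J m : ℂ) • fock m := by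
      ext n
      rw [wtOp_apply, lp.coeFn_smul, Pi.smul_apply, fock_apply, smul_eq_mul]
      split_ifs with h
      · rw [h]
      · simp
    rw [incl_single, map_smul, h, norm_smul, norm_smul, norm_fock, mul_one, Complex.norm_real,
      Real.norm_of_nonneg (wt_pos J m).le]
    exact mul_le_mul_of_nonneg_left (wt_le J m) (norm_nonneg _)

theorem sum_inv_sq_le (N : ℕ) :
    ∑ n ∈ Finset.range N, (((n : ℝ) + 1) ^ 2)⁻¹ ≤ 2 - 1 / (N : ℝ) := by
  induction N with
  | zero => simp
  | succ N ih =>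
    rw [Finset.sum_range_succ]
    rcases N.eq_zero_or_pos with rfl | hN
    · norm_num
    · have hN' : (0 : ℝ) < N := by exact_mod_cast hN
      have h : (((N : ℝ) + 1) ^ 2)⁻¹ ≤ 1 / (N : ℝ) - 1 / ((N : ℝ) + 1) := by
        rw [div_sub_div _ _ hN'.ne' (by positivity), inv_eq_one_div,
          div_le_div_iff₀ (by positivity) (by positivity)]
        nlinarith
      push_cast
      linarith

/-- Quadratically weighted ℓ² decay gives linearly weighted ℓ¹ decay: (n+1)|vₙ| is the product of
(n+1)²|vₙ| and 1/(n+1), and both factors are square summable. -/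
theorem sum_mul_norm_le {v : Osc} {B : ℝ} (hB : ∀ J, ‖wtOp J v‖ ≤ B) (N : ℕ) :
    ∑ n ∈ Finset.range N, ((n : ℝ) + 1) * ‖v n‖ ≤ B ^ 2 + 2 := by
  have h1 : ∑ n ∈ Finset.range N, (((n : ℝ) + 1) ^ 2 * ‖v n‖) ^ 2 ≤ B ^ 2 := by
    calc _ ≤ ∑ n ∈ Finset.range N, ‖wtOp N v n‖ ^ 2 := by
          refine Finset.sum_le_sum fun n hn => le_of_eq ?_
          rw [wtOp_apply, norm_mul, Complex.norm_real, Real.norm_of_nonneg (wt_pos N n).le,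
            wt_of_le (Finset.mem_range.1 hn).le]
      _ ≤ ‖wtOp N v‖ ^ 2 := sum_le_hasSum _ (fun _ _ => by positivity) (hasSum_norm_sq _)
      _ ≤ B ^ 2 := by
          gcongr
          exact hB N
  have h2 : ∀ n : ℕ, ((n : ℝ) + 1) * ‖v n‖ ≤ (((n : ℝ) + 1) ^ 2 * ‖v n‖) ^ 2 + (((n : ℝ) + 1) ^ 2)⁻¹ := by
    intro n
    have hn : (0 : ℝ) < (n : ℝ) + 1 := by positivity
    set a := ((n : ℝ) + 1) ^ 2 * ‖v n‖
    have h3 : ((n : ℝ) + 1) * ‖v n‖ = a * ((n : ℝ) + 1)⁻¹ := by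
      simp only [a]
      field_simp
    rw [h3, ← inv_pow]
    nlinarith [sq_nonneg (a - ((n : ℝ) + 1)⁻¹), sq_nonneg a, sq_nonneg ((n : ℝ) + 1)⁻¹]
  refine (Finset.sum_le_sum fun n _ => h2 n).trans ?_
  rw [Finset.sum_add_distrib]
  have h3 := sum_inv_sq_le N
  have : (0 : ℝ) ≤ 1 / (N : ℝ) := by positivity
  linarith

theorem dom_of_wtOp_le {v : Osc} {B : ℝ} (hB : ∀ J, ‖wtOp J v‖ ≤ B) : Dom v :=
  summable_of_sum_range_le (fun _ => by positivity) (sum_mul_norm_le hB)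

theorem tsum_mul_norm_le {v : Osc} {B : ℝ} (hB : ∀ J, ‖wtOp J v‖ ≤ B) :
    ∑' n : ℕ, ((n : ℝ) + 1) * ‖v n‖ ≤ B ^ 2 + 2 :=
  Real.tsum_le_of_sum_range_le (fun _ => by positivity) (sum_mul_norm_le hB)

/-! ### The limiting unitary group -/

/-- A strongly continuous unitary group whose generator extends `A`. -/
structure IsGroupOf (A : Module.End ℂ Fin0) (U : ℝ → (Osc ≃ₗᵢ[ℂ] Osc)) : Prop where
  add : ∀ s t : ℝ, ∀ v : Osc, U (s + t) v = U s (U t v)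
  cont : ∀ v : Osc, Continuous fun t : ℝ => U t v
  deriv : ∀ x : Fin0, HasDerivAt (fun t : ℝ => U t (incl x)) (incl (A x)) 0

section limit

variable {d : ℕ} {τ : ℕ → ℂ} {c : ℝ}

/-- On finite combinations the Duhamel bound is O(1/K); density and isometry extend the Cauchy
property to every vector. -/
theorem exists_tendsto_cutExp (hd : d ≤ 2) (hτ : ∀ n, ‖τ n‖ ≤ c * (n + 1)) (t : ℝ) (v : Osc) :
    ∃ u, Tendsto (fun M => cutExp d τ M t v) atTop (𝓝 u) := by
  have hc : 0 ≤ c := by simpa using (norm_nonneg _).trans (hτ 0)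
  refine cauchySeq_tendsto_of_complete (Metric.cauchySeq_iff'.2 fun ε hε => ?_)
  obtain ⟨x, hx⟩ := denseRange_incl.exists_dist_lt v (show 0 < ε / 3 by positivity)
  obtain ⟨B, hB⟩ := exists_wtOp_incl_le x
  set D := 2 * c * (Real.exp (80 * c * |t|) * B) * |t|
  have h0 : Tendsto (fun K : ℕ => D * (1 / ((K : ℝ) + 1))) atTop (𝓝 (D * 0)) :=
    tendsto_one_div_add_atTop_nhds_zero_nat.const_mul D
  rw [mul_zero] at h0
  obtain ⟨K, hK⟩ := (h0.eventually (gt_mem_nhds (show 0 < ε / 3 by positivity))).exists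
  refine ⟨K, fun M hM => ?_⟩
  have h1 := norm_cutExp_sub_le hd hτ hM hB t
  rw [dist_eq_norm]
  have e : cutExp d τ M t v - cutExp d τ K t v = cutExp d τ M t (v - incl x)
      + (cutExp d τ M t (incl x) - cutExp d τ K t (incl x)) - cutExp d τ K t (v - incl x) := by
    simp only [map_sub]; abel
  rw [e]
  have h2 : ‖v - incl x‖ < ε / 3 := by rwa [← dist_eq_norm]
  have h3 : 2 * c / ((K : ℝ) + 1) * (Real.exp (80 * c * |t|) * B) * |t| = D * (1 / ((K : ℝ) + 1)) := by
    simp only [D]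
    ring
  calc _ ≤ ‖cutExp d τ M t (v - incl x)‖ + ‖cutExp d τ M t (incl x) - cutExp d τ K t (incl x)‖
        + ‖cutExp d τ K t (v - incl x)‖ := norm_sub_le_of_le (norm_add_le _ _) le_rfl
    _ < ε := by
        rw [norm_cutExp, norm_cutExp]
        linarith

/-- Group law, isometry and weighted bound pass to the strong limit, with `u (-t)` as the inverse of
`u t`. The estimates at time zero pass as well, because on each finite combination the cut-off
generators eventually equal `A`. -/
theorem exists_unitaryGroup (hd : d ≤ 2) (hτ : ∀ n, ‖τ n‖ ≤ c * (n + 1)) {A : Module.End ℂ Fin0}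
    (hA : ∀ x : Fin0, ∀ᶠ M in atTop, cutGen d τ M (incl x) = incl (A x)) :
    ∃ U : ℝ → (Osc ≃ₗᵢ[ℂ] Osc), IsGroupOf A U ∧
      ∀ t v J, ‖wtOp J (U t v)‖ ≤ Real.exp (80 * c * |t|) * ‖wtOp J v‖ := by
  choose u hu using fun t v => exists_tendsto_cutExp hd hτ (t := t) (v := v)
  have hadd : ∀ s t v, u (s + t) v = u s (u t v) := by
    intro s t v
    refine tendsto_nhds_unique (hu (s + t) v) ?_
    rw [tendsto_iff_norm_sub_tendsto_zero]
    have h1 := tendsto_iff_norm_sub_tendsto_zero.1 (hu t v)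
    have h2 := tendsto_iff_norm_sub_tendsto_zero.1 (hu s (u t v))
    refine squeeze_zero (fun _ => norm_nonneg _) (fun M => ?_) (by simpa using h1.add h2)
    rw [cutExp_add, clm_mul_apply]
    calc _ = ‖cutExp d τ M s (cutExp d τ M t v - u t v)
          + (cutExp d τ M s (u t v) - u s (u t v))‖ := by rw [map_sub]; congr 1; abel
      _ ≤ ‖cutExp d τ M s (cutExp d τ M t v - u t v)‖
          + ‖cutExp d τ M s (u t v) - u s (u t v)‖ := norm_add_le _ _
      _ = _ := by rw [norm_cutExp]
  have hzero : ∀ v, u 0 v = v := fun v => by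
    refine tendsto_nhds_unique (hu 0 v) ?_
    simp only [cutExp_zero, one_apply_eq_self]
    exact tendsto_const_nhds
  have hnorm : ∀ t v, ‖u t v‖ = ‖v‖ := fun t v => by
    refine tendsto_nhds_unique (hu t v).norm ?_
    simp only [norm_cutExp]
    exact tendsto_const_nhds
  let U : ℝ → (Osc ≃ₗᵢ[ℂ] Osc) := fun t =>
    { toFun := u t
      map_add' := fun v w => tendsto_nhds_unique (hu t (v + w)) (by
        simpa only [map_add] using (hu t v).add (hu t w))
      map_smul' := fun a v => tendsto_nhds_unique (hu t (a • v)) (by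
        simp only [map_smul]
        exact (hu t v).const_smul a)
      invFun := u (-t)
      left_inv := fun v => by rw [← hadd, neg_add_cancel, hzero]
      right_inv := fun v => by rw [← hadd, add_neg_cancel, hzero]
      norm_map' := hnorm t }
  have hlip : ∀ x : Fin0, ∀ t, ‖u t (incl x) - incl x‖ ≤ ‖incl (A x)‖ * |t| := fun x t => by
    refine le_of_tendsto ((hu t (incl x)).sub_const _).norm ?_
    filter_upwards [hA x] with M hM
    rw [← hM]
    exact norm_cutExp_sub_self_le M _ t
  refine ⟨U, ⟨hadd, fun v => ?_, fun x => ?_⟩, fun t v J => ?_⟩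
  · rw [Metric.continuous_iff]
    intro t ε hε
    obtain ⟨x, hx⟩ := denseRange_incl.exists_dist_lt v (show 0 < ε / 3 by positivity)
    rw [dist_eq_norm] at hx
    refine ⟨ε / 3 / (‖incl (A x)‖ + 1), by positivity, fun s hs => ?_⟩
    rw [Real.dist_eq] at hs
    rw [dist_eq_norm]
    have e : U s v - U t v = U s (v - incl x) + U t (U (s - t) (incl x) - incl x)
        - U t (v - incl x) := by
      have : U s (incl x) = U t (U (s - t) (incl x)) := by
        change u s _ = u t (u _ _)
        rw [← hadd]; congr 1; ring
      simp only [map_sub, this]; abel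
    rw [e]
    refine (norm_sub_le_of_le (norm_add_le _ _) le_rfl).trans_lt ?_
    simp only [LinearIsometryEquiv.norm_map]
    have h1 : ‖U (s - t) (incl x) - incl x‖ ≤ ‖incl (A x)‖ * |s - t| := hlip x (s - t)
    have h2 : ‖incl (A x)‖ * |s - t| ≤ (‖incl (A x)‖ + 1) * (ε / 3 / (‖incl (A x)‖ + 1)) := by
      gcongr
      linarith
    rw [mul_div_cancel₀ _ (by positivity)] at h2
    linarith
  · have h1 : ∀ t, ‖u t (incl x) - incl x - t • incl (A x)‖ ≤ ‖incl (A (A x))‖ * |t| * |t| :=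
      fun t => by
        refine le_of_tendsto (((hu t (incl x)).sub_const _).sub_const _).norm ?_
        filter_upwards [hA x, hA (A x)] with M hM hM'
        rw [← hM', ← hM]
        exact norm_cutExp_sub_sub_le M _ t
    rw [hasDerivAt_iff_isLittleO_nhds_zero]
    have h2 : (fun h : ℝ => u (0 + h) (incl x) - u 0 (incl x) - h • incl (A x)) =O[𝓝 0]
        fun h : ℝ => h ^ 2 := by
      refine Asymptotics.IsBigO.of_bound ‖incl (A (A x))‖ (Eventually.of_forall fun h => ?_)
      rw [zero_add, hzero]
      refine (h1 h).trans (le_of_eq ?_)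
      rw [Real.norm_eq_abs, abs_pow]
      ring
    exact h2.trans_isLittleO (by simpa using Asymptotics.isLittleO_pow_pow (𝕜 := ℝ) one_lt_two)
  · refine le_of_tendsto ((((wtOp J).continuous.tendsto _).comp (hu t v)).norm)
      (Eventually.of_forall fun M => ?_)
    exact norm_wtOp_cutExp_le hd hτ J M t v

end limit

theorem eventually_cutGen_incl {d : ℕ} {τ : ℕ → ℂ} {c : ℝ} (hτ : ∀ n, ‖τ n‖ ≤ c * (n + 1))
    {A : Module.End ℂ Fin0} (hA : ∀ m n, (A (Finsupp.single m 1)) n =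
      (if m = n + d then τ n else 0) - (if n = m + d then star (τ m) else 0)) (x : Fin0) :
    ∀ᶠ M in atTop, cutGen d τ M (incl x) = incl (A x) := by
  induction x using Finsupp.induction_linear with
  | zero => simp
  | add f g hf hg =>
    filter_upwards [hf, hg] with M h1 h2
    simp only [map_add, h1, h2]
  | single m a =>
    filter_upwards [eventually_gt_atTop m] with M hM
    have ha : Finsupp.single m a = a • Finsupp.single m (1 : ℂ) := by simp
    rw [ha]
    simp only [map_smul]
    congr 1
    ext n
    rw [incl_apply, hA, incl_single, one_smul]
    change (cutShift d τ M (fock m) - star (cutShift d τ M) (fock m)) n = _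
    rw [lp.coeFn_sub, Pi.sub_apply, cutShift_apply hτ, ← inner_fock_left n,
      ContinuousLinearMap.star_eq_adjoint, ContinuousLinearMap.adjoint_inner_right,
      inner_fock_right, cutShift_apply hτ, fock_apply, fock_apply]
    congr 1
    · by_cases h : m = n + d
      · have : n < M := by omega
        simp [h, this]
      · simp [h]
    · by_cases h : n = m + d
      · simp [h, hM]
      · simp [h]

/-! ### Groups generated by extensions of a skew operator -/

namespace IsGroupOf

variable {A : Module.End ℂ Fin0} {U : ℝ → (Osc ≃ₗᵢ[ℂ] Osc)}

theorem zero (h : IsGroupOf A U) (v : Osc) : U 0 v = v := by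
  have := h.add 0 0 v
  rw [add_zero] at this
  exact ((U 0).injective this).symm

theorem inner_right (h : IsGroupOf A U) (t : ℝ) (v w : Osc) :
    ⟪v, U t w⟫_ℂ = ⟪U (-t) v, w⟫_ℂ := by
  rw [← (U (-t)).inner_map_map v, ← h.add, neg_add_cancel, h.zero]

theorem hasDerivAt (h : IsGroupOf A U) (x : Fin0) (t : ℝ) :
    HasDerivAt (fun s => U s (incl x)) (U t (incl (A x))) t := by
  have h1 := h.deriv x
  rw [← sub_self t] at h1
  have h2 := HasDerivAt.comp_sub_const t t h1
  have h3 := ((U t).toContinuousLinearEquiv.toContinuousLinearMap.restrictScalars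
    ℝ).hasFDerivAt.comp_hasDerivAt t h2
  refine h3.congr_of_eventuallyEq (Eventually.of_forall fun s => ?_)
  change U s (incl x) = U t (U (s - t) (incl x))
  rw [← h.add]
  congr 2
  ring

/-- Weakly, `U t A x = A U t x`: the function `⟨z, U s x⟩ = ⟨U (-s) z, x⟩` is differentiated once
with the group acting on `x` and once with it acting on `z`. -/
theorem inner_gen (h : IsGroupOf A U) (z x : Fin0) (t : ℝ) :
    ⟪incl z, U t (incl (A x))⟫_ℂ = -⟪incl (A z), U t (incl x)⟫_ℂ := by
  have h1 : HasDerivAt (fun s => ⟪incl z, U s (incl x)⟫_ℂ) (⟪incl z, U t (incl (A x))⟫_ℂ) t := by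
    simpa using (hasDerivAt_const t (incl z)).inner ℂ (h.hasDerivAt x t)
  have h2 : HasDerivAt (fun s => U (-s) (incl z)) (-(U (-t) (incl (A z)))) t := by
    have := (h.hasDerivAt z (-t)).scomp t (hasDerivAt_neg t)
    rwa [neg_one_smul] at this
  have h3 : HasDerivAt (fun s => ⟪U (-s) (incl z), incl x⟫_ℂ)
      (-⟪incl (A z), U t (incl x)⟫_ℂ) t := by
    have := h2.inner ℂ (hasDerivAt_const t (incl x))
    refine this.congr_deriv ?_
    rw [inner_zero_right, zero_add, inner_neg_left, ← h.inner_right]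
  refine h1.unique (h3.congr_of_eventuallyEq (Eventually.of_forall fun s => ?_))
  exact h.inner_right s _ _

/-- Bounded weak solutions of `w' = A w` on `[0, 1]` are given by the group. -/
theorem weak_unique (h : IsGroupOf A U) (hskew : FAdj A (-A)) (hdeg : Deg2 A)
    (hdom : ∀ x t, Dom (U t (incl x))) {w : ℝ → Osc} {B : ℝ}
    (hB : ∀ t ∈ Set.Icc (0 : ℝ) 1, ‖w t‖ ≤ B)
    (hw : ∀ t ∈ Set.Icc (0 : ℝ) 1, ∀ z : Fin0, HasDerivWithinAt (fun s => ⟪incl z, w s⟫_ℂ)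
      (-⟪incl (A z), w t⟫_ℂ) (Set.Icc 0 1) t) : w 1 = U 1 (w 0) := by
  -- The equation is extended from finite test vectors to `U t z` by truncation; boundedness of `w`
  -- makes the convergence of derivatives uniform in time.
  have h1 : ∀ t ∈ Set.Icc (0 : ℝ) 1, ∀ z : Fin0, HasDerivWithinAt
      (fun s => ⟪U t (incl z), w s⟫_ℂ) (-⟪U t (incl (A z)), w t⟫_ℂ) (Set.Icc 0 1) t := by
    intro t ht z
    have htr := hdeg.tendsto_trunc (M' := -A) hskew.symm (hdom z t)
      (m := U t (incl (A z))) (fun y => by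
        rw [h.inner_gen, LinearMap.neg_apply, map_neg, inner_neg_left])
    refine hasDerivWithinAt_of_tendsto (convex_Icc 0 1)
      (g := fun k s => ⟪incl (trunc k (U t (incl z))), w s⟫_ℂ)
      (g' := fun k s => -⟪incl (A (trunc k (U t (incl z)))), w s⟫_ℂ)
      (f' := fun s => -⟪U t (incl (A z)), w s⟫_ℂ)
      (b := fun k => ‖incl (A (trunc k (U t (incl z)))) - U t (incl (A z))‖ * B)
      (fun k s hs => hw s hs _) (fun s _ => (tendsto_trunc _).inner tendsto_const_nhds)
      (fun k s hs => ?_) ?_ ht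
    · rw [neg_sub_neg, ← inner_sub_left, norm_sub_rev (incl _)]
      exact (norm_inner_le_norm _ _).trans (mul_le_mul_of_nonneg_left (hB s hs) (norm_nonneg _))
    · have := (tendsto_iff_norm_sub_tendsto_zero.1 htr).mul_const B
      rwa [zero_mul] at this
  have h2 : ∀ z : Fin0, ⟪U 1 (incl z), w 1⟫_ℂ = ⟪U 0 (incl z), w 0⟫_ℂ := by
    intro z
    -- The motion of the test vector cancels the motion of `w`, so this pairing is conserved.
    have h3 : ∀ t ∈ Set.Icc (0 : ℝ) 1, HasDerivWithinAt (fun s => ⟪U s (incl z), w s⟫_ℂ) 0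
        (Set.Icc 0 1) t := by
      intro t ht
      have := hasDerivWithinAt_inner_weak (h.hasDerivAt z t).hasDerivWithinAt hB (h1 t ht z)
        (h1 t ht (A z)).continuousWithinAt
      rwa [add_neg_cancel] at this
    have h4 := (convex_Icc (0 : ℝ) 1).norm_image_sub_le_of_norm_hasDerivWithin_le (C := 0) h3
      (fun _ _ => by simp) (Set.left_mem_Icc.2 zero_le_one) (Set.right_mem_Icc.2 zero_le_one)
    rw [zero_mul, norm_le_zero_iff, sub_eq_zero] at h4
    exact h4
  have h5 : U (-1) (w 1) = w 0 := by
    refine ext_inner_incl fun z => ?_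
    have := h2 z
    rw [h.zero] at this
    rw [h.inner_right, neg_neg, this]
  rw [← h5, ← h.add]
  norm_num [h.zero]

/-- Every orbit of a competing group is a bounded weak solution, so uniqueness applies although
nothing is known about decay under `W`. -/
theorem eq_of_isGroupOf (h : IsGroupOf A U) (hskew : FAdj A (-A)) (hdeg : Deg2 A)
    (hdom : ∀ x t, Dom (U t (incl x))) {W : ℝ → (Osc ≃ₗᵢ[ℂ] Osc)} (hW : IsGroupOf A W) :
    W 1 = U 1 := by
  ext1 v
  have := h.weak_unique hskew hdeg hdom (w := fun t => W t v) (B := ‖v‖)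
    (fun t _ => ((W t).norm_map v).le) (fun t _ z => by
      have h2 : HasDerivAt (fun s => W (-s) (incl z)) (-(W (-t) (incl (A z)))) t := by
        have := (hW.hasDerivAt z (-t)).scomp t (hasDerivAt_neg t)
        rwa [neg_one_smul] at this
      have h3 : HasDerivAt (fun s => ⟪W (-s) (incl z), v⟫_ℂ) (-⟪incl (A z), W t v⟫_ℂ) t := by
        have := h2.inner ℂ (hasDerivAt_const t v)
        refine this.congr_deriv ?_
        rw [inner_zero_right, zero_add, inner_neg_left, ← hW.inner_right]
      refine (h3.congr_of_eventuallyEq (Eventually.of_forall fun s => ?_)).hasDerivWithinAt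
      exact hW.inner_right s _ _)
  simpa only [hW.zero] using this

end IsGroupOf

/-! ### Intertwining relations -/

/-- `P† V = V N`, tested on the finite Fock combinations. -/
def Intertwines (V : Osc ≃ₗᵢ[ℂ] Osc) (P N : Module.End ℂ Fin0) : Prop :=
  ∀ z x : Fin0, ⟪incl (P z), V (incl x)⟫_ℂ = ⟪incl z, V (incl (N x))⟫_ℂ

theorem inner_symm_right (V : Osc ≃ₗᵢ[ℂ] Osc) (v w : Osc) :
    ⟪v, V.symm w⟫_ℂ = ⟪V v, w⟫_ℂ := by
  rw [← V.inner_map_map v, V.apply_symm_apply]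

theorem Intertwines.symm {V : Osc ≃ₗᵢ[ℂ] Osc} {P N : Module.End ℂ Fin0}
    (h : Intertwines V P N) : Intertwines V.symm N P := fun z x => by
  rw [inner_symm_right, inner_symm_right, ← inner_conj_symm, ← h, inner_conj_symm]

theorem Intertwines.mul {V : Osc ≃ₗᵢ[ℂ] Osc} {P N P' N' : Module.End ℂ Fin0}
    (h : Intertwines V P N) (h' : Intertwines V P' N') : Intertwines V (P * P') (N' * N) :=
  fun z x => by
    rw [Module.End.mul_apply, Module.End.mul_apply, h, h']

/-- `S x` is no longer a finite combination, so the relation for `D` is applied to its truncations,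
on which `N` converges by decay. -/
theorem Intertwines.comp {D S : Osc ≃ₗᵢ[ℂ] Osc} {P N N' K : Module.End ℂ Fin0}
    (hD : Intertwines D P N) (hS : Intertwines S N' K) (hN : FAdj N' N) (hdeg : Deg2 N)
    (hdom : ∀ x, Dom (S (incl x))) : Intertwines (S.trans D) P K := fun z x => by
  have h1 := hdeg.tendsto_trunc (v := S (incl x)) (m := S (incl (K x))) hN (hdom x)
    fun y => (hS y x).symm
  have h2 : Tendsto (fun k => ⟪incl z, D (incl (N (trunc k (S (incl x)))))⟫_ℂ) atTop
      (𝓝 ⟪incl z, D (S (incl (K x)))⟫_ℂ) :=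
    tendsto_const_nhds.inner ((D.continuous.tendsto _).comp h1)
  have h3 : Tendsto (fun k => ⟪incl (P z), D (incl (trunc k (S (incl x))))⟫_ℂ) atTop
      (𝓝 ⟪incl (P z), D (S (incl x))⟫_ℂ) :=
    tendsto_const_nhds.inner ((D.continuous.tendsto _).comp (tendsto_trunc _))
  simp only [hD z] at h3
  exact tendsto_nhds_unique h3 h2

/-- Heisenberg evolution of a linear combination of `a`, `a†`, `1` under `exp A`. -/
theorem IsGroupOf.intertwines {A : Module.End ℂ Fin0} {U : ℝ → (Osc ≃ₗᵢ[ℂ] Osc)}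
    (h : IsGroupOf A U) (hskew : FAdj A (-A)) (hdeg : Deg2 A) {k : ℝ}
    (hU : ∀ t v J, ‖wtOp J (U t v)‖ ≤ Real.exp (k * |t|) * ‖wtOp J v‖)
    {c₁ c₂ c₃ c₁' c₂' c₃' : ℝ → ℂ} (h₁ : ∀ t, HasDerivAt c₁ (c₁' t) t)
    (h₂ : ∀ t, HasDerivAt c₂ (c₂' t) t) (h₃ : ∀ t, HasDerivAt c₃ (c₃' t) t)
    (hcomm : ∀ t, aff (star (c₁' t)) (star (c₂' t)) (star (c₃' t)) =
      A * aff (star (c₁ t)) (star (c₂ t)) (star (c₃ t)) -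
        aff (star (c₁ t)) (star (c₂ t)) (star (c₃ t)) * A) :
    Intertwines (U 1) (aff (star (c₁ 1)) (star (c₂ 1)) (star (c₃ 1)))
      (aff (c₂ 0) (c₁ 0) (c₃ 0)) := by
  intro z x
  have hk : ∀ x : Fin0, ∃ B, ∀ t ∈ Set.Icc (-1 : ℝ) 1, ∀ J, ‖wtOp J (U t (incl x))‖ ≤ B := by
    intro x
    obtain ⟨B, hB⟩ := exists_wtOp_incl_le x
    refine ⟨Real.exp |k| * B, fun t ht J => (hU t _ J).trans ?_⟩
    refine mul_le_mul (Real.exp_le_exp.2 ?_) (hB J) (norm_nonneg _) (Real.exp_pos _).le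
    calc k * |t| ≤ |k| * 1 := mul_le_mul (le_abs_self k) (abs_le.2 ht) (abs_nonneg _) (abs_nonneg _)
      _ = |k| := mul_one _
  have hdom : ∀ x t, Dom (U t (incl x)) := fun x t => by
    obtain ⟨B, hB⟩ := exists_wtOp_incl_le x
    refine dom_of_wtOp_le (B := Real.exp (k * |t|) * B) fun J => (hU t _ J).trans ?_
    gcongr
    exact hB J
  obtain ⟨B, hB⟩ := hk x
  -- `m₁` and `m₂` will stand for `a† U t x` and `a U t x`, which exist because `U t x` decays; then
  -- `w t = (c₁ a† + c₂ a + c₃) U t x`.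
  obtain ⟨C₁, hC₁, hm₁⟩ := deg2_cre.exists_weak fadj_ann_cre
  obtain ⟨C₂, hC₂, hm₂⟩ := deg2_ann.exists_weak fadj_ann_cre.symm
  choose m₁ hm₁ hb₁ using fun t => hm₁ (U t (incl x)) (hdom x t)
  choose m₂ hm₂ hb₂ using fun t => hm₂ (U t (incl x)) (hdom x t)
  set w : ℝ → Osc := fun t => c₁ t • m₁ t + c₂ t • m₂ t + c₃ t • U t (incl x)
  have hwz : ∀ t z, ⟪incl z, w t⟫_ℂ =
      ⟪incl (aff (star (c₁ t)) (star (c₂ t)) (star (c₃ t)) z), U t (incl x)⟫_ℂ := by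
    intro t z
    simp only [w, aff, inner_add_right, inner_smul_right, hm₁, hm₂, LinearMap.add_apply,
      LinearMap.smul_apply, map_add, map_smul, inner_add_left, inner_smul_left,
      Module.End.one_apply]
    simp
  have hbdd : ∀ f f' : ℝ → ℂ, (∀ t, HasDerivAt f (f' t) t) →
      ∃ D, ∀ t ∈ Set.Icc (0 : ℝ) 1, ‖f t‖ ≤ D := fun f f' hf =>
    isCompact_Icc.exists_bound_of_continuousOn
      fun t _ => (hf t).continuousAt.continuousWithinAt
  obtain ⟨D₁, hD₁⟩ := hbdd _ _ h₁
  obtain ⟨D₂, hD₂⟩ := hbdd _ _ h₂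
  obtain ⟨D₃, hD₃⟩ := hbdd _ _ h₃
  -- By `hcomm` the coefficients obey the Heisenberg equation, so `w` solves `w' = A w` weakly and
  -- equals the group applied to `w 0`, a finite combination.
  have hw1 := h.weak_unique hskew hdeg hdom (w := w)
    (B := D₁ * (C₁ * (B ^ 2 + 2)) + D₂ * (C₂ * (B ^ 2 + 2)) + D₃ * ‖incl x‖) (fun t ht => by
      have ht' : t ∈ Set.Icc (-1 : ℝ) 1 := ⟨by linarith [ht.1], ht.2⟩
      have hts := tsum_mul_norm_le (hB t ht')
      refine (norm_add₃_le).trans (add_le_add (add_le_add ?_ ?_) ?_)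
      · rw [norm_smul]
        exact mul_le_mul (hD₁ t ht) ((hb₁ t).trans (mul_le_mul_of_nonneg_left hts hC₁))
          (norm_nonneg _) ((norm_nonneg _).trans (hD₁ t ht))
      · rw [norm_smul]
        exact mul_le_mul (hD₂ t ht) ((hb₂ t).trans (mul_le_mul_of_nonneg_left hts hC₂))
          (norm_nonneg _) ((norm_nonneg _).trans (hD₂ t ht))
      · rw [norm_smul, (U t).norm_map]
        exact mul_le_mul_of_nonneg_right (hD₃ t ht) (norm_nonneg _)) (fun t ht z => by
      have hin : ∀ y : Fin0, HasDerivAt (fun s => ⟪incl y, U s (incl x)⟫_ℂ)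
          (-⟪incl (A y), U t (incl x)⟫_ℂ) t := fun y => by
        rw [← h.inner_gen]
        simpa using (hasDerivAt_const t (incl y)).inner ℂ (h.hasDerivAt x t)
      have hd := (((h₁ t).mul (hin (ann z))).add ((h₂ t).mul (hin (cre z)))).add
        ((h₃ t).mul (hin z))
      refine HasDerivAt.hasDerivWithinAt ((hd.congr_of_eventuallyEq
        (Eventually.of_forall fun s => ?_)).congr_deriv ?_)
      · change ⟪incl z, w s⟫_ℂ = c₁ s * ⟪incl (ann z), U s (incl x)⟫_ℂ +
          c₂ s * ⟪incl (cre z), U s (incl x)⟫_ℂ + c₃ s * ⟪incl z, U s (incl x)⟫_ℂ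
        rw [hwz]
        simp [aff]
        ring
      · have e := congrArg (fun M : Module.End ℂ Fin0 => ⟪incl (M z), U t (incl x)⟫_ℂ) (hcomm t)
        simp only [LinearMap.sub_apply, Module.End.mul_apply, map_sub, inner_sub_left] at e
        rw [hwz]
        have e' : ⟪incl (A (aff (star (c₁ t)) (star (c₂ t)) (star (c₃ t)) z)), U t (incl x)⟫_ℂ =
            c₁ t * ⟪incl (A (ann z)), U t (incl x)⟫_ℂ + c₂ t * ⟪incl (A (cre z)), U t (incl x)⟫_ℂ
            + c₃ t * ⟪incl (A z), U t (incl x)⟫_ℂ := by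
          simp [aff]
          ring
        have e'' : ⟪incl (aff (star (c₁' t)) (star (c₂' t)) (star (c₃' t)) z), U t (incl x)⟫_ℂ =
            c₁' t * ⟪incl (ann z), U t (incl x)⟫_ℂ + c₂' t * ⟪incl (cre z), U t (incl x)⟫_ℂ
            + c₃' t * ⟪incl z, U t (incl x)⟫_ℂ := by
          simp [aff]
          ring
        rw [e', e''] at e
        linear_combination e)
  rw [← hwz, hw1]
  congr 2
  refine ext_inner_incl fun y => ?_
  rw [hwz, h.zero, (fadj_aff _ _ _) y x]
  simp

/-! ### Generators with decay-preserving unitary groups -/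

/-- `A` is skew, of degree at most two, and generates a unitary group that preserves the decay
of Fock coefficients. -/
structure HasDecayGroup (A : Module.End ℂ Fin0) : Prop where
  skew : FAdj A (-A)
  deg : Deg2 A
  exists_group : ∃ (U : ℝ → (Osc ≃ₗᵢ[ℂ] Osc)) (k : ℝ), IsGroupOf A U ∧
    ∀ t v J, ‖wtOp J (U t v)‖ ≤ Real.exp (k * |t|) * ‖wtOp J v‖

theorem IsGroupOf.isUnitaryExp {A : Module.End ℂ Fin0} {U : ℝ → (Osc ≃ₗᵢ[ℂ] Osc)}
    (h : IsGroupOf A U) : IsUnitaryExp A (U 1) := ⟨U, h.add, h.cont, h.deriv, rfl⟩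

theorem dom_of_wtOp_apply_le {T : Osc → Osc} {C : ℝ} (hC : 0 ≤ C)
    (hT : ∀ v J, ‖wtOp J (T v)‖ ≤ C * ‖wtOp J v‖) (x : Fin0) : Dom (T (incl x)) := by
  obtain ⟨B, hB⟩ := exists_wtOp_incl_le x
  exact dom_of_wtOp_le (B := C * B) fun J => (hT _ J).trans (by gcongr; exact hB J)

theorem HasDecayGroup.eq_of_isUnitaryExp {A : Module.End ℂ Fin0} (h : HasDecayGroup A)
    {V W : Osc ≃ₗᵢ[ℂ] Osc} (hV : IsUnitaryExp A V) (hW : IsUnitaryExp A W) : V = W := by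
  obtain ⟨U, k, hU, hk⟩ := h.exists_group
  have hdom : ∀ x t, Dom (U t (incl x)) := fun x t =>
    dom_of_wtOp_apply_le (Real.exp_pos _).le (hk t) x
  obtain ⟨V', h1, h2, h3, rfl⟩ := hV
  obtain ⟨W', h4, h5, h6, rfl⟩ := hW
  rw [hU.eq_of_isGroupOf h.skew h.deg hdom ⟨h1, h2, h3⟩,
    hU.eq_of_isGroupOf h.skew h.deg hdom ⟨h4, h5, h6⟩]

theorem HasDecayGroup.existsUnique {A : Module.End ℂ Fin0} (h : HasDecayGroup A) :
    ∃! V, IsUnitaryExp A V := by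
  obtain ⟨U, k, hU, -⟩ := id h.exists_group
  exact ⟨U 1, hU.isUnitaryExp, fun V hV => h.eq_of_isUnitaryExp hV hU.isUnitaryExp⟩

theorem HasDecayGroup.unitaryExp_eq {A : Module.End ℂ Fin0} (h : HasDecayGroup A)
    {U : ℝ → (Osc ≃ₗᵢ[ℂ] Osc)} (hU : IsGroupOf A U) : unitaryExp A = U 1 :=
  h.eq_of_isUnitaryExp (Classical.epsilon_spec ⟨_, hU.isUnitaryExp⟩) hU.isUnitaryExp

theorem HasDecayGroup.exists_bound {A : Module.End ℂ Fin0} (h : HasDecayGroup A) :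
    ∃ C : ℝ, 0 ≤ C ∧ (∀ v J, ‖wtOp J (unitaryExp A v)‖ ≤ C * ‖wtOp J v‖) ∧
      ∀ v J, ‖wtOp J ((unitaryExp A).symm v)‖ ≤ C * ‖wtOp J v‖ := by
  obtain ⟨U, k, hU, hk⟩ := h.exists_group
  refine ⟨Real.exp k, (Real.exp_pos _).le, fun v J => ?_, fun v J => ?_⟩
  · rw [h.unitaryExp_eq hU]
    simpa using hk 1 v J
  · rw [h.unitaryExp_eq hU]
    have : (U 1).symm v = U (-1) v := by
      rw [LinearIsometryEquiv.symm_apply_eq, ← hU.add, add_neg_cancel, hU.zero]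
    rw [this]
    simpa using hk (-1) v J

theorem hasDecayGroup_of_shift {A : Module.End ℂ Fin0} (hskew : FAdj A (-A)) (hdeg : Deg2 A)
    {d : ℕ} {τ : ℕ → ℂ} {c : ℝ} (hd : d ≤ 2) (hτ : ∀ n, ‖τ n‖ ≤ c * (n + 1))
    (hA : ∀ m n, (A (Finsupp.single m 1)) n =
      (if m = n + d then τ n else 0) - (if n = m + d then star (τ m) else 0)) :
    HasDecayGroup A := by
  obtain ⟨U, hU, hk⟩ := exists_unitaryGroup hd hτ (eventually_cutGen_incl hτ hA)
  exact ⟨hskew, hdeg, U, 80 * c, hU, hk⟩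

theorem star_ofReal' (x : ℝ) : star (x : ℂ) = x := Complex.conj_ofReal x

theorem displacementGen_eq (α : ℂ) : displacementGen α = aff (-star α) α 0 := by
  simp only [displacementGen, aff]
  module

theorem hasDecayGroup_displacementGen (α : ℂ) : HasDecayGroup (displacementGen α) := by
  refine hasDecayGroup_of_shift (d := 1) (τ := fun n => -star α * (Real.sqrt (n + 1) : ℝ))
    (c := ‖α‖) ?_ ?_ (by norm_num) (fun n => ?_) (fun m n => ?_)
  · have h := fadj_aff (-star α) α 0
    rw [← displacementGen_eq] at h
    convert h using 1
    simp only [displacementGen, aff, star_neg, star_star, star_zero]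
    module
  · rw [displacementGen_eq]
    exact deg2_aff _ _ _
  · rw [norm_mul, norm_neg, norm_star, norm_ofReal_sqrt]
    gcongr
    exact sqrt_le_self_of_le le_rfl (by linarith [n.cast_nonneg (α := ℝ)])
  · simp only [displacementGen, LinearMap.sub_apply, LinearMap.smul_apply, ann_single, cre_single,
      Finsupp.sub_apply, Finsupp.smul_apply, Finsupp.single_apply, one_mul, smul_eq_mul, star_mul,
      star_neg, star_star, star_ofReal']
    rcases m with _ | m
    · by_cases h : n = 1
      · subst h
        simp
      · simp [h, Ne.symm h]
    · simp only [Nat.add_sub_cancel, add_left_inj]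
      by_cases h : m = n
      · subst h
        have h1 : ¬ m + 1 + 1 = m := by omega
        simp [h1, Ne.symm h1]
      · by_cases h' : n = m + 1 + 1
        · subst h'
          simp [h]
          ring
        · simp [h, h', Ne.symm h']

theorem squeezingGen_eq (ζ : ℂ) : squeezingGen ζ =
    (1 / 2 * star ζ) • (ann * ann) + (-(1 / 2 * ζ)) • (cre * cre) := by
  simp only [squeezingGen]
  module

theorem hasDecayGroup_squeezingGen (ζ : ℂ) : HasDecayGroup (squeezingGen ζ) := by
  refine hasDecayGroup_of_shift (d := 2)
    (τ := fun n => (1 / 2 : ℂ) * (star ζ * ((Real.sqrt (n + 1) * Real.sqrt (n + 1 + 1) : ℝ))))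
    (c := ‖ζ‖) ?_ ?_ le_rfl (fun n => ?_) (fun m n => ?_)
  · have h := (((fadj_ann_cre.mul fadj_ann_cre).smul (star ζ)).add
      ((fadj_ann_cre.symm.mul fadj_ann_cre.symm).smul (-ζ))).smul (1 / 2)
    convert h using 1
    · simp only [squeezingGen]
      module
    · have : star (1 / 2 : ℂ) = 1 / 2 := by
        have := star_ofReal' (1 / 2)
        push_cast at this
        exact this
      simp only [squeezingGen, this, star_star, star_neg]
      module
  · rw [squeezingGen_eq]
    exact (deg2_ann_ann.smul _).add (deg2_cre_cre.smul _)
  · rw [norm_mul, norm_mul, norm_star, Complex.norm_real, Real.norm_of_nonneg (by positivity)]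
    have hn := n.cast_nonneg (α := ℝ)
    -- The factor 1/2 in the generator cancels this 2, whence the constant `‖ζ‖`.
    have : Real.sqrt ((n : ℝ) + 1) * Real.sqrt ((n : ℝ) + 1 + 1) ≤ 2 * (n + 1) :=
      sqrt_mul_sqrt_le (by linarith) (by linarith) (by linarith)
    have h2 : ‖(1 / 2 : ℂ)‖ = 1 / 2 := by norm_num
    rw [h2]
    nlinarith [norm_nonneg ζ, mul_le_mul_of_nonneg_left this (norm_nonneg ζ)]
  · have h2 : star (1 / 2 : ℂ) = 1 / 2 := by
        have := star_ofReal' (1 / 2)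
        push_cast at this
        exact this
    simp only [squeezingGen, LinearMap.sub_apply, LinearMap.smul_apply, Module.End.mul_apply,
      ann_single, cre_single, Finsupp.sub_apply, Finsupp.smul_apply, Finsupp.single_apply, one_mul,
      smul_eq_mul, star_mul, star_star, star_ofReal', h2]
    rcases m with _ | _ | m
    · by_cases h : n = 2
      · subst h
        simp
        ring_nf
      · simp [h, Ne.symm h]
    · by_cases h : n = 3
      · subst h
        simp
        ring_nf
      · simp [h, Ne.symm h]
    · simp only [Nat.add_sub_cancel, add_left_inj]
      by_cases h : m = n
      · subst h
        have h1 : ¬ m + 1 + 1 + 1 + 1 = m := by omega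
        simp [h1, Ne.symm h1]
        left
        ring
      · by_cases h' : n = m + 1 + 1 + 1 + 1
        · subst h'
          simp [h]
          ring
        · have h'' : ¬ n = m + 1 + 1 + 2 := h'
          simp [h, h'', Ne.symm h']

/-! ### Action on the ladder operators -/

/-- The commutator of the generator with a linear form is a scalar, so only the constant term
evolves, linearly in time. The parameter `1 - t` puts the original form at time 1 and the shifted
one at time 0. -/
theorem intertwines_displacement (α c d e : ℂ) :
    Intertwines (displacement α) (aff (star d) (star c) (star e))
      (aff c d (e + (c * α + d * star α))) := by
  have hA := hasDecayGroup_displacementGen α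
  obtain ⟨U, k, hU, hk⟩ := id hA.exists_group
  have h := hU.intertwines hA.skew hA.deg hk (c₁ := fun _ => d) (c₂ := fun _ => c)
    (c₃ := fun t => e + (1 - (t : ℂ)) * (c * α + d * star α)) (c₁' := fun _ => 0)
    (c₂' := fun _ => 0) (c₃' := fun _ => -(c * α + d * star α))
    (fun t => hasDerivAt_const _ _) (fun t => hasDerivAt_const _ _) (fun t => by
      have := (((hasDerivAt_id t).ofReal_comp.const_sub 1).mul_const (c * α + d * star α)).const_add e
      simpa using this) (fun t => by
      have hc := ann_cre_comm
      simp only [displacementGen_eq, aff, mul_add, add_mul, smul_mul_assoc,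
        mul_smul_comm, hc, one_mul, mul_one, star_zero, star_neg, star_add, star_mul, star_star]
      module)
  have hD : displacement α = U 1 := hA.unitaryExp_eq hU
  rw [hD]
  simpa using h

theorem ann_ann_cre : ann * ann * cre = cre * (ann * ann) + (2 : ℂ) • ann := by
  rw [mul_assoc, ann_cre_comm, mul_add, ← mul_assoc, ann_cre_comm, add_mul, mul_assoc]
  simp only [one_mul, mul_one]
  module

theorem ann_cre_cre : ann * (cre * cre) = cre * cre * ann + (2 : ℂ) • cre := by
  rw [← mul_assoc, ann_cre_comm, add_mul, mul_assoc, ann_cre_comm, mul_add, ← mul_assoc]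
  simp only [one_mul, mul_one]
  module

/-- Bogoliubov transformation: commuting with the generator exchanges a and a†, so their
coefficients solve a hyperbolic rotation of angle `r (1 - t)`, again run backwards from time 1. -/
theorem intertwines_squeezing (r φ : ℝ) (c d e : ℂ) :
    Intertwines (squeezing (r * Complex.exp (Complex.I * φ)))
      (aff (star d) (star c) (star e))
      (aff (c * Real.cosh r - d * Complex.exp (-(Complex.I * φ)) * Real.sinh r)
        (d * Real.cosh r - c * Complex.exp (Complex.I * φ) * Real.sinh r) e) := by
  set p := Complex.exp (Complex.I * φ)
  set q := Complex.exp (-(Complex.I * φ))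
  have hpq : p * q = 1 := by
    simp only [p, q]
    rw [← Complex.exp_add, add_neg_cancel, Complex.exp_zero]
  have hsp : star p = q := by
    simp only [p, q]
    change (starRingEnd ℂ) _ = _
    rw [← Complex.exp_conj]
    simp
  have hsq : star q = p := by rw [← hsp, star_star]
  have hA := hasDecayGroup_squeezingGen (r * p)
  obtain ⟨U, k, hU, hk⟩ := id hA.exists_group
  have hcosh : ∀ t : ℝ, HasDerivAt (fun t : ℝ => ((Real.cosh (r * (1 - t)) : ℝ) : ℂ))
      (-(r * (Real.sinh (r * (1 - t)) : ℝ)) : ℂ) t := fun t => by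
    have := (((hasDerivAt_id t).const_sub 1).const_mul r).cosh.ofReal_comp
    refine this.congr_deriv ?_
    push_cast
    simp only [id]
    ring
  have hsinh : ∀ t : ℝ, HasDerivAt (fun t : ℝ => ((Real.sinh (r * (1 - t)) : ℝ) : ℂ))
      (-(r * (Real.cosh (r * (1 - t)) : ℝ)) : ℂ) t := fun t => by
    have := (((hasDerivAt_id t).const_sub 1).const_mul r).sinh.ofReal_comp
    refine this.congr_deriv ?_
    push_cast
    simp only [id]
    ring
  have h := hU.intertwines hA.skew hA.deg hk
    (c₁ := fun t => d * (Real.cosh (r * (1 - t)) : ℝ) - c * p * (Real.sinh (r * (1 - t)) : ℝ))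
    (c₂ := fun t => c * (Real.cosh (r * (1 - t)) : ℝ) - d * q * (Real.sinh (r * (1 - t)) : ℝ))
    (c₃ := fun _ => e)
    (c₁' := fun t => r * p * (c * (Real.cosh (r * (1 - t)) : ℝ)
      - d * q * (Real.sinh (r * (1 - t)) : ℝ)))
    (c₂' := fun t => r * q * (d * (Real.cosh (r * (1 - t)) : ℝ)
      - c * p * (Real.sinh (r * (1 - t)) : ℝ))) (c₃' := fun _ => 0)
    (fun t => by
      refine (((hcosh t).const_mul d).sub ((hsinh t).const_mul (c * p))).congr_deriv ?_
      linear_combination (r * d * Real.sinh (r * (1 - t))) * hpq) (fun t => by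
      refine (((hcosh t).const_mul c).sub ((hsinh t).const_mul (d * q))).congr_deriv ?_
      linear_combination (r * c * Real.sinh (r * (1 - t))) * hpq)
    (fun t => hasDerivAt_const _ _) (fun t => by
      have h1 := ann_ann_cre
      have h2 := ann_cre_cre
      generalize hc' : c * (Real.cosh (r * (1 - t)) : ℝ)
        - d * q * (Real.sinh (r * (1 - t)) : ℝ) = c'
      generalize hd' : d * (Real.cosh (r * (1 - t)) : ℝ)
        - c * p * (Real.sinh (r * (1 - t)) : ℝ) = d'
      simp only [squeezingGen_eq, aff, mul_add, add_mul, smul_mul_assoc,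
        mul_smul_comm, h1, h2, one_mul, mul_one, star_zero, star_mul, star_ofReal', hsp, hsq,
        mul_assoc ann ann ann, mul_assoc cre cre cre]
      module)
  have hS : squeezing (r * p) = U 1 := hA.unitaryExp_eq hU
  rw [hS]
  simpa using h

/-! ### The unitary onto the frame of the target state -/

/-- The unitary `D(α) S(ζ)`. -/
def squeezeDisplace (α ζ : ℂ) : Osc ≃ₗᵢ[ℂ] Osc := (squeezing ζ).trans (displacement α)

/-- Both directions are needed: weak solutions are carried into the target frame and back. -/
theorem squeezeDisplace_bound (α ζ : ℂ) : ∃ C : ℝ, 0 ≤ C ∧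
    (∀ v J, ‖wtOp J (squeezeDisplace α ζ v)‖ ≤ C * ‖wtOp J v‖) ∧
      ∀ v J, ‖wtOp J ((squeezeDisplace α ζ).symm v)‖ ≤ C * ‖wtOp J v‖ := by
  obtain ⟨C, hC, h1, h2⟩ := (hasDecayGroup_displacementGen α).exists_bound
  obtain ⟨D, hD, h3, h4⟩ := (hasDecayGroup_squeezingGen ζ).exists_bound
  refine ⟨C * D, by positivity, fun v J => ?_, fun v J => ?_⟩
  · refine (h1 _ J).trans ?_
    rw [mul_assoc]
    exact mul_le_mul_of_nonneg_left (h3 v J) hC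
  · refine (h4 _ J).trans ?_
    rw [mul_comm C, mul_assoc]
    exact mul_le_mul_of_nonneg_left (h2 v J) hD

theorem dom_squeezeDisplace (α ζ : ℂ) (x : Fin0) : Dom (squeezeDisplace α ζ (incl x)) := by
  obtain ⟨C, hC, h, -⟩ := squeezeDisplace_bound α ζ
  exact dom_of_wtOp_apply_le hC h x

theorem dom_squeezeDisplace_symm (α ζ : ℂ) (x : Fin0) :
    Dom ((squeezeDisplace α ζ).symm (incl x)) := by
  obtain ⟨C, hC, -, h⟩ := squeezeDisplace_bound α ζ
  exact dom_of_wtOp_apply_le hC h x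

theorem intertwines_squeezeDisplace (α : ℂ) (r φ : ℝ) (c d e : ℂ) :
    Intertwines (squeezeDisplace α (r * Complex.exp (Complex.I * φ)))
      (aff (star d) (star c) (star e))
      (aff (c * Real.cosh r - d * Complex.exp (-(Complex.I * φ)) * Real.sinh r)
        (d * Real.cosh r - c * Complex.exp (Complex.I * φ) * Real.sinh r)
        (e + (c * α + d * star α))) := by
  refine (intertwines_displacement α c d e).comp (intertwines_squeezing r φ c d _)
    (fadj_aff _ _ _).symm (deg2_aff _ _ _) ?_
  obtain ⟨C, hC, h, -⟩ :=
    (hasDecayGroup_squeezingGen (r * Complex.exp (Complex.I * φ))).exists_bound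
  exact dom_of_wtOp_apply_le hC h

/-- The squeezed coherent state is Lipschitz along real rescalings of the displacement. -/
theorem exists_norm_squeezedCoherent_sub_le (α ζ : ℂ) : ∃ K : ℝ, ∀ c : ℝ,
    ‖squeezedCoherent (c * α) ζ - squeezedCoherent α ζ‖ ≤ K * |c - 1| := by
  have hA := hasDecayGroup_displacementGen α
  obtain ⟨U, k, hU, hk⟩ := id hA.exists_group
  -- Displacements along one ray form a single one-parameter group; uniqueness of the exponential
  -- identifies it.
  have hc : ∀ c : ℝ, displacement (c * α) = U c := by
    intro c
    have h1 : IsGroupOf (displacementGen (c * α)) (fun t => U (c * t)) := by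
      refine ⟨fun s t v => ?_, fun v => (hU.cont v).comp (continuous_const_mul c), fun x => ?_⟩
      · rw [mul_add, hU.add]
      · have h2 : displacementGen (c * α) = (c : ℂ) • displacementGen α := by
          simp only [displacementGen, star_mul, star_ofReal']
          module
        have h3 := (hU.hasDerivAt x (c * 0)).scomp 0 ((hasDerivAt_id (0 : ℝ)).const_mul c)
        refine h3.congr_deriv ?_
        rw [h2, mul_zero, hU.zero, mul_one, real_smul_eq, LinearMap.smul_apply, map_smul]
    have := (hasDecayGroup_displacementGen (c * α)).unitaryExp_eq h1
    rwa [mul_one] at this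
  have h1 := hc 1
  rw [Complex.ofReal_one, one_mul] at h1
  obtain ⟨C, hC, h, -⟩ := (hasDecayGroup_squeezingGen ζ).exists_bound
  have hdom := dom_of_wtOp_apply_le hC h (Finsupp.single 0 1)
  set v := unitaryExp (squeezingGen ζ) (incl (Finsupp.single 0 1))
  -- The squeezed vacuum `v` decays fast enough for the generator to act on it, with value `m`; its
  -- orbit is then Lipschitz with constant `‖m‖`, as seen on truncations.
  obtain ⟨D, -, hD⟩ := hA.deg.exists_weak (M' := -displacementGen α) hA.skew.symm
  obtain ⟨m, hm, -⟩ := hD v hdom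
  have ht := hA.deg.tendsto_trunc hA.skew.symm hdom hm
  refine ⟨‖m‖, fun c => ?_⟩
  have hv : ∀ β, squeezedCoherent β ζ = displacement β v := fun β => by
    simp only [squeezedCoherent, squeezedFock, v, incl_single, one_smul]
    rfl
  rw [hv, hv, hc, h1]
  refine le_of_tendsto_of_tendsto'
    (((((U c).continuous.tendsto _).comp (tendsto_trunc v)).sub
      (((U 1).continuous.tendsto _).comp (tendsto_trunc v))).norm) (ht.norm.mul_const _) fun j => ?_
  have := (convex_univ (𝕜 := ℝ) (E := ℝ)).norm_image_sub_le_of_norm_hasDerivWithin_le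
    (x := 1) (y := c) (fun s _ => (hU.hasDerivAt (trunc j v) s).hasDerivWithinAt)
    (fun s _ => ((U s).norm_map _).le) trivial trivial
  simpa using this

/-! ### Square roots and absolute values of bounded operators -/

section absOp

variable {E : Type*} [NormedAddCommGroup E] [InnerProductSpace ℂ E] [CompleteSpace E]

theorem exists_isPositive_mul_self {ρ : E →L[ℂ] E} (h : ρ.IsPositive) :
    ∃ s : E →L[ℂ] E, s.IsPositive ∧ s * s = ρ :=
  ⟨CFC.sqrt ρ, (ContinuousLinearMap.nonneg_iff_isPositive _).1 (CFC.sqrt_nonneg ρ),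
    CFC.sqrt_mul_sqrt_self ρ ((ContinuousLinearMap.nonneg_iff_isPositive ρ).2 h)⟩

theorem isPositive_absOp (T : E →L[ℂ] E) : (absOp T).IsPositive :=
  (ContinuousLinearMap.nonneg_iff_isPositive _).1 (CFC.abs_nonneg T)

/-- `|T|` is approximately `g T` for a contraction `g`. -/
theorem exists_norm_absOp_sub_le {T : E →L[ℂ] E} (hT : IsSelfAdjoint T) {δ : ℝ} (hδ : 0 < δ) :
    ∃ g : E →L[ℂ] E, ‖g‖ ≤ 1 ∧ ‖absOp T - g * T‖ ≤ δ := by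
  have hpd : ∀ x : ℝ, 0 < |x| + δ := fun x => by positivity
  -- A continuous substitute for the sign function; replacing |x| by `f x * x` costs |x|δ/(|x|+δ) ≤
  -- δ.
  set f : ℝ → ℝ := fun x => x / (|x| + δ)
  have hf : Continuous f := continuous_id.div (continuous_abs.add continuous_const)
    fun x => (hpd x).ne'
  refine ⟨cfc f T, ?_, ?_⟩
  · refine norm_cfc_le zero_le_one fun x _ => ?_
    rw [Real.norm_eq_abs, abs_div, abs_of_pos (hpd x), div_le_one (hpd x)]
    linarith
  · have hgT : cfc f T * T = cfc (fun x => f x * x) T := by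
      rw [cfc_mul f (fun x => x) T hf.continuousOn continuousOn_id, cfc_id' ℝ T]
    have e : absOp T = cfc (fun x : ℝ => ‖x‖) T := CFC.abs_eq_cfc_norm T hT
    rw [e, hgT, ← cfc_sub (fun x : ℝ => ‖x‖) (fun x => f x * x) T continuous_norm.continuousOn
      (hf.mul continuous_id).continuousOn]
    refine norm_cfc_le hδ.le fun x _ => ?_
    have e2 : ‖x‖ - f x * x = |x| * δ / (|x| + δ) := by
      have := (hpd x).ne'
      simp only [f, Real.norm_eq_abs]
      field_simp
      rw [← sq_abs x]
      ring
    rw [e2, Real.norm_of_nonneg (by positivity), div_le_iff₀ (hpd x)]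
    nlinarith [abs_nonneg x]

end absOp

/-! ### Density operators as mixtures of pure states -/

/-- Tonelli for a nonnegative double family, in a form that also gives convergence of the other
iterated sum. -/
theorem hasSum_comm_of_nonneg {ι κ : Type*} {f : ι → κ → ℝ} (h0 : ∀ i k, 0 ≤ f i k) {g : ι → ℝ}
    (hg : ∀ i, HasSum (f i) (g i)) {a : ℝ} (ha : HasSum g a) {h : κ → ℝ}
    (hh : ∀ k, HasSum (fun i => f i k) (h k)) : HasSum h a := by
  have hs : Summable fun p : ι × κ => f p.1 p.2 :=
    (summable_prod_of_nonneg fun p => h0 p.1 p.2).2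
      ⟨fun i => (hg i).summable, by simpa only [(hg _).tsum_eq] using ha.summable⟩
  have h1 : HasSum g (∑' p : ι × κ, f p.1 p.2) := hs.hasSum.prod_fiberwise hg
  have h2 : HasSum h (∑' p : ι × κ, f p.1 p.2) :=
    ((Equiv.prodComm κ ι).hasSum_iff.2 hs.hasSum).prod_fiberwise hh
  rwa [ha.unique h1]

/-- `ρ = ∑ᵢ |wᵢ⟩⟨wᵢ|` with total weight one. -/
structure IsMixture {ι : Type*} (ρ : Osc →L[ℂ] Osc) (w : ι → Osc) : Prop where
  norm_sq : HasSum (fun i => ‖w i‖ ^ 2) 1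
  inner : ∀ x y, HasSum (fun i => ⟪x, w i⟫_ℂ * ⟪w i, y⟫_ℂ) ⟪x, ρ y⟫_ℂ

theorem inner_mul_inner_self (x w : Osc) :
    ⟪x, w⟫_ℂ * ⟪w, x⟫_ℂ = ((‖⟪x, w⟫_ℂ‖ ^ 2 : ℝ) : ℂ) := by
  rw [← inner_conj_symm w x, Complex.mul_conj, Complex.normSq_eq_norm_sq]

theorem IsMixture.hasSum_diag {ι : Type*} {ρ : Osc →L[ℂ] Osc} {w : ι → Osc} (h : IsMixture ρ w)
    (x : Osc) : HasSum (fun i => ‖⟪x, w i⟫_ℂ‖ ^ 2) (⟪x, ρ x⟫_ℂ).re := by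
  have := Complex.hasSum_re (h.inner x x)
  simpa only [inner_mul_inner_self, Complex.ofReal_re] using this

theorem IsMixture.inner_self_eq {ι : Type*} {ρ : Osc →L[ℂ] Osc} {w : ι → Osc} (h : IsMixture ρ w)
    (x : Osc) : ⟪x, ρ x⟫_ℂ = ((⟪x, ρ x⟫_ℂ).re : ℂ) := by
  have h1 := h.inner x x
  simp only [inner_mul_inner_self] at h1
  exact h1.unique (Complex.hasSum_ofReal.2 (h.hasSum_diag x))

/-- The trace of a mixture, in any orthonormal basis of the form `V |n⟩`. -/
theorem IsMixture.hasSum_trace {ι : Type*} {ρ : Osc →L[ℂ] Osc} {w : ι → Osc} (h : IsMixture ρ w)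
    (V : Osc ≃ₗᵢ[ℂ] Osc) : HasSum (fun n => (⟪V (fock n), ρ (V (fock n))⟫_ℂ).re) 1 := by
  refine hasSum_comm_of_nonneg (f := fun i n => ‖⟪V (fock n), w i⟫_ℂ‖ ^ 2)
    (fun _ _ => by positivity) (fun i => ?_) h.norm_sq fun n => h.hasSum_diag _
  have := hasSum_norm_sq (V.symm (w i))
  rw [V.symm.norm_map] at this
  simpa only [← inner_fock_left, inner_symm_right] using this

theorem IsMixture.isDensity {ι : Type*} {ρ : Osc →L[ℂ] Osc} {w : ι → Osc} (h : IsMixture ρ w) :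
    IsDensity ρ := by
  constructor
  · rw [ContinuousLinearMap.isPositive_iff_complex]
    intro x
    have h1 := h.inner_self_eq x
    have h2 : ⟪ρ x, x⟫_ℂ = ((⟪x, ρ x⟫_ℂ).re : ℂ) := by
      rw [← inner_conj_symm, h1]
      simp
    rw [h2]
    refine ⟨by simp, ?_⟩
    simpa using (h.hasSum_diag x).nonneg fun _ => by positivity
  · have h1 := Complex.hasSum_ofReal.2 (h.hasSum_trace (LinearIsometryEquiv.refl ℂ Osc))
    simp only [← h.inner_self_eq, Complex.ofReal_one] at h1
    exact h1

/-- The vectors √ρ|j⟩ serve: Parseval gives ρ as the sum of their projections, and no eigenbasis is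
needed. -/
theorem IsDensity.exists_mixture {ρ : Osc →L[ℂ] Osc} (h : IsDensity ρ) :
    ∃ w : ℕ → Osc, IsMixture ρ w := by
  obtain ⟨s, hs, hss⟩ := exists_isPositive_mul_self h.1
  have hsym : ∀ x y, ⟪s x, y⟫_ℂ = ⟪x, s y⟫_ℂ := fun x y => hs.isSymmetric x y
  have hin : ∀ x y, ⟪x, ρ y⟫_ℂ = ⟪s x, s y⟫_ℂ := fun x y => by
    rw [hsym, ← hss]; rfl
  refine ⟨fun j => s (fock j), ?_, fun x y => ?_⟩
  · have h1 := Complex.hasSum_re h.2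
    rw [Complex.one_re] at h1
    refine h1.congr_fun fun j => ?_
    rw [hin, inner_self_eq_norm_sq_to_K]
    norm_cast
  · have := fockBasis.hasSum_inner_mul_inner (s x) (s y)
    simp only [fockBasis_apply] at this
    rw [hin]
    refine this.congr_fun fun j => ?_
    rw [← hsym, hsym (fock j)]

theorem exists_isMixture {ι : Type*} {w : ι → Osc} (h : HasSum (fun i => ‖w i‖ ^ 2) 1) :
    ∃ ρ, IsMixture ρ w := by
  have hs : Summable fun i => pureState (w i) := by
    refine Summable.of_norm ?_
    simpa only [pureState, InnerProductSpace.norm_rankOne, ← pow_two] using h.summable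
  refine ⟨∑' i, pureState (w i), h, fun x y => ?_⟩
  have h1 := ((innerSL ℂ x).comp (ContinuousLinearMap.apply ℂ Osc y)).hasSum hs.hasSum
  refine h1.congr_fun fun i => ?_
  simp [pureState, InnerProductSpace.rankOne_apply, mul_comm]

theorem IsMixture.norm_inner_le {ι : Type*} {ρ : Osc →L[ℂ] Osc} {w : ι → Osc} (h : IsMixture ρ w)
    (x y : Osc) : ‖⟪x, ρ y⟫_ℂ‖ ≤ ‖x‖ * ‖y‖ := by
  have h1 := h.norm_sq.mul_left (‖x‖ * ‖y‖)
  rw [mul_one] at h1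
  rw [← (h.inner x y).tsum_eq]
  refine tsum_of_norm_bounded h1 fun i => ?_
  rw [norm_mul]
  calc _ ≤ (‖x‖ * ‖w i‖) * (‖w i‖ * ‖y‖) :=
        mul_le_mul (norm_inner_le_norm _ _) (norm_inner_le_norm _ _) (norm_nonneg _) (by positivity)
    _ = _ := by ring

theorem IsDensity.norm_inner_le {ρ : Osc →L[ℂ] Osc} (h : IsDensity ρ) (x y : Osc) :
    ‖⟪x, ρ y⟫_ℂ‖ ≤ ‖x‖ * ‖y‖ := by
  obtain ⟨w, hw⟩ := h.exists_mixture
  exact hw.norm_inner_le x y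

theorem pureState_isMixture {ψ : Osc} (h : ‖ψ‖ = 1) :
    IsMixture (pureState ψ) fun _ : Unit => ψ := by
  constructor
  · simp [h]
  · intro x y
    simp [pureState, InnerProductSpace.rankOne_apply, mul_comm]

/-- Conjugation `V† ρ V` by a unitary. -/
def conj (V : Osc ≃ₗᵢ[ℂ] Osc) (ρ : Osc →L[ℂ] Osc) : Osc →L[ℂ] Osc :=
  (V.symm.toContinuousLinearEquiv : Osc →L[ℂ] Osc) ∘L ρ ∘L
    (V.toContinuousLinearEquiv : Osc →L[ℂ] Osc)

theorem conj_apply (V : Osc ≃ₗᵢ[ℂ] Osc) (ρ : Osc →L[ℂ] Osc) (x : Osc) :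
    conj V ρ x = V.symm (ρ (V x)) := rfl

theorem inner_conj (V : Osc ≃ₗᵢ[ℂ] Osc) (ρ : Osc →L[ℂ] Osc) (x y : Osc) :
    ⟪x, conj V ρ y⟫_ℂ = ⟪V x, ρ (V y)⟫_ℂ := by
  rw [conj_apply, inner_symm_right]

theorem conj_symm_conj (V : Osc ≃ₗᵢ[ℂ] Osc) (ρ : Osc →L[ℂ] Osc) :
    conj V.symm (conj V ρ) = ρ := by
  ext1 x
  simp [conj_apply]

theorem IsMixture.conj {ι : Type*} {ρ : Osc →L[ℂ] Osc} {w : ι → Osc} (h : IsMixture ρ w)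
    (V : Osc ≃ₗᵢ[ℂ] Osc) : IsMixture (conj V ρ) fun i => V.symm (w i) := by
  constructor
  · simpa only [V.symm.norm_map] using h.norm_sq
  · intro x y
    have := h.inner (V x) (V y)
    rw [inner_conj]
    convert this using 3 with i
    · exact inner_symm_right V x (w i)
    · rw [← inner_conj_symm, inner_symm_right, inner_conj_symm]

theorem IsDensity.conj {ρ : Osc →L[ℂ] Osc} (h : IsDensity ρ) (V : Osc ≃ₗᵢ[ℂ] Osc) :
    IsDensity (conj V ρ) := by
  obtain ⟨w, hw⟩ := h.exists_mixture
  exact (hw.conj V).isDensity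

/-! ### Trace-norm bounds -/

/-- `|Tr (P g T)| ≤ S` for all contractions `g` and all coordinate projections `P`. -/
def NuclearBound (T : Osc →L[ℂ] Osc) (S : ℝ) : Prop :=
  ∀ g : Osc →L[ℂ] Osc, ‖g‖ ≤ 1 → ∀ N : ℕ,
    ‖∑ n ∈ Finset.range N, ⟪fock n, g (T (fock n))⟫_ℂ‖ ≤ S

theorem NuclearBound.add {T₁ T₂ : Osc →L[ℂ] Osc} {S₁ S₂ : ℝ} (h₁ : NuclearBound T₁ S₁)
    (h₂ : NuclearBound T₂ S₂) : NuclearBound (T₁ + T₂) (S₁ + S₂) := fun g hg N => by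
  simp only [add_apply, map_add, inner_add_right, Finset.sum_add_distrib]
  exact norm_add_le_of_le (h₁ g hg N) (h₂ g hg N)

theorem sum_norm_mul_norm_le (v w : Osc) (N : ℕ) :
    ∑ n ∈ Finset.range N, ‖v n‖ * ‖w n‖ ≤ ‖v‖ * ‖w‖ := by
  refine le_of_sq_le_sq ((Finset.sum_mul_sq_le_sq_mul_sq _ _ _).trans ?_) (by positivity)
  rw [mul_pow]
  exact mul_le_mul (sum_le_hasSum _ (fun _ _ => by positivity) (hasSum_norm_sq v))
    (sum_le_hasSum _ (fun _ _ => by positivity) (hasSum_norm_sq w))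
    (Finset.sum_nonneg fun _ _ => by positivity) (by positivity)

/-- For a rank-one term |a⟩⟨b|, Cauchy–Schwarz over the first `N` coordinates bounds the truncated
trace of g|a⟩⟨b| by ‖a‖‖b‖. -/
theorem nuclearBound_of_hasSum {ι : Type*} {T : Osc →L[ℂ] Osc} {a b : ι → Osc} {c : ι → ℝ} {S : ℝ}
    (h : ∀ x y, HasSum (fun i => ⟪x, a i⟫_ℂ * ⟪b i, y⟫_ℂ) ⟪x, T y⟫_ℂ)
    (hc : ∀ i, ‖a i‖ * ‖b i‖ ≤ c i) (hS : HasSum c S) : NuclearBound T S := by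
  intro g hg N
  have h1 : ∀ n, HasSum (fun i => (g (a i)) n * star (b i n)) ⟪fock n, g (T (fock n))⟫_ℂ := by
    intro n
    have := h (ContinuousLinearMap.adjoint g (fock n)) (fock n)
    simpa only [ContinuousLinearMap.adjoint_inner_left, inner_fock_left, inner_fock_right] using this
  have h2 := hasSum_sum (s := Finset.range N) fun n _ => h1 n
  rw [← h2.tsum_eq]
  refine tsum_of_norm_bounded hS fun i => ?_
  refine (norm_sum_le _ _).trans ?_
  simp only [norm_mul, norm_star]
  refine (sum_norm_mul_norm_le _ _ N).trans (le_trans ?_ (hc i))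
  gcongr
  simpa using g.le_of_opNorm_le hg (a i)

/-- Since |T| is nearly `g T` with a contraction `g`, each partial trace of |T| is nearly one of the
bounded sums. -/
theorem traceNorm_le_of_nuclearBound {T : Osc →L[ℂ] Osc} (hT : IsSelfAdjoint T) {S : ℝ}
    (h : NuclearBound T S) : traceNorm T ≤ ENNReal.ofReal S := by
  have hpos := isPositive_absOp T
  refine ENNReal.tsum_le_of_sum_range_le fun N => ?_
  have h0 : ∀ n, 0 ≤ (⟪fock n, absOp T (fock n)⟫_ℂ).re := fun n =>
    (Complex.le_def.1 (hpos.inner_nonneg_right (fock n))).1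
  rw [← ENNReal.ofReal_sum_of_nonneg fun n _ => h0 n]
  refine ENNReal.ofReal_le_ofReal (le_of_forall_pos_le_add fun ε hε => ?_)
  -- The error `δ` is incurred once for each of the `N` diagonal entries.
  set δ := ε / (N + 1)
  have hδ : 0 < δ := by positivity
  obtain ⟨g, hg, hdiff⟩ := exists_norm_absOp_sub_le hT hδ
  have h3 := h g hg N
  have h4 : ∀ n, (⟪fock n, absOp T (fock n)⟫_ℂ).re ≤ (⟪fock n, g (T (fock n))⟫_ℂ).re + δ := by
    intro n
    have h5 : ‖⟪fock n, (absOp T - g * T) (fock n)⟫_ℂ‖ ≤ δ := by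
      refine (norm_inner_le_norm _ _).trans ?_
      rw [norm_fock, one_mul]
      simpa [norm_fock] using (absOp T - g * T).le_of_opNorm_le hdiff (fock n)
    rw [sub_apply, inner_sub_right, clm_mul_apply] at h5
    have := (Complex.re_le_norm _).trans h5
    rw [Complex.sub_re] at this
    linarith
  calc _ ≤ ∑ n ∈ Finset.range N, ((⟪fock n, g (T (fock n))⟫_ℂ).re + δ) :=
        Finset.sum_le_sum fun n _ => h4 n
    _ = (∑ n ∈ Finset.range N, ⟪fock n, g (T (fock n))⟫_ℂ).re + N * δ := by
        rw [Finset.sum_add_distrib, Complex.re_sum]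
        simp
    _ ≤ S + ε := by
        refine add_le_add ((Complex.re_le_norm _).trans h3) ?_
        simp only [δ]
        rw [mul_div_assoc', div_le_iff₀ (by positivity)]
        nlinarith

/-- A density operator with small infidelity is close to the pure state in trace norm. -/
theorem traceNorm_sub_pureState_le {ρ : Osc →L[ℂ] Osc} (hρ : IsDensity ρ) {ψ : Osc}
    (hψ : ‖ψ‖ = 1) {η : ℝ} (hη : 0 < η) :
    traceNorm (ρ - pureState ψ) ≤ ENNReal.ofReal
      (η + (1 - (⟪ψ, ρ ψ⟫_ℂ).re) * (η⁻¹ + 1)) := by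
  obtain ⟨w, hw⟩ := hρ.exists_mixture
  set P := pureState ψ
  set δ := 1 - (⟪ψ, ρ ψ⟫_ℂ).re
  have hPapp : ∀ x, P x = ⟪ψ, x⟫_ℂ • ψ := fun x => by
    simp [P, pureState, InnerProductSpace.rankOne_apply]
  have hPsym : ∀ x y, ⟪P x, y⟫_ℂ = ⟪x, P y⟫_ℂ := fun x y => by
    rw [hPapp, hPapp, inner_smul_left, inner_smul_right, inner_conj_symm, mul_comm]
  have hQsym : ∀ x y, ⟪x - P x, y⟫_ℂ = ⟪x, y - P y⟫_ℂ := fun x y => by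
    rw [inner_sub_left, inner_sub_right, hPsym]
  have hnP : ∀ x, ‖P x‖ ^ 2 = ‖⟪ψ, x⟫_ℂ‖ ^ 2 := fun x => by
    rw [hPapp, norm_smul, hψ, mul_one]
  have hPP : ∀ x, P (P x) = P x := fun x => by
    rw [hPapp (P x), hPapp x, inner_smul_right, inner_self_eq_norm_sq_to_K, hψ]
    simp
  have hpyth : ∀ x, ‖x - P x‖ ^ 2 = ‖x‖ ^ 2 - ‖⟪ψ, x⟫_ℂ‖ ^ 2 := fun x => by
    have h1 : ‖x‖ * ‖x‖ = ‖P x‖ * ‖P x‖ + ‖x - P x‖ * ‖x - P x‖ := by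
      have h2 := norm_add_sq_eq_norm_sq_add_norm_sq_of_inner_eq_zero (𝕜 := ℂ) (P x) (x - P x) (by
        rw [hPsym, map_sub, hPP, sub_self, inner_zero_right])
      rwa [add_sub_cancel] at h2
    rw [← hnP]
    nlinarith
  have hQ : HasSum (fun j => ‖w j - P (w j)‖ ^ 2) δ := by
    simp only [hpyth]
    exact hw.norm_sq.sub (hw.hasSum_diag ψ)
  have hδ0 : 0 ≤ δ := hQ.nonneg fun _ => by positivity
  -- AM–GM with the free parameter `η`: the small part of each `w j` is weighted by 1/η, the whole
  -- vector by `η`.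
  have hc : HasSum (fun j => (‖w j - P (w j)‖ ^ 2 * η⁻¹ + ‖w j‖ ^ 2 * η) * 2⁻¹)
      ((δ * η⁻¹ + 1 * η) * 2⁻¹) := ((hQ.mul_right _).add (hw.norm_sq.mul_right _)).mul_right _
  have hamgm : ∀ j, ‖w j - P (w j)‖ * ‖w j‖ ≤
      (‖w j - P (w j)‖ ^ 2 * η⁻¹ + ‖w j‖ ^ 2 * η) * 2⁻¹ := fun j => by
    set a := ‖w j - P (w j)‖
    set b := ‖w j‖
    have h1 : a ^ 2 * η⁻¹ + b ^ 2 * η - 2 * (a * b) = η⁻¹ * (a - b * η) ^ 2 := by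
      field_simp
      ring
    have h2 : 0 ≤ η⁻¹ * (a - b * η) ^ 2 := by positivity
    linarith
  have hPle : ∀ x, ‖P x‖ ≤ ‖x‖ := fun x => by
    rw [hPapp, norm_smul, hψ, mul_one]
    simpa [hψ] using norm_inner_le_norm (𝕜 := ℂ) ψ x
  have b1 : NuclearBound ((1 - P) * ρ) ((δ * η⁻¹ + 1 * η) * 2⁻¹) :=
    nuclearBound_of_hasSum (a := fun j => w j - P (w j)) (b := w) (fun x y => by
      have := hw.inner (x - P x) y
      simp only [hQsym] at this
      exact this) hamgm hc
  have b2 : NuclearBound (P * ρ * (1 - P)) ((δ * η⁻¹ + 1 * η) * 2⁻¹) :=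
    nuclearBound_of_hasSum (a := fun j => P (w j)) (b := fun j => w j - P (w j)) (fun x y => by
      have := hw.inner (P x) (y - P y)
      simp only [hPsym, ← hQsym _ y] at this
      exact this) (fun j => by
        rw [mul_comm]
        exact (mul_le_mul_of_nonneg_left (hPle _) (norm_nonneg _)).trans (hamgm j)) hc
  have b3 : NuclearBound ((-(δ : ℂ)) • P) δ :=
    nuclearBound_of_hasSum (a := fun _ : Unit => (-(δ : ℂ)) • ψ) (b := fun _ => ψ) (fun x y => by
      have := hasSum_unique fun _ : Unit => ⟪x, (-(δ : ℂ)) • ψ⟫_ℂ * ⟪ψ, y⟫_ℂ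
      convert this using 1
      change ⟪x, (-(δ : ℂ)) • P y⟫_ℂ = _
      rw [hPapp, inner_smul_right, inner_smul_right, inner_smul_right]
      ring) (c := fun _ => δ) (fun _ => by
        rw [norm_smul, norm_neg, Complex.norm_real, Real.norm_of_nonneg hδ0, hψ, mul_one, mul_one])
      (hasSum_unique fun _ : Unit => δ)
  -- Here `P ρ P = (1 - δ) P`. The two off-diagonal pieces contribute (δ/η + η)/2 each and the last
  -- one `δ`.
  have e : ρ - P = (1 - P) * ρ + P * ρ * (1 - P) + (-(δ : ℂ)) • P := by
    ext1 x
    have h1 : P (ρ (P x)) = (1 - δ : ℂ) • P x := by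
      rw [hPapp x, map_smul, map_smul, hPapp (ρ ψ), hw.inner_self_eq ψ, smul_comm]
      congr 1
      simp [δ]
    change ρ x - P x = (ρ x - P (ρ x)) + P (ρ (x - P x)) + (-(δ : ℂ)) • P x
    rw [map_sub, map_sub, h1, sub_smul, one_smul, neg_smul]
    abel
  have hsa : IsSelfAdjoint (ρ - P) := by
    refine hρ.1.isSelfAdjoint.sub ?_
    rw [ContinuousLinearMap.isSelfAdjoint_iff_isSymmetric]
    exact hPsym
  refine (traceNorm_le_of_nuclearBound hsa (e ▸ (b1.add b2).add b3)).trans (le_of_eq ?_)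
  congr 1
  ring

/-! ### Weak solutions and changes of frame -/

/-- Weak solution of the Lindblad equation with Hamiltonian `H` and jump operator `L`, where `Ld`
is the formal adjoint of `L`. -/
def IsWeakSolution (H L Ld : Module.End ℂ Fin0) (ρ : ℝ → (Osc →L[ℂ] Osc)) : Prop :=
  (∀ t : ℝ, 0 ≤ t → IsDensity (ρ t)) ∧
  ∀ t : ℝ, 0 ≤ t → ∀ x y : Fin0,
    HasDerivWithinAt (fun s : ℝ => ⟪incl x, ρ s (incl y)⟫_ℂ)
      (lindbladForm H L Ld (ρ t) x y) (Set.Ici 0) t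

/-- The bound does not involve `ρ`; along a curve of density operators it is uniform in time. -/
theorem IsDensity.norm_inner_sub_le {ρ : Osc →L[ℂ] Osc} (h : IsDensity ρ) (a a' b b' : Osc) :
    ‖⟪a, ρ b⟫_ℂ - ⟪a', ρ b'⟫_ℂ‖ ≤ ‖a - a'‖ * ‖b‖ + ‖a'‖ * ‖b - b'‖ := by
  have e : ⟪a, ρ b⟫_ℂ - ⟪a', ρ b'⟫_ℂ = ⟪a - a', ρ b⟫_ℂ + ⟪a', ρ (b - b')⟫_ℂ := by
    rw [map_sub, inner_sub_left, inner_sub_right]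
    ring
  rw [e]
  exact norm_add_le_of_le (h.norm_inner_le _ _) (h.norm_inner_le _ _)

theorem tendsto_pair_error {a b : ℕ → Osc} {a' b' : Osc} (ha : Tendsto a atTop (𝓝 a'))
    (hb : Tendsto b atTop (𝓝 b')) :
    Tendsto (fun k => ‖a k - a'‖ * ‖b k‖ + ‖a'‖ * ‖b k - b'‖) atTop (𝓝 0) := by
  have h1 := (tendsto_iff_norm_sub_tendsto_zero.1 ha).mul hb.norm
  have h2 := (tendsto_iff_norm_sub_tendsto_zero.1 hb).const_mul ‖a'‖
  simpa using h1.add h2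

/-- A unitary intertwining the coefficients transports weak solutions. -/
theorem IsWeakSolution.conj {H L Ld H' L' Ld' : Module.End ℂ Fin0} {V : Osc ≃ₗᵢ[ℂ] Osc}
    (hH : FAdj H H) (hL : FAdj L Ld) (dH : Deg2 H) (dLd : Deg2 Ld) (dN : Deg2 (Ld * L))
    (iH : Intertwines V H H') (iL : Intertwines V L Ld') (iLd : Intertwines V Ld L')
    (hdom : ∀ x, Dom (V (incl x))) {ρ : ℝ → (Osc →L[ℂ] Osc)} (hρ : IsWeakSolution H L Ld ρ) :
    IsWeakSolution H' L' Ld' (fun t => conj V (ρ t)) := by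
  refine ⟨fun t ht => (hρ.1 t ht).conj V, fun t ht x y => ?_⟩
  have iN := iLd.mul iL
  have hN : FAdj (Ld * L) (Ld * L) := hL.symm.mul hL
  have t0 : ∀ x, Tendsto (fun k => incl (trunc k (V (incl x)))) atTop (𝓝 (V (incl x))) :=
    fun x => tendsto_trunc _
  have tH : ∀ x, Tendsto (fun k => incl (H (trunc k (V (incl x))))) atTop
      (𝓝 (V (incl (H' x)))) := fun x => dH.tendsto_trunc hH (hdom x) fun z => (iH z x).symm
  have tL : ∀ x, Tendsto (fun k => incl (Ld (trunc k (V (incl x))))) atTop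
      (𝓝 (V (incl (Ld' x)))) := fun x => dLd.tendsto_trunc hL (hdom x) fun z => (iL z x).symm
  have tN : ∀ x, Tendsto (fun k => incl (Ld (L (trunc k (V (incl x)))))) atTop
      (𝓝 (V (incl (Ld' (L' x))))) :=
    fun x => dN.tendsto_trunc hN (hdom x) fun z => (iN z x).symm
  set u : ℕ → Fin0 := fun k => trunc k (V (incl x))
  set v : ℕ → Fin0 := fun k => trunc k (V (incl y))
  -- Truncations of `V x` and `V y` are admissible test vectors; the five errors below, one per term
  -- of the Lindblad form, vanish uniformly in time.
  have key := hasDerivWithinAt_of_tendsto (convex_Ici (0 : ℝ))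
    (g := fun k s => ⟪incl (u k), ρ s (incl (v k))⟫_ℂ)
    (g' := fun k s => lindbladForm H L Ld (ρ s) (u k) (v k))
    (f := fun s => ⟪V (incl x), ρ s (V (incl y))⟫_ℂ)
    (f' := fun s => -Complex.I * (⟪V (incl (H' x)), ρ s (V (incl y))⟫_ℂ
        - ⟪V (incl x), ρ s (V (incl (H' y)))⟫_ℂ)
      + ⟪V (incl (Ld' x)), ρ s (V (incl (Ld' y)))⟫_ℂ
      - (1 / 2 : ℂ) * (⟪V (incl (Ld' (L' x))), ρ s (V (incl y))⟫_ℂ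
        + ⟪V (incl x), ρ s (V (incl (Ld' (L' y))))⟫_ℂ))
    (fun k s hs => hρ.2 s hs _ _)
    (fun s _ => (t0 x).inner (((ρ s).continuous.tendsto _).comp (t0 y)))
    (fun k s hs => ?_)
    (b := fun k =>
      (‖incl (H (u k)) - V (incl (H' x))‖ * ‖incl (v k)‖
        + ‖V (incl (H' x))‖ * ‖incl (v k) - V (incl y)‖)
      + (‖incl (u k) - V (incl x)‖ * ‖incl (H (v k))‖
        + ‖V (incl x)‖ * ‖incl (H (v k)) - V (incl (H' y))‖)
      + (‖incl (Ld (u k)) - V (incl (Ld' x))‖ * ‖incl (Ld (v k))‖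
        + ‖V (incl (Ld' x))‖ * ‖incl (Ld (v k)) - V (incl (Ld' y))‖)
      + (‖incl (Ld (L (u k))) - V (incl (Ld' (L' x)))‖ * ‖incl (v k)‖
        + ‖V (incl (Ld' (L' x)))‖ * ‖incl (v k) - V (incl y)‖)
      + (‖incl (u k) - V (incl x)‖ * ‖incl (Ld (L (v k)))‖
        + ‖V (incl x)‖ * ‖incl (Ld (L (v k))) - V (incl (Ld' (L' y)))‖)) ?_ ht
  · simpa only [inner_conj, lindbladForm] using key
  · have hd := hρ.1 s hs
    have b1 := hd.norm_inner_sub_le (incl (H (u k))) (V (incl (H' x))) (incl (v k)) (V (incl y))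
    have b2 := hd.norm_inner_sub_le (incl (u k)) (V (incl x)) (incl (H (v k))) (V (incl (H' y)))
    have b3 := hd.norm_inner_sub_le (incl (Ld (u k))) (V (incl (Ld' x))) (incl (Ld (v k)))
      (V (incl (Ld' y)))
    have b4 := hd.norm_inner_sub_le (incl (Ld (L (u k)))) (V (incl (Ld' (L' x)))) (incl (v k))
      (V (incl y))
    have b5 := hd.norm_inner_sub_le (incl (u k)) (V (incl x)) (incl (Ld (L (v k))))
      (V (incl (Ld' (L' y))))
    set z1 := ⟪incl (H (u k)), ρ s (incl (v k))⟫_ℂ - ⟪V (incl (H' x)), ρ s (V (incl y))⟫_ℂ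
    set z2 := ⟪incl (u k), ρ s (incl (H (v k)))⟫_ℂ - ⟪V (incl x), ρ s (V (incl (H' y)))⟫_ℂ
    set z3 := ⟪incl (Ld (u k)), ρ s (incl (Ld (v k)))⟫_ℂ
      - ⟪V (incl (Ld' x)), ρ s (V (incl (Ld' y)))⟫_ℂ
    set z4 := ⟪incl (Ld (L (u k))), ρ s (incl (v k))⟫_ℂ
      - ⟪V (incl (Ld' (L' x))), ρ s (V (incl y))⟫_ℂ
    set z5 := ⟪incl (u k), ρ s (incl (Ld (L (v k))))⟫_ℂ
      - ⟪V (incl x), ρ s (V (incl (Ld' (L' y))))⟫_ℂ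
    have e : ∀ w, lindbladForm H L Ld (ρ s) (u k) (v k) - w =
        -Complex.I * z1 + Complex.I * z2 + z3 - (1 / 2 : ℂ) * z4 - (1 / 2 : ℂ) * z5
        + ((-Complex.I * (⟪V (incl (H' x)), ρ s (V (incl y))⟫_ℂ
        - ⟪V (incl x), ρ s (V (incl (H' y)))⟫_ℂ)
      + ⟪V (incl (Ld' x)), ρ s (V (incl (Ld' y)))⟫_ℂ
      - (1 / 2 : ℂ) * (⟪V (incl (Ld' (L' x))), ρ s (V (incl y))⟫_ℂ
        + ⟪V (incl x), ρ s (V (incl (Ld' (L' y))))⟫_ℂ)) - w) := fun w => by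
      simp only [lindbladForm, z1, z2, z3, z4, z5]
      ring
    rw [e, sub_self, add_zero]
    have h12 : ‖(1 / 2 : ℂ)‖ = 1 / 2 := by norm_num
    have n1 : ‖-Complex.I * z1‖ = ‖z1‖ := by simp
    have n2 : ‖Complex.I * z2‖ = ‖z2‖ := by simp
    have n4 : ‖(1 / 2 : ℂ) * z4‖ ≤ ‖z4‖ := by
      rw [norm_mul, h12]; linarith [norm_nonneg z4]
    have n5 : ‖(1 / 2 : ℂ) * z5‖ ≤ ‖z5‖ := by
      rw [norm_mul, h12]; linarith [norm_nonneg z5]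
    refine norm_sub_le_of_le (norm_sub_le_of_le (norm_add_le_of_le
      (norm_add_le_of_le ?_ ?_) b3) (n4.trans b4)) (n5.trans b5)
    · exact n1.le.trans b1
    · exact n2.le.trans b2
  · have := (((((tendsto_pair_error (tH x) (t0 y)).add (tendsto_pair_error (t0 x) (tH y))).add
      (tendsto_pair_error (tL x) (tL y))).add (tendsto_pair_error (tN x) (t0 y))).add
      (tendsto_pair_error (t0 x) (tN y)))
    simpa only [add_zero] using this

/-! ### The damped oscillator -/

/-- Weak solution of the damped oscillator equation with jump operator `k a`. -/
def IsDamped (k : ℝ) (σ : ℝ → (Osc →L[ℂ] Osc)) : Prop :=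
  IsWeakSolution 0 (aff k 0 0) (aff 0 k 0) σ

theorem lindbladForm_damped (k : ℝ) (σ : Osc →L[ℂ] Osc) (x y : Fin0) :
    lindbladForm 0 (aff k 0 0) (aff 0 k 0) σ x y = (k : ℂ) ^ 2 *
      (⟪incl (cre x), σ (incl (cre y))⟫_ℂ - (1 / 2 : ℂ) *
        (⟪incl (cre (ann x)), σ (incl y)⟫_ℂ + ⟪incl x, σ (incl (cre (ann y)))⟫_ℂ)) := by
  simp only [lindbladForm, aff, LinearMap.smul_apply, zero_smul, add_zero,
    zero_add, LinearMap.zero_apply, map_zero, inner_zero_left, inner_zero_right, map_smul,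
    inner_smul_left, inner_smul_right, Complex.conj_ofReal]
  ring

/-- A scalar shift of the jump operator is compensated by a linear Hamiltonian. -/
theorem lindbladForm_shift (k e : ℝ) (l : ℂ) (σ : Osc →L[ℂ] Osc) (x y : Fin0) :
    lindbladForm (aff (-(Complex.I / 2) * k * star l) ((Complex.I / 2) * k * l) e)
      (aff k 0 l) (aff 0 k (star l)) σ x y = lindbladForm 0 (aff k 0 0) (aff 0 k 0) σ x y := by
  have h1 : (starRingEnd ℂ) (star l) = l := star_star l
  have h2 : (starRingEnd ℂ) l = star l := rfl
  have h3 : (starRingEnd ℂ) (2 : ℂ) = 2 := Complex.conj_ofNat 2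
  rw [lindbladForm_damped]
  simp only [lindbladForm, aff, LinearMap.add_apply, LinearMap.smul_apply, zero_smul, add_zero,
    zero_add, map_smul, map_add, inner_add_left, inner_add_right, Module.End.one_apply,
    inner_smul_left, inner_smul_right, Complex.conj_ofReal, map_mul, map_neg, map_div₀,
    Complex.conj_I, h1, h2, h3]
  -- The `|l|²` terms and the real constant `e` cancel by themselves; the terms linear in `l` cancel
  -- against the commutator once I² = -1 is used.
  linear_combination (-(1 / 2) * k * star l * ⟪incl x, σ (incl (ann y))⟫_ℂ
    - 1 / 2 * k * l * ⟪incl (ann x), σ (incl y)⟫_ℂ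
    + (1 / 2) * k * star l * ⟪incl (cre x), σ (incl y)⟫_ℂ
    + 1 / 2 * k * l * ⟪incl x, σ (incl (cre y))⟫_ℂ) * Complex.I_sq

/-! ### The linear death process -/

/-- `p` is a family of probability distributions on `ℕ` solving the master equation of the linear
death process with rate `κ`. -/
structure IsDeathFlow (κ : ℝ) (p : ℝ → ℕ → ℝ) : Prop where
  nonneg : ∀ t, 0 ≤ t → ∀ n, 0 ≤ p t n
  hasSum : ∀ t, 0 ≤ t → HasSum (p t) 1
  deriv : ∀ t, 0 ≤ t → ∀ n : ℕ, HasDerivWithinAt (fun s => p s n)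
    (κ * (((n : ℝ) + 1) * p t (n + 1) - n * p t n)) (Set.Ici 0) t

theorem summable_mul_pow {p : ℕ → ℝ} (h0 : ∀ n, 0 ≤ p n) (hp : Summable p) {z : ℝ} (hz0 : 0 ≤ z)
    (hz1 : z ≤ 1) : Summable fun n => p n * z ^ n :=
  hp.of_nonneg_of_le (fun n => mul_nonneg (h0 n) (pow_nonneg hz0 n)) fun n =>
    mul_le_of_le_one_right (h0 n) (pow_le_one₀ hz0 hz1)

/-- The generating function along the characteristics of the death process. -/
theorem IsDeathFlow.tsum_mul_pow {κ : ℝ} (hκ : 0 ≤ κ) {p : ℝ → ℕ → ℝ} (h : IsDeathFlow κ p)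
    {t : ℝ} (ht : 0 ≤ t) {z : ℝ} (hz0 : 0 ≤ z) (hz1 : z < 1) :
    ∑' n, p t n * z ^ n = ∑' n, p 0 n * (1 - (1 - z) * Real.exp (-κ * t)) ^ n := by
  set Z := 1 - (1 - z) * Real.exp (-κ * t) with hZ
  -- The characteristic of the generating-function equation that ends at `z` at time `t` and starts
  -- at `Z`.
  let y : ℝ → ℝ := fun s => 1 - (1 - z) * Real.exp (-κ * (t - s))
  have hy : ∀ s, HasDerivAt y (κ * (y s - 1)) s := fun s => by
    have h1 : HasDerivAt (fun s : ℝ => -κ * (t - s)) κ s := by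
      simpa using ((hasDerivAt_id s).const_sub t).const_mul (-κ)
    have h2 := (h1.exp.const_mul (1 - z)).const_sub 1
    refine h2.congr_deriv ?_
    simp only [y]
    ring
  have hexp1 : ∀ s ≤ t, Real.exp (-κ * (t - s)) ≤ 1 := fun s hs => by
    rw [Real.exp_le_one_iff]
    nlinarith
  have hyZ : ∀ s, 0 ≤ s → y s ≤ Z := fun s hs => by
    have h1 : Real.exp (-κ * t) ≤ Real.exp (-κ * (t - s)) := by
      apply Real.exp_le_exp.2; nlinarith
    have := mul_le_mul_of_nonneg_left h1 (sub_nonneg.2 hz1.le)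
    simp only [y, hZ]
    linarith
  have hy0 : ∀ s ≤ t, 0 ≤ y s := fun s hs => by
    have := mul_le_mul_of_nonneg_left (hexp1 s hs) (sub_nonneg.2 hz1.le)
    simp only [y]
    linarith
  have hZ1 : Z < 1 := by
    have : 0 < (1 - z) * Real.exp (-κ * t) := mul_pos (sub_pos.2 hz1) (Real.exp_pos _)
    linarith
  have hy00 : y 0 = Z := by simp [y, hZ]
  have hyt : y t = z := by simp [y]
  have hZ0 : 0 ≤ Z := hy00 ▸ hy0 0 ht
  -- Along the characteristic the derivative of the partial sum telescopes to one boundary term.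
  have hder : ∀ N : ℕ, ∀ s ∈ Set.Icc 0 t, HasDerivWithinAt
      (fun s => ∑ n ∈ Finset.range N, p s n * y s ^ n) (κ * (N * p s N * y s ^ (N - 1)))
      (Set.Icc 0 t) s := fun N s hs => by
    have h1 : ∀ n ∈ Finset.range N, HasDerivWithinAt (fun s => p s n * y s ^ n)
        (κ * (((n + 1 : ℕ) : ℝ) * p s (n + 1) * y s ^ (n + 1 - 1))
          - κ * (n * p s n * y s ^ (n - 1))) (Set.Icc 0 t) s := fun n _ => by
      have h2 := ((h.deriv s hs.1 n).mono Set.Icc_subset_Ici_self).mul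
        (((hy s).pow n).hasDerivWithinAt (s := Set.Icc 0 t))
      refine h2.congr_deriv ?_
      rcases n with _ | n
      · simp
      · simp only [Nat.add_sub_cancel, Pi.pow_apply]
        push_cast
        ring
    have h2 := HasDerivWithinAt.fun_sum h1
    rw [Finset.sum_range_sub fun n : ℕ => κ * (n * p s n * y s ^ (n - 1))] at h2
    simpa using h2
  have hb : ∀ N : ℕ, ‖(∑ n ∈ Finset.range N, p t n * y t ^ n)
      - ∑ n ∈ Finset.range N, p 0 n * y 0 ^ n‖ ≤ κ * (N * Z ^ (N - 1)) * ‖t - 0‖ := fun N =>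
    (convex_Icc 0 t).norm_image_sub_le_of_norm_hasDerivWithin_le (hder N) (fun s hs => by
      have hp1 : p s N ≤ 1 := le_hasSum (h.hasSum s hs.1) N fun n _ => h.nonneg s hs.1 n
      have hp0 := h.nonneg s hs.1 N
      have h3 : y s ^ (N - 1) ≤ Z ^ (N - 1) := pow_le_pow_left₀ (hy0 s hs.2) (hyZ s hs.1) _
      have h4 := pow_nonneg (hy0 s hs.2) (N - 1)
      rw [Real.norm_of_nonneg (by positivity)]
      gcongr
      exact mul_le_of_le_one_right (by positivity) hp1) ⟨le_rfl, ht⟩ ⟨ht, le_rfl⟩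
  -- The boundary term vanishes like N Z^(N-1); this uses `Z < 1`, hence `z < 1`.
  have hlim0 : Tendsto (fun N : ℕ => κ * (N * Z ^ (N - 1)) * ‖t - 0‖) atTop (𝓝 0) := by
    rw [← tendsto_add_atTop_iff_nat 1]
    have h1 := tendsto_self_mul_const_pow_of_lt_one hZ0 hZ1
    have h2 := tendsto_pow_atTop_nhds_zero_of_lt_one hZ0 hZ1
    have h3 := ((h1.add h2).const_mul κ).mul_const ‖t - 0‖
    simp only [add_zero, mul_zero, zero_mul] at h3
    refine h3.congr fun N => ?_
    simp only [Nat.add_sub_cancel]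
    push_cast
    ring
  have hlim := ((summable_mul_pow (h.nonneg t ht) (h.hasSum t ht).summable hz0
    hz1.le).hasSum.tendsto_sum_nat).sub ((summable_mul_pow (h.nonneg 0 le_rfl)
      (h.hasSum 0 le_rfl).summable hZ0 hZ1.le).hasSum.tendsto_sum_nat)
  rw [hyt, hy00] at hb
  have := tendsto_nhds_unique hlim (squeeze_zero_norm hb hlim0)
  linarith

theorem IsDeathFlow.apply_zero {κ : ℝ} (hκ : 0 ≤ κ) {p : ℝ → ℕ → ℝ} (h : IsDeathFlow κ p)
    {t : ℝ} (ht : 0 ≤ t) : p t 0 = ∑' n, p 0 n * (1 - Real.exp (-κ * t)) ^ n := by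
  have := h.tsum_mul_pow hκ ht le_rfl zero_lt_one
  rw [tsum_eq_single 0 fun n hn => by rw [zero_pow hn, mul_zero]] at this
  simpa using this

/-- Dominated convergence in the formula for the vacuum population, with the initial distribution as
majorant; no finite mean is required. -/
theorem IsDeathFlow.tendsto_apply_zero {κ : ℝ} (hκ : 0 < κ) {p : ℝ → ℕ → ℝ}
    (h : IsDeathFlow κ p) : Tendsto (fun t => p t 0) atTop (𝓝 1) := by
  have h0 := h.nonneg 0 le_rfl
  have he : Tendsto (fun t : ℝ => 1 - Real.exp (-κ * t)) atTop (𝓝 1) := by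
    have h1 : Tendsto (fun t : ℝ => -κ * t) atTop atBot :=
      tendsto_id.const_mul_atTop_of_neg (neg_lt_zero.2 hκ)
    simpa using (Real.tendsto_exp_atBot.comp h1).const_sub 1
  have key : Tendsto (fun t : ℝ => ∑' n, p 0 n * (1 - Real.exp (-κ * t)) ^ n) atTop
      (𝓝 (∑' n, p 0 n)) := by
    refine tendsto_tsum_of_dominated_convergence (h.hasSum 0 le_rfl).summable (fun n => ?_) ?_
    · simpa using (he.pow n).const_mul (p 0 n)
    · filter_upwards [eventually_ge_atTop 0] with t ht n
      have h1 : 0 ≤ 1 - Real.exp (-κ * t) := by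
        rw [sub_nonneg, Real.exp_le_one_iff]; nlinarith
      have h2 : 1 - Real.exp (-κ * t) ≤ 1 := by linarith [Real.exp_pos (-κ * t)]
      rw [Real.norm_of_nonneg (mul_nonneg (h0 n) (pow_nonneg h1 n))]
      exact mul_le_of_le_one_right (h0 n) (pow_le_one₀ h1 h2)
  rw [(h.hasSum 0 le_rfl).tsum_eq] at key
  refine key.congr' ?_
  filter_upwards [eventually_ge_atTop 0] with t ht
  exact (h.apply_zero hκ.le ht).symm

/-- The mean of a distribution on `ℕ` from its generating function near `1`. -/
theorem tendsto_genFun_mean {p : ℕ → ℝ} (h0 : ∀ n, 0 ≤ p n) (h1 : HasSum p 1) {c : ℝ} (hc0 : 0 < c)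
    (hc1 : c ≤ 1) : Tendsto (fun k : ℕ => ENNReal.ofReal
      ((1 - ∑' n, p n * (1 - c / (k + 1)) ^ n) * ((k + 1) / c))) atTop
      (𝓝 (∑' n : ℕ, ENNReal.ofReal (n * p n))) := by
  let z : ℕ → ℝ := fun k => 1 - c / (k + 1)
  have hz0 : ∀ k, 0 ≤ z k := fun k => by
    have : c / ((k : ℝ) + 1) ≤ 1 := by
      rw [div_le_one (by positivity)]
      linarith [k.cast_nonneg (α := ℝ)]
    simp only [z]
    linarith
  have hz1 : ∀ k, z k ≤ 1 := fun k => by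
    have : 0 ≤ c / ((k : ℝ) + 1) := by positivity
    simp only [z]
    linarith
  have hmono : Monotone z := fun j k hjk => by
    have : (j : ℝ) ≤ k := by exact_mod_cast hjk
    simp only [z]
    gcongr
  have hzlim : Tendsto z atTop (𝓝 1) := by
    have := (tendsto_one_div_add_atTop_nhds_zero_nat (𝕜 := ℝ)).const_mul c
    simpa [z, div_eq_mul_inv] using this.const_sub 1
  -- The quotient (1 - zⁿ)/(1 - z) is a geometric sum that increases to `n` as z ↑ 1.
  have hterm : ∀ k n, (p n - p n * z k ^ n) * ((k + 1) / c)
      = p n * ∑ j ∈ Finset.range n, z k ^ j := fun k n => by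
    have h3 := geom_sum_mul (z k) n
    have h4 : z k - 1 = -(c / (k + 1)) := by simp only [z]; ring
    rw [h4] at h3
    have h5 : (∑ j ∈ Finset.range n, z k ^ j) = (1 - z k ^ n) * ((k + 1) / c) := by
      have : 1 - z k ^ n = (∑ j ∈ Finset.range n, z k ^ j) * (c / (k + 1)) := by linarith
      rw [this]
      field_simp
    rw [h5]
    ring
  have hsum : ∀ k : ℕ, ENNReal.ofReal ((1 - ∑' n, p n * z k ^ n) * ((k + 1) / c))
      = ∑' n, ENNReal.ofReal (p n * ∑ j ∈ Finset.range n, z k ^ j) := fun k => by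
    have h3 := ((h1.sub (summable_mul_pow h0 h1.summable (hz0 k) (hz1 k)).hasSum).mul_right
      (((k : ℝ) + 1) / c))
    simp only [hterm] at h3
    rw [← h3.tsum_eq, ENNReal.ofReal_tsum_of_nonneg _ h3.summable]
    exact fun n => mul_nonneg (h0 n) (Finset.sum_nonneg fun j _ => pow_nonneg (hz0 k) j)
  change Tendsto (fun k : ℕ => ENNReal.ofReal ((1 - ∑' n, p n * z k ^ n) * ((k + 1) / c))) _ _
  simp only [hsum]
  -- Monotone convergence for the counting measure, which allows the value ∞.
  simp only [← MeasureTheory.lintegral_count]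
  refine MeasureTheory.lintegral_tendsto_of_tendsto_of_monotone
    (fun k => (measurable_of_countable _).aemeasurable) (MeasureTheory.ae_of_all _ fun n j k hjk => ?_)
    (MeasureTheory.ae_of_all _ fun n => ?_)
  · refine ENNReal.ofReal_le_ofReal (mul_le_mul_of_nonneg_left (Finset.sum_le_sum fun i _ => ?_)
      (h0 n))
    exact pow_le_pow_left₀ (hz0 j) (hmono hjk) i
  · refine ENNReal.tendsto_ofReal ?_
    have := (tendsto_finsetSum (Finset.range n) fun j _ => hzlim.pow j).const_mul (p n)
    simpa [mul_comm] using this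

/-- The characteristic carries 1 - 1/(k+1) to 1 - e^{-κt}/(k+1), so the difference quotients of the
two generating functions at 1 differ exactly by the factor e^{-κt}. -/
theorem IsDeathFlow.mean {κ : ℝ} (hκ : 0 ≤ κ) {p : ℝ → ℕ → ℝ} (h : IsDeathFlow κ p) {t : ℝ}
    (ht : 0 ≤ t) : ∑' n : ℕ, ENNReal.ofReal (n * p t n)
      = ENNReal.ofReal (Real.exp (-κ * t)) * ∑' n : ℕ, ENNReal.ofReal (n * p 0 n) := by
  have hc0 := Real.exp_pos (-κ * t)
  have hc1 : Real.exp (-κ * t) ≤ 1 := by rw [Real.exp_le_one_iff]; nlinarith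
  have l1 := tendsto_genFun_mean (h.nonneg t ht) (h.hasSum t ht) zero_lt_one le_rfl
  have l2 := ENNReal.Tendsto.const_mul (a := ENNReal.ofReal (Real.exp (-κ * t)))
    (tendsto_genFun_mean (h.nonneg 0 le_rfl) (h.hasSum 0 le_rfl) hc0 hc1)
    (Or.inr ENNReal.ofReal_ne_top)
  refine tendsto_nhds_unique l1 (l2.congr fun k => ?_)
  have hk : (0 : ℝ) < k + 1 := by positivity
  rw [h.tsum_mul_pow hκ ht (z := 1 - 1 / ((k : ℝ) + 1)), ← ENNReal.ofReal_mul hc0.le]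
  · congr 1
    have : 1 - (1 - (1 - 1 / ((k : ℝ) + 1))) * Real.exp (-κ * t)
        = 1 - Real.exp (-κ * t) / (k + 1) := by ring
    rw [this]
    field_simp
  · rw [sub_nonneg, div_le_one hk]; linarith [k.cast_nonneg (α := ℝ)]
  · linarith [one_div_pos.2 hk]

/-- Markov's inequality at level 1. -/
theorem ofReal_one_sub_le_mean {p : ℕ → ℝ} (h0 : ∀ n, 0 ≤ p n) (h1 : HasSum p 1) :
    ENNReal.ofReal (1 - p 0) ≤ ∑' n : ℕ, ENNReal.ofReal (n * p n) := by
  have h2 := h1.sub (hasSum_ite_eq 0 (p 0))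
  have h3 : ∀ n, 0 ≤ p n - (if n = 0 then p 0 else 0) := fun n => by
    split_ifs with h
    · simp [h]
    · simpa using h0 n
  rw [← h2.tsum_eq, ENNReal.ofReal_tsum_of_nonneg h3 h2.summable]
  refine ENNReal.tsum_le_tsum fun n => ENNReal.ofReal_le_ofReal ?_
  split_ifs with h
  · simp [h]
  · have : (1 : ℝ) ≤ n := by exact_mod_cast Nat.one_le_iff_ne_zero.2 h
    simpa using le_mul_of_one_le_left (h0 n) this

/-! ### The attenuation channel -/

/-- `√(m + k choose k) √(n + k choose k)`. -/
def binomWeight (m n k : ℕ) : ℝ := √((m + k).choose k : ℝ) * √((n + k).choose k : ℝ)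

theorem binomWeight_nonneg (m n k : ℕ) : 0 ≤ binomWeight m n k := by
  unfold binomWeight
  positivity

theorem sqrt_choose_succ (m k : ℕ) : √((k : ℝ) + 1) * √((m + (k + 1)).choose (k + 1) : ℝ)
    = √((m : ℝ) + 1) * √((m + 1 + k).choose k : ℝ) := by
  rw [← Real.sqrt_mul (by positivity), ← Real.sqrt_mul (by positivity)]
  congr 1
  have h := Nat.choose_succ_right_eq (m + k + 1) k
  rw [show m + k + 1 - k = m + 1 by omega, show m + k + 1 = m + 1 + k by omega] at h
  rw [show m + (k + 1) = m + 1 + k by omega]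
  have h2 : (((m + 1 + k).choose (k + 1) : ℕ) : ℝ) * (k + 1)
      = ((m + 1 + k).choose k : ℕ) * (m + 1) := by exact_mod_cast h
  linarith

/-- This recursion turns the termwise derivative of the series in `z` into the series with both
indices raised, the gain term a σ a† of the damped equation. -/
theorem binomWeight_succ (m n k : ℕ) : ((k : ℝ) + 1) * binomWeight m n (k + 1)
    = √((m : ℝ) + 1) * √((n : ℝ) + 1) * binomWeight (m + 1) (n + 1) k := by
  have h : ((k : ℝ) + 1) = √((k : ℝ) + 1) * √((k : ℝ) + 1) :=
    (Real.mul_self_sqrt (by positivity)).symm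
  have h1 := sqrt_choose_succ m k
  have h2 := sqrt_choose_succ n k
  unfold binomWeight
  calc _ = (√((k : ℝ) + 1) * √((m + (k + 1)).choose (k + 1) : ℝ))
        * (√((k : ℝ) + 1) * √((n + (k + 1)).choose (k + 1) : ℝ)) := by
        nth_rewrite 1 [h]; ring
    _ = _ := by rw [h1, h2]; ring

theorem summable_binomWeight (m n : ℕ) {r : ℝ} (hr0 : 0 ≤ r) (hr1 : r < 1) :
    Summable fun k => binomWeight m n k * r ^ k := by
  have hn : ‖r‖ < 1 := by rwa [Real.norm_of_nonneg hr0]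
  have h := (summable_choose_mul_geometric_of_norm_lt_one m hn).add
    (summable_choose_mul_geometric_of_norm_lt_one n hn)
  refine h.of_nonneg_of_le (fun k => mul_nonneg (binomWeight_nonneg m n k) (by positivity))
    fun k => ?_
  rw [← add_mul]
  refine mul_le_mul_of_nonneg_right ?_ (by positivity)
  rw [← Nat.choose_symm_add, ← Nat.choose_symm_add (a := k), add_comm k m, add_comm k n]
  unfold binomWeight
  exact sqrt_mul_sqrt_le (by simp) (by simp) (by positivity)

/-- Matrix element `(m, n)` of the attenuated state, up to a power of the transmissivity. -/
def attenuationSeries (s : ℕ → ℕ → ℂ) (m n : ℕ) (z : ℝ) : ℂ :=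
  ∑' k, ((binomWeight m n k * z ^ k : ℝ) : ℂ) * s (m + k) (n + k)

theorem summable_attenuationSeries {s : ℕ → ℕ → ℂ} (hs : ∀ i j, ‖s i j‖ ≤ 1) (m n : ℕ) {z : ℝ}
    (hz0 : 0 ≤ z) (hz1 : z < 1) :
    Summable fun k => ((binomWeight m n k * z ^ k : ℝ) : ℂ) * s (m + k) (n + k) := by
  refine Summable.of_norm_bounded (summable_binomWeight m n hz0 hz1) fun k => ?_
  have h0 : 0 ≤ binomWeight m n k * z ^ k := mul_nonneg (binomWeight_nonneg _ _ _) (by positivity)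
  rw [norm_mul, Complex.norm_real, Real.norm_of_nonneg h0]
  exact mul_le_of_le_one_right h0 (hs _ _)

theorem hasDerivAt_attenuationSeries {s : ℕ → ℕ → ℂ} (hs : ∀ i j, ‖s i j‖ ≤ 1) (m n : ℕ) {z : ℝ}
    (hz0 : 0 ≤ z) (hz1 : z < 1) : HasDerivAt (attenuationSeries s m n)
      (((√((m : ℝ) + 1) * √((n : ℝ) + 1) : ℝ) : ℂ) * attenuationSeries s (m + 1) (n + 1) z) z := by
  obtain ⟨r, hr1, hr2⟩ := exists_between hz1
  have hr0 : 0 < r := hz0.trans_lt hr1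
  have key := hasDerivAt_tsum_of_isPreconnected (𝕜 := ℝ) (t := Set.Ioo (-r) r) (y := z) (y₀ := 0)
    (u := fun k : ℕ => k * binomWeight m n k * r ^ (k - 1))
    (g := fun k z => ((binomWeight m n k * z ^ k : ℝ) : ℂ) * s (m + k) (n + k))
    (g' := fun k z => ((binomWeight m n k * (k * z ^ (k - 1)) : ℝ) : ℂ) * s (m + k) (n + k))
    ?_ isOpen_Ioo isPreconnected_Ioo (fun k y _ => ?_) (fun k y hy => ?_) ⟨by linarith, hr0⟩
    (summable_attenuationSeries hs m n le_rfl zero_lt_one) ⟨by linarith, hr1⟩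
  · refine key.congr_deriv ?_
    have h0 : ∀ k, ((binomWeight m n (k + 1) * (((k + 1 : ℕ) : ℝ) * z ^ (k + 1 - 1)) : ℝ) : ℂ)
        * s (m + (k + 1)) (n + (k + 1)) = ((√((m : ℝ) + 1) * √((n : ℝ) + 1) : ℝ) : ℂ)
        * (((binomWeight (m + 1) (n + 1) k * z ^ k : ℝ) : ℂ) * s (m + 1 + k) (n + 1 + k)) := by
      intro k
      rw [← mul_assoc (((√((m : ℝ) + 1) * √((n : ℝ) + 1) : ℝ) : ℂ)), ← Complex.ofReal_mul,
        show m + (k + 1) = m + 1 + k by omega,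
        show n + (k + 1) = n + 1 + k by omega, ← mul_assoc (√((m : ℝ) + 1) * √((n : ℝ) + 1)),
        ← binomWeight_succ, Nat.add_sub_cancel]
      congr 2
      push_cast
      ring
    have h1 := (summable_attenuationSeries hs (m + 1) (n + 1) hz0 hz1).hasSum.mul_left
      ((√((m : ℝ) + 1) * √((n : ℝ) + 1) : ℝ) : ℂ)
    simp only [← h0] at h1
    have h2 := (hasSum_nat_add_iff' (f := fun k : ℕ =>
      ((binomWeight m n k * (k * z ^ (k - 1)) : ℝ) : ℂ) * s (m + k) (n + k))
      (g := ((√((m : ℝ) + 1) * √((n : ℝ) + 1) : ℝ) : ℂ) * attenuationSeries s (m + 1) (n + 1) z)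
      1).1 (by
        unfold attenuationSeries
        rw [Finset.sum_range_one, Nat.cast_zero, zero_mul, mul_zero, Complex.ofReal_zero, zero_mul,
          sub_zero]
        exact h1)
    exact h2.tsum_eq
  · rw [← summable_nat_add_iff 1]
    have h1 := (summable_binomWeight (m + 1) (n + 1) hr0.le hr2).mul_left
      (√((m : ℝ) + 1) * √((n : ℝ) + 1))
    refine h1.congr fun k => ?_
    rw [← mul_assoc, ← binomWeight_succ, Nat.add_sub_cancel]
    push_cast
    ring
  · exact ((((hasDerivAt_pow k y).const_mul _).ofReal_comp)).mul_const _
  · have hyr : |y| ≤ r := (abs_lt.2 hy).le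
    have h0 := binomWeight_nonneg m n k
    rw [norm_mul, Complex.norm_real, norm_mul, norm_mul, norm_pow, Real.norm_of_nonneg h0,
      Real.norm_natCast, Real.norm_eq_abs]
    have : |y| ^ (k - 1) ≤ r ^ (k - 1) := by gcongr
    calc _ ≤ binomWeight m n k * (k * |y| ^ (k - 1)) :=
          mul_le_of_le_one_right (by positivity) (hs _ _)
      _ ≤ binomWeight m n k * (k * r ^ (k - 1)) := by gcongr
      _ = _ := by ring

/-- Coefficients of the Kraus operators of the attenuation channel with amplitude
transmissivity `q`. -/
def krausCoeff (q : ℝ) (k m : ℕ) : ℝ := √((m + k).choose k : ℝ) * √(1 - q ^ 2) ^ k * q ^ m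

theorem krausCoeff_sq {q : ℝ} (h0 : 0 ≤ q) (h1 : q ≤ 1) (k m : ℕ) :
    krausCoeff q k m ^ 2 = (1 - q ^ 2) ^ k * (q ^ 2) ^ m * (m + k).choose k := by
  have h2 : 0 ≤ 1 - q ^ 2 := by nlinarith
  unfold krausCoeff
  rw [mul_pow, mul_pow, ← pow_mul, mul_comm k 2, pow_mul, Real.sq_sqrt h2,
    Real.sq_sqrt (by positivity), ← pow_mul, mul_comm m 2, pow_mul]
  ring

theorem krausCoeff_mul {q : ℝ} (h0 : 0 ≤ q) (h1 : q ≤ 1) (k m n : ℕ) :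
    krausCoeff q k m * krausCoeff q k n = q ^ (m + n) * (binomWeight m n k * (1 - q ^ 2) ^ k) := by
  have h2 : 0 ≤ 1 - q ^ 2 := by nlinarith
  have h3 : √(1 - q ^ 2) ^ k * √(1 - q ^ 2) ^ k = (1 - q ^ 2) ^ k := by
    rw [← mul_pow, Real.mul_self_sqrt h2]
  unfold krausCoeff binomWeight
  rw [← h3, pow_add]
  ring

theorem sum_binomial (q : ℝ) (N : ℕ) :
    ∑ k ∈ Finset.range (N + 1), (1 - q ^ 2) ^ k * (q ^ 2) ^ (N - k) * N.choose k = 1 := by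
  rw [← add_pow]
  simp

theorem norm_krausCoeff_le {q : ℝ} (h0 : 0 ≤ q) (h1 : q ≤ 1) (k m : ℕ) :
    ‖(krausCoeff q k m : ℂ)‖ ≤ 1 := by
  have h2 : 0 ≤ 1 - q ^ 2 := by nlinarith
  rw [Complex.norm_real]
  refine le_of_sq_le_sq ?_ zero_le_one
  rw [Real.norm_eq_abs, sq_abs, krausCoeff_sq h0 h1, one_pow]
  refine le_of_le_of_eq ?_ (sum_binomial q (m + k))
  have := Finset.single_le_sum (f := fun j => (1 - q ^ 2) ^ j * (q ^ 2) ^ (m + k - j)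
    * (m + k).choose j) (s := Finset.range (m + k + 1)) (fun j _ => by positivity)
    (Finset.mem_range.2 (by omega : k < m + k + 1))
  simpa only [Nat.add_sub_cancel] using this

/-- Kraus operators of the attenuation channel. -/
def kraus (q : ℝ) (k : ℕ) : Osc →L[ℂ] Osc := wshift k fun m => (krausCoeff q k m : ℂ)

theorem kraus_apply {q : ℝ} (h0 : 0 ≤ q) (h1 : q ≤ 1) (k : ℕ) (v : Osc) (m : ℕ) :
    kraus q k v m = krausCoeff q k m * v (m + k) :=
  wshift_apply (norm_krausCoeff_le h0 h1 k) k v m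

/-- Trace preservation: level `N` is spread over the losses `k` with binomial probabilities, which
sum to one. -/
theorem hasSum_norm_sq_kraus {q : ℝ} (h0 : 0 ≤ q) (h1 : q ≤ 1) (v : Osc) :
    HasSum (fun k => ‖kraus q k v‖ ^ 2) (‖v‖ ^ 2) := by
  have h2 : 0 ≤ 1 - q ^ 2 := by nlinarith
  refine hasSum_comm_of_nonneg (f := fun N k =>
    (1 - q ^ 2) ^ k * (q ^ 2) ^ (N - k) * N.choose k * ‖v N‖ ^ 2)
    (fun N k => by positivity) (fun N => ?_) (hasSum_norm_sq v) fun k => ?_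
  · have h3 := hasSum_sum_of_ne_finset_zero (L := SummationFilter.unconditional ℕ) (s := Finset.range (N + 1))
      (f := fun k => (1 - q ^ 2) ^ k * (q ^ 2) ^ (N - k) * N.choose k * ‖v N‖ ^ 2) fun k hk => by
        rw [Nat.choose_eq_zero_of_lt (by simpa using hk)]
        simp
    rwa [← Finset.sum_mul, sum_binomial, one_mul] at h3
  · have h3 := hasSum_norm_sq (kraus q k v)
    rw [← (add_left_injective k).hasSum_iff]
    · refine h3.congr_fun fun m => ?_
      simp only [Function.comp_apply]
      rw [kraus_apply h0 h1, norm_mul, mul_pow, Complex.norm_real, Real.norm_eq_abs, sq_abs,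
        krausCoeff_sq h0 h1, Nat.add_sub_cancel]
    · intro N hN
      have : N < k := by
        by_contra h
        exact hN ⟨N - k, by simp; omega⟩
      rw [Nat.choose_eq_zero_of_lt this]
      simp

/-- The output is defined as the mixture of the vectors `kraus q k (w j)`, so its positivity and
trace come for free; its matrix elements are summed over `j` first. -/
theorem exists_attenuation {ρ : Osc →L[ℂ] Osc} (h : IsDensity ρ) {q : ℝ} (h0 : 0 < q)
    (h1 : q ≤ 1) : ∃ τ, IsDensity τ ∧ ∀ m n, ⟪fock m, τ (fock n)⟫_ℂ = ((q ^ (m + n) : ℝ) : ℂ)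
      * attenuationSeries (fun i j => ⟪fock i, ρ (fock j)⟫_ℂ) m n (1 - q ^ 2) := by
  obtain ⟨w, hw⟩ := h.exists_mixture
  have hsum : HasSum (fun p : ℕ × ℕ => ‖kraus q p.1 (w p.2)‖ ^ 2) 1 := by
    rw [← (Equiv.prodComm ℕ ℕ).hasSum_iff]
    have hs : Summable fun p : ℕ × ℕ => ‖kraus q p.2 (w p.1)‖ ^ 2 :=
      (summable_prod_of_nonneg fun p => by positivity).2
        ⟨fun i => (hasSum_norm_sq_kraus h0.le h1 (w i)).summable, by
          simpa only [(hasSum_norm_sq_kraus h0.le h1 _).tsum_eq] using hw.norm_sq.summable⟩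
    have h3 := hs.hasSum.prod_fiberwise fun i => hasSum_norm_sq_kraus h0.le h1 (w i)
    rw [hw.norm_sq.unique h3]
    exact hs.hasSum
  obtain ⟨τ, hτ⟩ := exists_isMixture hsum
  refine ⟨τ, hτ.isDensity, fun m n => ?_⟩
  have h3 := (hτ.inner (fock m) (fock n)).prod_fiberwise fun k => by
    have h4 := (hw.inner (fock (m + k)) (fock (n + k))).mul_left
      ((krausCoeff q k m * krausCoeff q k n : ℝ) : ℂ)
    refine h4.congr_fun fun j => ?_
    simp only [inner_fock_left, inner_fock_right, kraus_apply h0.le h1, star_mul,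
      Complex.ofReal_mul]
    rw [show star (krausCoeff q k n : ℂ) = krausCoeff q k n from Complex.conj_ofReal _]
    ring
  rw [← h3.tsum_eq, attenuationSeries, ← tsum_mul_left]
  refine tsum_congr fun k => ?_
  rw [krausCoeff_mul h0.le h1, Complex.ofReal_mul, mul_assoc]

theorem ext_of_inner_fock {S T : Osc →L[ℂ] Osc}
    (h : ∀ m n, ⟪fock m, S (fock n)⟫_ℂ = ⟪fock m, T (fock n)⟫_ℂ) : S = T := by
  have h1 : ∀ n, S (fock n) = T (fock n) := fun n => by
    ext m
    simpa only [inner_fock_left] using h m n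
  have h2 := denseRange_incl.equalizer S.continuous T.continuous (by
    funext x
    simp only [Function.comp_apply]
    induction x using Finsupp.induction_linear with
    | zero => simp
    | add f g hf hg => simp only [map_add, hf, hg]
    | single m c => simp only [incl_single, map_smul, h1])
  exact ContinuousLinearMap.ext fun v => congrFun h2 v

/-! ### Solutions of the damped oscillator equation -/

theorem cre_ann_single (n : ℕ) : cre (ann (Finsupp.single n 1)) = Finsupp.single n (n : ℂ) := by
  rw [ann_single, cre_single]
  rcases n with _ | n
  · simp
  · rw [Nat.add_sub_cancel, one_mul, ← Complex.ofReal_mul, Nat.cast_succ,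
      Real.mul_self_sqrt (by positivity)]
    push_cast
    rfl

theorem lindbladForm_damped_fock (k : ℝ) (σ : Osc →L[ℂ] Osc) (m n : ℕ) :
    lindbladForm 0 (aff k 0 0) (aff 0 k 0) σ (Finsupp.single m 1) (Finsupp.single n 1)
      = (k : ℂ) ^ 2 * (((√((m : ℝ) + 1) * √((n : ℝ) + 1) : ℝ) : ℂ)
          * ⟪fock (m + 1), σ (fock (n + 1))⟫_ℂ
        - (1 / 2 : ℂ) * (m + n) * ⟪fock m, σ (fock n)⟫_ℂ) := by
  rw [lindbladForm_damped, cre_ann_single, cre_ann_single, cre_single, cre_single]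
  simp only [incl_single, one_mul, one_smul, map_smul, inner_smul_left, inner_smul_right,
    Complex.conj_ofReal, Complex.conj_natCast]
  push_cast
  ring

theorem isDamped_of_fock {k : ℝ} {σ : ℝ → (Osc →L[ℂ] Osc)} (h0 : ∀ t, 0 ≤ t → IsDensity (σ t))
    (h1 : ∀ t, 0 ≤ t → ∀ m n : ℕ, HasDerivWithinAt (fun s => ⟪fock m, σ s (fock n)⟫_ℂ)
      ((k : ℂ) ^ 2 * (((√((m : ℝ) + 1) * √((n : ℝ) + 1) : ℝ) : ℂ)
          * ⟪fock (m + 1), σ t (fock (n + 1))⟫_ℂ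
        - (1 / 2 : ℂ) * (m + n) * ⟪fock m, σ t (fock n)⟫_ℂ)) (Set.Ici 0) t) :
    IsDamped k σ := by
  refine ⟨h0, fun t ht x y => ?_⟩
  induction x using Finsupp.induction_linear with
  | zero => simpa [lindbladForm] using hasDerivWithinAt_const t (Set.Ici (0 : ℝ)) (0 : ℂ)
  | add x x' hx hx' =>
    simp only [lindbladForm_damped, map_add, inner_add_left] at hx hx' ⊢
    refine (hx.add hx').congr_deriv ?_
    ring
  | single m c =>
    induction y using Finsupp.induction_linear with
    | zero => simpa [lindbladForm] using hasDerivWithinAt_const t (Set.Ici (0 : ℝ)) (0 : ℂ)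
    | add y y' hy hy' =>
      simp only [lindbladForm_damped, map_add, inner_add_right] at hy hy' ⊢
      refine (hy.add hy').congr_deriv ?_
      ring
    | single n d =>
      have e : ∀ (j : ℕ) (b : ℂ), Finsupp.single j b = b • Finsupp.single j (1 : ℂ) := fun j b => by
        simp
      have h2 := ((h1 t ht m n).const_mul (star c)).mul_const d
      rw [← lindbladForm_damped_fock] at h2
      rw [e m c, e n d]
      simp only [lindbladForm_damped, map_smul, inner_smul_left, inner_smul_right, incl_single,
        one_smul] at h2 ⊢
      refine (h2.congr_deriv ?_).congr_of_eventuallyEq ?_ ?_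
      · rw [show star c = (starRingEnd ℂ) c from rfl]
        ring
      · exact Eventually.of_forall fun s => by
          simp only [show star c = (starRingEnd ℂ) c from rfl]
          ring
      · rw [show star c = (starRingEnd ℂ) c from rfl]
        ring

/-- The solution is attenuation with amplitude transmissivity `q t = exp(-k² t / 2)`; negative times
carry no condition and receive a dummy value. -/
theorem exists_isDamped (k : ℝ) {ρ : Osc →L[ℂ] Osc} (h : IsDensity ρ) :
    ∃ σ, IsDamped k σ ∧ σ 0 = ρ := by
  let q : ℝ → ℝ := fun t => Real.exp (-(k ^ 2 / 2) * t)
  have hq0 : ∀ t, 0 < q t := fun t => Real.exp_pos _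
  have hq1 : ∀ t, 0 ≤ t → q t ≤ 1 := fun t ht => by
    rw [Real.exp_le_one_iff]
    nlinarith [mul_nonneg (sq_nonneg k) ht]
  set s : ℕ → ℕ → ℂ := fun i j => ⟪fock i, ρ (fock j)⟫_ℂ
  have hs : ∀ i j, ‖s i j‖ ≤ 1 := fun i j => by
    simpa [norm_fock] using h.norm_inner_le (fock i) (fock j)
  have hex : ∀ t, ∃ τ : Osc →L[ℂ] Osc, 0 ≤ t → IsDensity τ ∧ ∀ m n, ⟪fock m, τ (fock n)⟫_ℂ
      = ((q t ^ (m + n) : ℝ) : ℂ) * attenuationSeries s m n (1 - q t ^ 2) := fun t => by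
    by_cases ht : 0 ≤ t
    · obtain ⟨τ, hτ⟩ := exists_attenuation h (hq0 t) (hq1 t ht)
      exact ⟨τ, fun _ => hτ⟩
    · exact ⟨0, fun h' => absurd h' ht⟩
  choose σ hσ using hex
  refine ⟨σ, isDamped_of_fock (fun t ht => (hσ t ht).1) fun t ht m n => ?_, ?_⟩
  · have hq : HasDerivAt q (-(k ^ 2 / 2) * q t) t := by
      have := ((hasDerivAt_id t).const_mul (-(k ^ 2 / 2))).exp
      refine this.congr_deriv ?_
      simp only [q, id]
      ring
    have hpow : ∀ N : ℕ, HasDerivAt (fun t => q t ^ N) (-(k ^ 2 / 2) * N * q t ^ N) t := fun N => by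
      refine (hq.pow N).congr_deriv ?_
      rcases N with _ | N
      · simp
      · rw [Nat.add_sub_cancel, pow_succ]
        ring
    -- The derivative k² q² of 1 - q² supplies the two extra powers of `q` for the entry (m+1, n+1);
    -- the prefactor q^(m+n) produces the loss term.
    have hz := (hpow 2).const_sub 1
    have hA := (hasDerivAt_attenuationSeries hs m n (z := 1 - q t ^ 2)
      (by nlinarith [hq0 t, hq1 t ht]) (by nlinarith [hq0 t])).scomp t hz
    have hmul := ((hpow (m + n)).ofReal_comp.mul hA).hasDerivWithinAt (s := Set.Ici 0)
    refine (hmul.congr_deriv ?_).congr (fun x hx => (hσ x hx).2 m n) ((hσ t ht).2 m n)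
    rw [(hσ t ht).2, (hσ t ht).2]
    simp only [Function.comp_apply, Complex.real_smul]
    push_cast
    ring
  · refine ext_of_inner_fock fun m n => ?_
    rw [(hσ 0 le_rfl).2, attenuationSeries, tsum_eq_single 0]
    · simp [q, binomWeight, s]
    · intro b hb
      simp [q, hb]

theorem pureState_isDensity {ψ : Osc} (h : ‖ψ‖ = 1) : IsDensity (pureState ψ) :=
  (pureState_isMixture h).isDensity

theorem isDamped_vacuum (k : ℝ) : IsDamped k fun _ => pureState (fock 0) := by
  refine isDamped_of_fock (fun _ _ => pureState_isDensity (norm_fock 0)) fun t _ m n => ?_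
  refine (hasDerivWithinAt_const t _ _).congr_deriv ?_
  simp only [pureState, InnerProductSpace.rankOne_apply, inner_smul_right, inner_fock_left,
    fock_apply]
  rcases m with _ | m <;> rcases n with _ | n <;> simp

/-! ### Populations and convergence of damped solutions -/

/-- Population of the Fock state `|n⟩`. -/
def population (σ : Osc →L[ℂ] Osc) (n : ℕ) : ℝ := (⟪fock n, σ (fock n)⟫_ℂ).re

theorem IsDensity.population_nonneg {σ : Osc →L[ℂ] Osc} (h : IsDensity σ) (n : ℕ) :
    0 ≤ population σ n := (Complex.le_def.1 (h.1.inner_nonneg_right (fock n))).1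

theorem IsDensity.hasSum_population {σ : Osc →L[ℂ] Osc} (h : IsDensity σ) :
    HasSum (population σ) 1 := by
  have h1 := Complex.hasSum_re h.2
  rwa [Complex.one_re] at h1

/-- The diagonal matrix elements couple only to diagonal ones. -/
theorem IsDamped.isDeathFlow {k : ℝ} {σ : ℝ → (Osc →L[ℂ] Osc)} (h : IsDamped k σ) :
    IsDeathFlow (k ^ 2) fun t => population (σ t) where
  nonneg t ht := (h.1 t ht).population_nonneg
  hasSum t ht := (h.1 t ht).hasSum_population
  deriv t ht n := by
    have h1 := h.2 t ht (Finsupp.single n 1) (Finsupp.single n 1)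
    rw [lindbladForm_damped_fock, Real.mul_self_sqrt (by positivity)] at h1
    simp only [incl_single, one_smul] at h1
    refine (Complex.reCLM.hasFDerivAt.comp_hasDerivWithinAt t h1).congr_deriv ?_
    rw [show (k : ℂ) ^ 2 = ((k ^ 2 : ℝ) : ℂ) by push_cast; rfl,
      show (1 / 2 : ℂ) * (n + n) = ((n : ℝ) : ℂ) by push_cast; ring, Complex.reCLM_apply,
      Complex.re_ofReal_mul, Complex.sub_re, Complex.re_ofReal_mul, Complex.re_ofReal_mul]
    rfl

theorem population_pureState_fock (m n : ℕ) :
    population (pureState (fock m)) n = if n = m then 1 else 0 := by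
  simp only [population, pureState, InnerProductSpace.rankOne_apply, inner_smul_right,
    inner_fock_left, fock_apply]
  split_ifs <;> simp_all

theorem IsDamped.tendsto_traceNorm {k : ℝ} (hk : k ≠ 0) {ρ σ : ℝ → (Osc →L[ℂ] Osc)}
    (h : IsDamped k σ) {ψ : Osc} (hψ : ‖ψ‖ = 1) (hρ : ∀ t, 0 ≤ t → IsDensity (ρ t))
    (hρσ : ∀ t, (⟪ψ, ρ t ψ⟫_ℂ).re = population (σ t) 0) :
    Tendsto (fun t => traceNorm (ρ t - pureState ψ)) atTop (𝓝 0) := by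
  have hlim := h.isDeathFlow.tendsto_apply_zero (by positivity)
  rw [ENNReal.tendsto_nhds_zero]
  intro ε hε
  obtain ⟨η, hη0, hη⟩ : ∃ η : ℝ, 0 < η ∧ ENNReal.ofReal η < ε := by
    obtain ⟨r, hr0, hr⟩ := ENNReal.lt_iff_exists_nnreal_btwn.1 hε
    exact ⟨r, by exact_mod_cast hr0, by simpa using hr⟩
  -- For fixed `η` the infidelity term dies out and the bound tends to `η`, which was chosen below
  -- `ε`.
  have h1 : Tendsto (fun t => ENNReal.ofReal (η + (1 - population (σ t) 0) * (η⁻¹ + 1))) atTop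
      (𝓝 (ENNReal.ofReal η)) := by
    refine ENNReal.tendsto_ofReal ?_
    simpa using ((hlim.const_sub 1).mul_const (η⁻¹ + 1)).const_add η
  filter_upwards [h1.eventually_lt_const hη, eventually_ge_atTop 0] with t ht ht0
  have h2 := traceNorm_sub_pureState_le (hρ t ht0) hψ hη0
  rw [hρσ] at h2
  exact h2.trans ht.le

/-- Decay of the first excited state. -/
theorem IsDamped.infidelity_of_fock_one {k : ℝ} {σ : ℝ → (Osc →L[ℂ] Osc)} (h : IsDamped k σ)
    (h0 : σ 0 = pureState (fock 1)) {t : ℝ} (ht : 0 ≤ t) :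
    1 - population (σ t) 0 = Real.exp (-k ^ 2 * t) := by
  rw [h.isDeathFlow.apply_zero (by positivity) ht]
  simp only [h0, population_pureState_fock]
  rw [tsum_eq_single 1 fun n hn => by rw [if_neg hn, zero_mul]]
  simp

/-! ### The Lindblad equation in the frame of the target state -/

theorem conj_symm_pureState (V : Osc ≃ₗᵢ[ℂ] Osc) (ψ : Osc) :
    conj V.symm (pureState ψ) = pureState (V ψ) := by
  ext1 x
  simp [conj_apply, pureState, InnerProductSpace.rankOne_apply, inner_symm_right]

/-- The coefficients of the Lindblad equation whose dark state is `|α, r e^{iφ}⟩`. -/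
structure IsTuned (H L Ld : Module.End ℂ Fin0) (k : ℝ) (α : ℂ) (r φ : ℝ) : Prop where
  ham : H = aff (-Complex.I * ((k ^ 2 / 2 : ℝ) * star α)) (Complex.I * ((k ^ 2 / 2 : ℝ) * α)) 0
  jump : L = aff ((k * Real.cosh r : ℝ)) (Complex.exp (Complex.I * φ) * (k * Real.sinh r : ℝ)) 0
  jumpDag : Ld =
    aff (Complex.exp (-(Complex.I * φ)) * (k * Real.sinh r : ℝ)) ((k * Real.cosh r : ℝ)) 0

theorem star_exp_I_mul (φ : ℝ) :
    star (Complex.exp (Complex.I * φ)) = Complex.exp (-(Complex.I * φ)) := by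
  rw [Complex.star_def, ← Complex.exp_conj, map_mul, Complex.conj_I, Complex.conj_ofReal, neg_mul]

section tuned

variable {H L Ld : Module.End ℂ Fin0} {k : ℝ} {α : ℂ} {r φ : ℝ}

/-- The scalar shift of the jump operator in the frame of the target state. -/
def jumpShift (k : ℝ) (α : ℂ) (r φ : ℝ) : ℂ :=
  k * (Real.cosh r * α + Complex.exp (Complex.I * φ) * Real.sinh r * star α)

theorem exp_mul_exp_neg (φ : ℝ) :
    Complex.exp (Complex.I * φ) * Complex.exp (-(Complex.I * φ)) = 1 := by
  rw [← Complex.exp_add, add_neg_cancel, Complex.exp_zero]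

theorem cosh_sq_sub_sinh_sq (r : ℝ) :
    (Real.cosh r : ℂ) ^ 2 - (Real.sinh r : ℂ) ^ 2 = 1 := by
  exact_mod_cast Real.cosh_sq_sub_sinh_sq r

theorem star_jumpShift : star (jumpShift k α r φ) =
    k * (Real.cosh r * star α + Complex.exp (-(Complex.I * φ)) * Real.sinh r * α) := by
  simp only [jumpShift, star_mul, star_add, star_star, star_exp_I_mul, star_ofReal']
  ring

/-- The transformed Hamiltonian is the one that offsets the scalar shift of the jump operator. Its
constant vanishes because the two contributions proportional to |α|² have opposite signs. -/
theorem IsTuned.intertwines_ham (h : IsTuned H L Ld k α r φ) :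
    Intertwines (squeezeDisplace α (r * Complex.exp (Complex.I * φ))) H
      (aff (-(Complex.I / 2) * k * star (jumpShift k α r φ))
        ((Complex.I / 2) * k * jumpShift k α r φ) (0 : ℝ)) := by
  have := intertwines_squeezeDisplace α r φ (-Complex.I * ((k ^ 2 / 2 : ℝ) * star α))
    (Complex.I * ((k ^ 2 / 2 : ℝ) * α)) 0
  rw [h.ham]
  convert this using 2
  · simp only [star_mul, star_ofReal', Complex.star_def, Complex.conj_I]
    ring
  · simp only [star_mul, star_neg, star_ofReal', Complex.star_def, Complex.conj_I]
    simp only [Complex.conj_conj]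
    ring
  · simp
  · rw [star_jumpShift]
    push_cast
    ring
  · rw [jumpShift]
    push_cast
    ring
  · push_cast
    ring

/-- With coefficients proportional to cosh r and e^{iφ} sinh r, the Bogoliubov transformation undoes
the mixing of a and a†; cosh² - sinh² = 1 leaves `k`. -/
theorem IsTuned.intertwines_jump (h : IsTuned H L Ld k α r φ) :
    Intertwines (squeezeDisplace α (r * Complex.exp (Complex.I * φ))) L
      (aff 0 k (star (jumpShift k α r φ))) := by
  have := intertwines_squeezeDisplace α r φ
    (Complex.exp (-(Complex.I * φ)) * (k * Real.sinh r : ℝ)) ((k * Real.cosh r : ℝ)) 0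
  rw [h.jump]
  convert this using 2
  · rw [star_ofReal']
  · rw [star_mul, ← star_exp_I_mul, star_star, star_ofReal', mul_comm]
  · simp
  · push_cast
    ring
  · rw [Complex.ofReal_mul, Complex.ofReal_mul]
    linear_combination (-(k : ℂ)) * cosh_sq_sub_sinh_sq r
      + k * (Real.sinh r : ℂ) ^ 2 * exp_mul_exp_neg φ
  · rw [star_jumpShift]
    push_cast
    ring

theorem IsTuned.intertwines_jumpDag (h : IsTuned H L Ld k α r φ) :
    Intertwines (squeezeDisplace α (r * Complex.exp (Complex.I * φ))) Ld
      (aff k 0 (jumpShift k α r φ)) := by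
  have := intertwines_squeezeDisplace α r φ ((k * Real.cosh r : ℝ))
    (Complex.exp (Complex.I * φ) * (k * Real.sinh r : ℝ)) 0
  rw [h.jumpDag]
  convert this using 2
  · rw [star_mul, star_exp_I_mul, star_ofReal', mul_comm]
  · rw [star_ofReal']
  · simp
  · rw [Complex.ofReal_mul, Complex.ofReal_mul]
    linear_combination (-(k : ℂ)) * cosh_sq_sub_sinh_sq r
      + k * (Real.sinh r : ℂ) ^ 2 * exp_mul_exp_neg φ
  · push_cast
    ring
  · rw [jumpShift]
    push_cast
    ring

theorem IsTuned.fadj_ham (h : IsTuned H L Ld k α r φ) : FAdj H H := by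
  have := fadj_aff (-Complex.I * ((k ^ 2 / 2 : ℝ) * star α)) (Complex.I * ((k ^ 2 / 2 : ℝ) * α)) 0
  rw [h.ham]
  convert this using 2
  · simp only [star_mul, star_ofReal', Complex.star_def, Complex.conj_I]
    ring
  · simp only [star_mul, star_neg, star_ofReal', Complex.star_def, Complex.conj_I]
    simp only [Complex.conj_conj]
    ring
  · simp

theorem IsTuned.fadj_jump (h : IsTuned H L Ld k α r φ) : FAdj L Ld := by
  have := fadj_aff ((k * Real.cosh r : ℝ)) (Complex.exp (Complex.I * φ) * (k * Real.sinh r : ℝ)) 0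
  rw [h.jump, h.jumpDag]
  convert this using 2
  · rw [star_mul, star_exp_I_mul, star_ofReal', mul_comm]
  · rw [star_ofReal']
  · simp

theorem isDamped_iff_shift (k : ℝ) (l : ℂ) {σ : ℝ → (Osc →L[ℂ] Osc)} :
    IsWeakSolution (aff (-(Complex.I / 2) * k * star l) ((Complex.I / 2) * k * l) (0 : ℝ))
      (aff k 0 l) (aff 0 k (star l)) σ ↔ IsDamped k σ := by
  simp only [IsDamped, IsWeakSolution, lindbladForm_shift]

theorem IsTuned.isDamped_conj (h : IsTuned H L Ld k α r φ) {ρ : ℝ → (Osc →L[ℂ] Osc)}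
    (hρ : IsWeakSolution H L Ld ρ) :
    IsDamped k fun t => conj (squeezeDisplace α (r * Complex.exp (Complex.I * φ))) (ρ t) := by
  rw [← isDamped_iff_shift k (jumpShift k α r φ)]
  refine hρ.conj h.fadj_ham h.fadj_jump ?_ ?_ ?_ h.intertwines_ham h.intertwines_jump
    h.intertwines_jumpDag (dom_squeezeDisplace _ _)
  · rw [h.ham]
    exact deg2_aff _ _ _
  · rw [h.jumpDag]
    exact deg2_aff _ _ _
  · rw [h.jumpDag, h.jump]
    exact deg2_aff_mul_aff _ _ _ _ _ _

theorem IsTuned.isWeakSolution_conj (h : IsTuned H L Ld k α r φ) {σ : ℝ → (Osc →L[ℂ] Osc)}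
    (hσ : IsDamped k σ) : IsWeakSolution H L Ld fun t =>
      conj (squeezeDisplace α (r * Complex.exp (Complex.I * φ))).symm (σ t) := by
  rw [← isDamped_iff_shift k (jumpShift k α r φ)] at hσ
  refine hσ.conj ?_ ?_ (deg2_aff _ _ _) (deg2_aff _ _ _) (deg2_aff_mul_aff _ _ _ _ _ _)
    h.intertwines_ham.symm h.intertwines_jumpDag.symm h.intertwines_jump.symm
    (dom_squeezeDisplace_symm _ _)
  · have := fadj_aff (-(Complex.I / 2) * k * star (jumpShift k α r φ))
      ((Complex.I / 2) * k * jumpShift k α r φ) (0 : ℝ)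
    convert this using 2
    · simp only [star_mul, star_ofReal', star_div₀, Complex.star_def, Complex.conj_I,
        Complex.conj_ofNat]
      ring
    · simp only [star_mul, star_neg, star_ofReal', star_div₀, Complex.star_def, Complex.conj_I,
        Complex.conj_ofNat, Complex.conj_conj]
      ring
    · simp
  · have := fadj_aff (k : ℂ) 0 (jumpShift k α r φ)
    rwa [star_zero, star_ofReal'] at this

end tuned

theorem excitation_eq (α ζ : ℂ) (ρ : Osc →L[ℂ] Osc) : excitation α ζ ρ =
    ∑' n : ℕ, ENNReal.ofReal (n * population (conj (squeezeDisplace α ζ) ρ) n) := by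
  simp only [population, inner_conj]
  rfl

theorem infidelity_eq (α ζ : ℂ) (ρ : Osc →L[ℂ] Osc) :
    infidelity α ζ ρ = 1 - population (conj (squeezeDisplace α ζ) ρ) 0 := by
  simp only [population, inner_conj]
  rfl

/-- Excitation number, infidelity and distance to the target are quantities of the damped oscillator
in the target frame, so all clauses are read off there. -/
theorem stabilizes_of_isTuned {θ k : ℝ} {β : PairState} {α : ℂ} {r φ : ℝ}
    (h : IsTuned (hamiltonian θ β) (jump θ β) (jumpDag θ β) k α r φ) (hk : k ≠ 0) :
    Stabilizes θ β α (r * Complex.exp (Complex.I * φ)) (k ^ 2) := by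
  set ζ := (r : ℂ) * Complex.exp (Complex.I * φ) with hζ
  set V := squeezeDisplace α ζ with hV
  have hV0 : squeezedCoherent α ζ = V (fock 0) := rfl
  have hnorm : ‖squeezedCoherent α ζ‖ = 1 := by rw [hV0, V.norm_map, norm_fock]
  have hcs : ∀ σ, conj V (conj V.symm σ) = σ := conj_symm_conj V.symm
  have hk2 : 0 < k ^ 2 := by positivity
  refine ⟨hk2, fun ρ₀ hρ₀ => ?_, ?_, fun ρ hρ => ?_, ?_⟩
  · obtain ⟨σ, hσ, h0⟩ := exists_isDamped k (hρ₀.conj V)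
    exact ⟨_, h.isWeakSolution_conj hσ, by simp only [h0]; exact conj_symm_conj V ρ₀⟩
  · have := h.isWeakSolution_conj (isDamped_vacuum k)
    rw [conj_symm_pureState] at this
    exact this
  · have hσ := h.isDamped_conj hρ
    refine ⟨hσ.tendsto_traceNorm hk hnorm hρ.1 fun t => ?_, fun t ht => ?_⟩
    · rw [population, inner_conj, hV0]
    · have hm := hσ.isDeathFlow.mean hk2.le ht
      rw [excitation_eq, excitation_eq, infidelity_eq, ← hm]
      exact ⟨rfl, ofReal_one_sub_le_mean (hσ.1 t ht).population_nonneg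
        (hσ.1 t ht).hasSum_population⟩
  -- The extremal solution starts in the first excited state above the target.
  · obtain ⟨σ, hσ, h0⟩ := exists_isDamped k (pureState_isDensity (norm_fock 1))
    refine ⟨_, h.isWeakSolution_conj hσ, ?_, fun t ht => ?_⟩
    · rw [excitation_eq, hcs, h0, tsum_eq_single 1]
      · simp [population_pureState_fock]
      · intro n hn
        simp [population_pureState_fock, hn]
    · rw [infidelity_eq, hcs]
      exact hσ.infidelity_of_fock_one h0 ht

/-! ### The tuning formulas -/

theorem exp_I_mul (x : ℝ) :
    Complex.exp (Complex.I * x) = (Real.cos x : ℂ) + (Real.sin x : ℂ) * Complex.I := by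
  rw [mul_comm, Complex.exp_mul_I]
  push_cast
  rfl

/-- The relation between the angles and the squeezing strength: `tan u = -tanh r`, and
`e^{iφα} + e^{i(φr - φα)} tanh r` has modulus `R` and argument `χ`. -/
structure IsBranch (r φα φr u χ R : ℝ) : Prop where
  cos_pos : 0 < Real.cos u
  sin_eq : Real.sin u = -(Real.tanh r * Real.cos u)
  pos : 0 < R
  re_eq : Real.cos φα + Real.tanh r * Real.cos (φα - φr) = R * Real.cos χ
  im_eq : Real.sin φα - Real.tanh r * Real.sin (φα - φr) = R * Real.sin χ

/-- `R` is the projection of (denominator, numerator) on (cos χ, sin χ); it is positive by `hχ'`,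
and by `hχ` the two vectors are parallel. -/
theorem exists_isBranch {r φα φr u χ : ℝ} (hu : u ∈ Set.Ioo (-(Real.pi / 4)) (Real.pi / 4))
    (hur : Real.tan u = -Real.tanh r)
    (hχ : Real.sin χ * (Real.cos φα + Real.tanh r * Real.cos (φα - φr)) =
      Real.cos χ * (Real.sin φα - Real.tanh r * Real.sin (φα - φr)))
    (hχ' : 0 < Real.cos χ * (Real.cos φα + Real.tanh r * Real.cos (φα - φr)) +
      Real.sin χ * (Real.sin φα - Real.tanh r * Real.sin (φα - φr))) :
    ∃ R, IsBranch r φα φr u χ R := by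
  have hpi := Real.pi_pos
  have hcos : 0 < Real.cos u :=
    Real.cos_pos_of_mem_Ioo ⟨by linarith [hu.1], by linarith [hu.2]⟩
  have h1 := Real.sin_sq_add_cos_sq χ
  refine ⟨_, hcos, ?_, hχ', ?_, ?_⟩
  · rw [← Real.tan_mul_cos hcos.ne', hur]
    ring
  · linear_combination
      (-(Real.cos φα + Real.tanh r * Real.cos (φα - φr))) * h1 + Real.sin χ * hχ
  · linear_combination
      (-(Real.sin φα - Real.tanh r * Real.sin (φα - φr))) * h1 - Real.cos χ * hχ

theorem one_sub_tanh_sq (r : ℝ) : (1 - Real.tanh r ^ 2) * Real.cosh r ^ 2 = 1 := by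
  have h := Real.cosh_pos r
  have h2 := Real.cosh_sq_sub_sinh_sq r
  rw [Real.tanh_eq_sinh_div_cosh]
  field_simp
  exact h2

section branch

variable {r φα φr u χ R : ℝ}

theorem IsBranch.cos_sq (h : IsBranch r φα φr u χ R) :
    Real.cos u ^ 2 * (1 + Real.tanh r ^ 2) = 1 := by
  have h1 := Real.sin_sq_add_cos_sq u
  rw [h.sin_eq] at h1
  linarith

/-- With t = tanh r and C = cos(2φ_α - φ_r), R² = 1 + t² + 2tC and R² cos(φ_r - 2χ) = (1 + t²)C +
2t. The unknown C drops out of the combination. -/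
theorem IsBranch.radius_sq_mul (h : IsBranch r φα φr u χ R) :
    R ^ 2 * (1 + Real.tanh r ^ 2 - 2 * Real.tanh r * Real.cos (φr - 2 * χ))
      = (1 - Real.tanh r ^ 2) ^ 2 := by
  have hD := h.re_eq
  have hN := h.im_eq
  obtain ⟨b, rfl⟩ : ∃ b, φr = φα + b := ⟨φr - φα, by ring⟩
  rw [show φα - (φα + b) = -b by ring, Real.cos_neg] at hD
  rw [show φα - (φα + b) = -b by ring, Real.sin_neg] at hN
  set t := Real.tanh r
  set ca := Real.cos φα
  set sa := Real.sin φα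
  set cb := Real.cos b
  set sb := Real.sin b
  have ha : sa ^ 2 + ca ^ 2 = 1 := Real.sin_sq_add_cos_sq φα
  have hb : sb ^ 2 + cb ^ 2 = 1 := Real.sin_sq_add_cos_sq b
  have hx := Real.sin_sq_add_cos_sq χ
  have e1 : R ^ 2 = (ca + t * cb) ^ 2 + (sa - t * -sb) ^ 2 := by
    rw [hD, hN]
    linear_combination (-R ^ 2) * hx
  have e2 : R ^ 2 * Real.cos (φα + b - 2 * χ) = (ca * cb - sa * sb)
      * ((ca + t * cb) ^ 2 - (sa - t * -sb) ^ 2)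
      + 2 * (sa * cb + ca * sb) * ((ca + t * cb) * (sa - t * -sb)) := by
    rw [hD, hN, Real.cos_sub, Real.cos_add, Real.sin_add, Real.cos_two_mul', Real.sin_two_mul]
    ring
  set C := ca * cb + sa * sb with hC
  have e3 : (ca + t * cb) ^ 2 + (sa - t * -sb) ^ 2 = 1 + t ^ 2 + 2 * t * C := by
    rw [hC]
    linear_combination ha + t ^ 2 * hb
  have e4 : (ca * cb - sa * sb) * ((ca + t * cb) ^ 2 - (sa - t * -sb) ^ 2)
      + 2 * (sa * cb + ca * sb) * ((ca + t * cb) * (sa - t * -sb))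
      = (1 + t ^ 2) * C + 2 * t := by
    rw [hC]
    linear_combination (ca * cb + sa * sb) * ha + t ^ 2 * (ca * cb + sa * sb) * hb
      + 2 * t * (ha * (sb ^ 2 + cb ^ 2) + hb)
  linear_combination (1 + t ^ 2) * (e1.trans e3) - 2 * t * (e2.trans e4)

theorem one_sub_tanh_sq_pos (r : ℝ) : 0 < 1 - Real.tanh r ^ 2 := by
  have h1 := one_sub_tanh_sq r
  have h2 := sq_pos_of_pos (Real.cosh_pos r)
  by_contra h
  nlinarith [not_lt.1 h]

/-- The radicand is (R cos u)²: numerator and denominator share the factor 1 + cos(φ_r - 2χ) sin 2u.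
-/
theorem IsBranch.tuning_eq (h : IsBranch r φα φr u χ R) (θ : ℝ) (α : ℂ) :
    tuning θ α φr u χ = θ * ‖α‖ / √2 * (R * Real.cos u) := by
  unfold tuning
  congr 1
  have hc := h.cos_pos
  have hR := h.pos
  have h1 := h.cos_sq
  have h2 := h.radius_sq_mul
  have h3 := one_sub_tanh_sq_pos r
  set t := Real.tanh r
  set X := 1 + t ^ 2 - 2 * t * Real.cos (φr - 2 * χ) with hX
  have hX0 : 0 < X := by
    by_contra h0
    nlinarith [sq_pos_of_pos h3, sq_pos_of_pos hR, not_lt.1 h0]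
  have hs : Real.sin (2 * u) = -(2 * t * Real.cos u ^ 2) := by
    rw [Real.sin_two_mul, h.sin_eq]
    ring
  have hden : 1 + Real.cos (φr - 2 * χ) * Real.sin (2 * u) = Real.cos u ^ 2 * X := by
    rw [hs, hX]
    linear_combination -h1
  have hnum : (1 + Real.sin (2 * u)) * (1 - Real.sin (2 * u))
      = (R * Real.cos u) ^ 2 * (Real.cos u ^ 2 * X) := by
    rw [hs]
    linear_combination Real.cos u ^ 4 * (-h2)
      - (Real.cos u ^ 2 * (1 + t ^ 2) + 1) * h1
  rw [hden, hnum, mul_div_assoc, div_self (by positivity), mul_one, Real.sqrt_sq (by positivity)]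

theorem IsBranch.exp_eq (h : IsBranch r φα φr u χ R) :
    (R : ℂ) * Complex.exp (Complex.I * χ) = Complex.exp (Complex.I * φα)
      + Real.tanh r * (Complex.exp (Complex.I * φr) * Complex.exp (-(Complex.I * φα))) := by
  have e : Complex.exp (Complex.I * φr) * Complex.exp (-(Complex.I * φα))
      = Complex.exp (Complex.I * ((-(φα - φr) : ℝ) : ℂ)) := by
    rw [← Complex.exp_add]
    congr 1
    push_cast
    ring
  rw [e, exp_I_mul, exp_I_mul, exp_I_mul, Real.cos_neg, Real.sin_neg]
  have h1 := congrArg (fun x : ℝ => (x : ℂ)) h.re_eq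
  have h2 := congrArg (fun x : ℝ => (x : ℂ)) h.im_eq
  simp only [Complex.ofReal_add, Complex.ofReal_mul, Complex.ofReal_sub] at h1 h2
  rw [Complex.ofReal_neg]
  linear_combination -h1 - Complex.I * h2

/-- The conjugate of `exp_eq` minus tanh r e^{-iφ_r} times `exp_eq` eliminates e^{iφ_α}. The left
side is the phase factor of `qCoeff`, which is thus aligned with the conjugate of α. -/
theorem IsBranch.exp_neg_sub (h : IsBranch r φα φr u χ R) :
    (R : ℂ) * (Complex.exp (-(Complex.I * χ))
        - Real.tanh r * (Complex.exp (-(Complex.I * φr)) * Complex.exp (Complex.I * χ)))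
      = (1 - (Real.tanh r : ℂ) ^ 2) * Complex.exp (-(Complex.I * φα)) := by
  have h1 := h.exp_eq
  have h2 := congrArg star h1
  simp only [star_mul, star_add, star_exp_I_mul, star_ofReal'] at h2
  rw [← star_exp_I_mul φα, star_star, star_exp_I_mul φα] at h2
  have h3 := exp_mul_exp_neg φr
  linear_combination h2 - Real.tanh r * Complex.exp (-(Complex.I * φr)) * h1
    - (Real.tanh r : ℂ) ^ 2 * Complex.exp (-(Complex.I * φα)) * h3

/-! ### Matching the pair amplitudes with the tuned coefficients -/

/-- The damping amplitude in the frame of the target state. -/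
def dampingAmplitude (θ ε u r : ℝ) : ℝ := √2 * θ * (Real.cos ε * Real.cos u) / Real.cosh r

theorem dampingAmplitude_mul_cosh (θ ε u r : ℝ) :
    dampingAmplitude θ ε u r * Real.cosh r = √2 * θ * (Real.cos ε * Real.cos u) :=
  div_mul_cancel₀ _ (Real.cosh_pos r).ne'

theorem dampingAmplitude_sq (θ ε u r : ℝ) : dampingAmplitude θ ε u r ^ 2
    = 2 * θ ^ 2 * Real.cos ε ^ 2 * Real.cos u ^ 2 * (1 - Real.tanh r ^ 2) := by
  have h1 := one_sub_tanh_sq r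
  have h2 : √2 ^ 2 = (2 : ℝ) := Real.sq_sqrt zero_le_two
  have h3 := Real.cosh_pos r
  have h4 : 1 - Real.tanh r ^ 2 = 1 / Real.cosh r ^ 2 := by
    rw [eq_div_iff (by positivity), h1]
  rw [h4, dampingAmplitude, div_pow, mul_pow, mul_pow, h2]
  ring

theorem IsBranch.dampingAmplitude_mul_sinh (h : IsBranch r φα φr u χ R) (θ ε : ℝ) :
    dampingAmplitude θ ε u r * Real.sinh r = -(√2 * θ * (Real.cos ε * Real.sin u)) := by
  have h1 := (Real.cosh_pos r).ne'
  rw [h.sin_eq, Real.tanh_eq_sinh_div_cosh, dampingAmplitude]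
  field_simp

theorem IsBranch.dampingAmplitude_sq_eq_rate (h : IsBranch r φα φr u χ R) (θ ε : ℝ) :
    dampingAmplitude θ ε u r ^ 2 = rate θ r * Real.cos ε ^ 2 := by
  have h1 : Real.tanh |r| ^ 2 = Real.tanh r ^ 2 := by
    rcases abs_choice r with h | h <;> simp [h]
  have h2 : Real.cos u ^ 2 = 1 / (1 + Real.tanh r ^ 2) := by
    rw [eq_div_iff (by positivity), h.cos_sq]
  rw [dampingAmplitude_sq, rate, h1, h2]
  ring

/-- The phases agree by the choice of χ, and `hm` is what equality of the moduli requires; `m` is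
left free to serve both tunings. -/
theorem IsBranch.coupling_mul_qCoeff (h : IsBranch r φα φr u χ R) {θ ε m : ℝ}
    (hm : √2 * Real.sin ε = R * θ * Real.cos ε * Real.cos u * m) :
    (θ : ℂ) * qCoeff (pairState ε u φr χ) = (dampingAmplitude θ ε u r ^ 2 / 2 : ℝ)
      * star (m * Complex.exp (Complex.I * φα)) := by
  have h1 := h.exp_neg_sub
  have hs2 : √2 * √2 = (2 : ℝ) := Real.mul_self_sqrt zero_le_two
  have hs : Real.sin ε / √2 = √2 * Real.sin ε / 2 := by
    rw [div_eq_div_iff (by positivity) two_ne_zero]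
    linear_combination (-Real.sin ε) * hs2
  have hR : (R : ℂ) ≠ 0 := Complex.ofReal_ne_zero.2 h.pos.ne'
  have hmC := congrArg (fun x : ℝ => (x : ℂ)) hm
  simp only [Complex.ofReal_mul] at hmC
  have hsC := congrArg (fun x : ℝ => (x : ℂ)) h.sin_eq
  simp only [Complex.ofReal_mul, Complex.ofReal_neg] at hsC
  refine mul_left_cancel₀ hR ?_
  rw [dampingAmplitude_sq]
  simp only [qCoeff, pairState, star_mul, star_exp_I_mul, star_ofReal', hs]
  simp only [Complex.ofReal_mul, Complex.ofReal_div, Complex.ofReal_sub, Complex.ofReal_pow,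
    Complex.ofReal_one, Complex.ofReal_ofNat, hsC]
  linear_combination (θ * Real.cos ε * Real.cos u * (√2 * Real.sin ε : ℂ)) * h1
    + θ * Real.cos ε * Real.cos u * (1 - (Real.tanh r : ℂ) ^ 2)
      * Complex.exp (-(Complex.I * φα)) * hmC

theorem hamiltonian_eq_aff (θ : ℝ) (β : PairState) : hamiltonian θ β =
    aff (-Complex.I * (θ * qCoeff β)) (Complex.I * star (θ * qCoeff β)) 0 := by
  rw [star_mul, star_ofReal']
  simp only [hamiltonian, linDag, lin, aff, star_zero]
  module

theorem IsBranch.isTuned (h : IsBranch r φα φr u χ R) {θ ε m : ℝ}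
    (hm : √2 * Real.sin ε = R * θ * Real.cos ε * Real.cos u * m) :
    IsTuned (hamiltonian θ (pairState ε u φr χ)) (jump θ (pairState ε u φr χ))
      (jumpDag θ (pairState ε u φr χ)) (dampingAmplitude θ ε u r)
      (m * Complex.exp (Complex.I * φα)) r φr := by
  have hc : ((√2 * θ : ℝ) : ℂ) * (pairState ε u φr χ).gg
      = (dampingAmplitude θ ε u r * Real.cosh r : ℝ) := by
    rw [dampingAmplitude_mul_cosh, pairState, ← Complex.ofReal_mul]
  have hd : -(((√2 * θ : ℝ) : ℂ) * (pairState ε u φr χ).ee) = Complex.exp (Complex.I * φr)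
      * (dampingAmplitude θ ε u r * Real.sinh r : ℝ) := by
    rw [h.dampingAmplitude_mul_sinh]
    simp only [pairState, Complex.ofReal_mul, Complex.ofReal_neg]
    ring
  refine ⟨?_, ?_, ?_⟩
  · have h1 : ∀ (a : ℝ) (z : ℂ), star ((a : ℂ) * star z) = a * z := fun a z => by
      rw [star_mul, star_star, star_ofReal', mul_comm]
    rw [hamiltonian_eq_aff, h.coupling_mul_qCoeff hm, h1]
  · rw [jump, lin_eq_aff, hc, hd]
  · rw [jumpDag, linDag, lin_eq_aff, hc, hd, star_mul, star_exp_I_mul, star_ofReal',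
      star_ofReal', mul_comm]

theorem IsBranch.stabilizes (h : IsBranch r φα φr u χ R) {θ ε m : ℝ} (hθ : 0 < θ)
    (hε : Real.cos ε ≠ 0) (hm : √2 * Real.sin ε = R * θ * Real.cos ε * Real.cos u * m) :
    Stabilizes θ (pairState ε u φr χ) (m * Complex.exp (Complex.I * φα))
      (r * Complex.exp (Complex.I * φr)) (rate θ r * Real.cos ε ^ 2) := by
  rw [← h.dampingAmplitude_sq_eq_rate]
  refine stabilizes_of_isTuned (h.isTuned hm) ?_
  have h1 := h.cos_pos.ne'
  have h2 := (Real.cosh_pos r).ne'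
  unfold dampingAmplitude
  positivity

end branch

/-! ### Leading-order asymptotics -/

/-- From sin x ≤ x and cos x ≥ 1 - x²/2, since (1 + x²)(1 - x²/2) ≥ 1 for x ≤ 1. -/
theorem abs_tan_div_self_sub_one_le {x : ℝ} (h0 : 0 < x) (h1 : x ≤ 1) :
    |Real.tan x / x - 1| ≤ x ^ 2 := by
  have hpi : x < Real.pi / 2 := by linarith [Real.pi_gt_three]
  have hlt := Real.lt_tan h0 hpi
  have hcos := Real.one_sub_sq_div_two_le_cos (x := x)
  have hsin := Real.sin_le h0.le
  have hc : 0 < Real.cos x := by nlinarith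
  have h2 : Real.tan x ≤ (1 + x ^ 2) * x := by
    rw [Real.tan_eq_sin_div_cos, div_le_iff₀ hc]
    have : x ≤ (1 + x ^ 2) * x * (1 - x ^ 2 / 2) := by
      nlinarith [mul_pos h0 (pow_pos h0 2), pow_le_one₀ (n := 2) h0.le h1]
    calc _ ≤ x := hsin
      _ ≤ _ := this
      _ ≤ _ := mul_le_mul_of_nonneg_left hcos (by positivity)
  rw [abs_of_nonneg]
  · have := (div_le_iff₀ h0).2 h2
    linarith
  · have := (one_le_div h0).2 hlt.le
    linarith

theorem isBigO_tan_div_sub_one {C : ℝ} (hC : 0 < C) :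
    (fun θ : ℝ => Real.tan (C * θ) / (C * θ) - 1) =O[𝓝[>] 0] fun θ : ℝ => θ ^ 2 := by
  refine IsBigO.of_bound (C ^ 2) ?_
  have h1 : ∀ᶠ θ : ℝ in 𝓝[>] 0, θ < C⁻¹ :=
    nhdsWithin_le_nhds (gt_mem_nhds (by positivity))
  filter_upwards [h1, self_mem_nhdsWithin] with θ h2 h3
  have h3' : 0 < θ := h3
  rw [Real.norm_eq_abs, Real.norm_of_nonneg (by positivity), ← mul_pow]
  refine abs_tan_div_self_sub_one_le (by positivity) ?_
  rw [mul_comm]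
  exact ((lt_inv_mul_iff₀ hC).1 (by simpa using h2)).le.trans' (by rw [mul_comm])

theorem rate_pos {θ : ℝ} (hθ : 0 < θ) (r : ℝ) : 0 < rate θ r := by
  have := one_sub_tanh_sq_pos |r|
  unfold rate
  positivity

end SqueezedReservoir

end


/-! ### The main theorem -/

open SqueezedReservoir in
theorem theorem1
    (α : ℂ) (φα r φr μ u χ : ℝ)
    -- the target `|α, r e^{iφ_r}⟩`, with `α = |α| e^{iφ_α}`
    (hα : α = (‖α‖ : ℂ) * Complex.exp (Complex.I * φα))
    (hμ : μ = φr)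
    (hu : u ∈ Set.Ioo (-(Real.pi / 4)) (Real.pi / 4)) (hur : Real.tan u = -Real.tanh r)
    -- `tan χ = num / den`, multiplied out because `den` may vanish
    (hχ : Real.sin χ * (Real.cos φα + Real.tanh r * Real.cos (φα - φr)) =
      Real.cos χ * (Real.sin φα - Real.tanh r * Real.sin (φα - φr)))
    -- `χ` lies on the branch with `(cos χ, sin χ)` pointing along `(den, num)`
    (hχ' : 0 < Real.cos χ * (Real.cos φα + Real.tanh r * Real.cos (φα - φr)) +
      Real.sin χ * (Real.sin φα - Real.tanh r * Real.sin (φα - φr))) :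
    -- the displacement and squeezing operators are well defined
    (∀ γ : ℂ, ∃! V, IsUnitaryExp (displacementGen γ) V) ∧
    (∀ ζ : ℂ, ∃! V, IsUnitaryExp (squeezingGen ζ) V) ∧
    -- exact tuning
    (∀ θ ε : ℝ, 0 < θ → ε ∈ Set.Ioo (-(Real.pi / 2)) (Real.pi / 2) →
      Real.tan ε = tuning θ α φr u χ →
      Stabilizes θ (pairState ε u μ χ) α (r * Complex.exp (Complex.I * φr))
        (rate θ r * Real.cos ε ^ 2)) ∧
    -- the leading-order tuning
    (∀ θ ε : ℝ, 0 < θ → ε = tuning θ α φr u χ → Real.cos ε ≠ 0 →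
      Stabilizes θ (pairState ε u μ χ) (((Real.tan ε / ε : ℝ) : ℂ) * α)
        (r * Complex.exp (Complex.I * φr)) (rate θ r * Real.cos ε ^ 2)) ∧
    -- its stabilized state and its rate agree with `|α, r e^{iφ_r}⟩` and `κ` to leading order
    (∀ ε : ℝ → ℝ, (∀ θ : ℝ, ε θ = tuning θ α φr u χ) →
      ((fun θ : ℝ => ((Real.tan (ε θ) / ε θ : ℝ) : ℂ) * α - α) =O[𝓝[>] 0]
        fun θ : ℝ => θ ^ 2) ∧
      ((fun θ : ℝ =>
          squeezedCoherent (((Real.tan (ε θ) / ε θ : ℝ) : ℂ) * α)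
              (r * Complex.exp (Complex.I * φr)) -
            squeezedCoherent α (r * Complex.exp (Complex.I * φr))) =O[𝓝[>] 0]
        fun θ : ℝ => θ ^ 2) ∧
      ((fun θ : ℝ => rate θ r * Real.cos (ε θ) ^ 2 / rate θ r - 1) =O[𝓝[>] 0]
        fun θ : ℝ => θ ^ 2)) := by
  subst hμ
  obtain ⟨R, h⟩ := exists_isBranch hu hur hχ hχ'
  have hs2 : √2 * √2 = (2 : ℝ) := Real.mul_self_sqrt zero_le_two
  have hs0 : √2 ≠ (0 : ℝ) := by positivity
  have hR := h.pos
  have hcu := h.cos_pos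
  refine ⟨fun γ => (hasDecayGroup_displacementGen γ).existsUnique,
    fun ζ => (hasDecayGroup_squeezingGen ζ).existsUnique, fun θ ε hθ hε ht => ?_,
    fun θ ε hθ ht hε => ?_, fun ε hε => ?_⟩
  · have hc : Real.cos ε ≠ 0 := (Real.cos_pos_of_mem_Ioo hε).ne'
    rw [h.tuning_eq] at ht
    have := h.stabilizes (m := ‖α‖) hθ hc (by
      rw [← Real.tan_mul_cos hc, ht]
      field_simp)
    rwa [← hα] at this
  · rw [h.tuning_eq] at ht
    have := h.stabilizes (m := Real.tan ε / ε * ‖α‖) hθ hε (by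
      have h1 : ε * √2 = θ * ‖α‖ * (R * Real.cos u) := by
        nth_rewrite 1 [ht]
        field_simp
      -- At `ε = 0`, which forces α = 0, the quotient has the default value 0 and the identity still
      -- holds.
      have h2 : Real.tan ε = Real.tan ε / ε * ε := by
        rcases eq_or_ne ε 0 with h0 | h0
        · simp [h0]
        · rw [div_mul_cancel₀ _ h0]
      rw [← Real.tan_mul_cos hε]
      nth_rewrite 1 [h2]
      linear_combination Real.tan ε / ε * Real.cos ε * h1)
    rwa [Complex.ofReal_mul, mul_assoc, ← hα] at this
  · set C := ‖α‖ / √2 * (R * Real.cos u) with hC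
    -- The leading-order tuning is linear in `θ`, so expansions in `ε` are expansions in `θ`.
    obtain rfl : ε = fun θ => C * θ := by
      funext θ
      rw [hε, h.tuning_eq, hC]
      ring
    have hdiff : ∀ x : ℝ, (x : ℂ) * α - α = ((x - 1 : ℝ) : ℂ) * α := fun x => by
      push_cast
      ring
    refine ⟨?_, ?_, ?_⟩
    · simp only [hdiff]
      rcases eq_or_ne α 0 with h0 | h0
      · simpa only [h0, mul_zero] using isBigO_zero _ _
      · have hC0 : 0 < C := by
          have := norm_pos_iff.2 h0
          positivity
        refine IsBigO.trans (IsBigO.of_bound ‖α‖ (Eventually.of_forall fun θ => ?_))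
          (isBigO_tan_div_sub_one hC0)
        rw [norm_mul, Complex.norm_real, mul_comm]
    · rcases eq_or_ne α 0 with h0 | h0
      · simpa only [h0, mul_zero, sub_self] using isBigO_zero _ _
      · have hC0 : 0 < C := by
          have := norm_pos_iff.2 h0
          positivity
        obtain ⟨K, hK⟩ := exists_norm_squeezedCoherent_sub_le α (r * Complex.exp (Complex.I * μ))
        exact IsBigO.trans (IsBigO.of_bound K (Eventually.of_forall fun θ => hK _))
          (isBigO_tan_div_sub_one hC0)
    · refine IsBigO.of_bound (C ^ 2) ?_
      filter_upwards [self_mem_nhdsWithin] with θ hθ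
      -- The relative error of the rate is exactly -sin² ε.
      rw [mul_div_cancel_left₀ _ (rate_pos hθ r).ne', Real.cos_sq', sub_sub_cancel_left, norm_neg,
        Real.norm_of_nonneg (sq_nonneg _), Real.norm_of_nonneg (sq_nonneg _), ← mul_pow]
      exact sq_le_sq.2 Real.abs_sin_le_abs
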